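/- Let $G$ be a Carnot group: a simply connected finite-dimensional real Lie group with identity $1$ whose Lie algebra $\mathfrak g$ of left-invariant vector fields is stratified, i.e. $\mathfrak g=V_1\oplus\cdots\oplus V_s$ for linear subspaces $V_i$ with $\mathrm{span}[V_1,V_i]=V_{i+1}$ for $1\le i<s$ and $[V_1,V_s]=\{0\}$. Let $X_1,\dots,X_m$ be a basis of $V_1$, let $\exp\colon\mathfrak g\to G$ be the exponential map (a bijection), and for $t\in\mathbb R$ let $\delta_t\colon G\to G$ be the dilation $\delta_t(\exp Y)=\exp(\delta_tY)$, where $\delta_t$ is the linear map on $\mathfrak g$ acting on $V_i$ as multiplication by $t^i$. Let $d$ be the Carnot-Carathéodory distance: $d(x,y)$ is the infimum of $\int_0^1|u(\tau)|\,d\tau$ over all absolutely continuous curves $\gamma\colon[0,1]\to G$ from $x$ to $y$ such that $\gamma'(\tau)=\sum_{j=1}^m u_j(\tau)X_j(\gamma(\tau))$ for almost every $\tau$ with $u=(u_1,\dots,u_m)\in L^1([0,1];\mathbb R^m)$, where $|\cdot|$ is the Euclidean norm. Write $d(u)=d(u,1)$ for $u\in G$. For $f\colon G\to\mathbb R$,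 $x\in G$ and $E\in V_1$ put $Ef(x)=\lim_{t\to0}\frac{f(x\exp(tE))-f(x)}{t}$ if the limit exists. A point $x\in G$ is a regular point of $f$ if for every $E\in V_1$ for which $Ef(x)$ exists, $$\lim_{t\to0}\frac{f(x\,\delta_t(u)\exp(tE))-f(x\,\delta_t(u))}{t}=Ef(x)\quad\text{uniformly for } u\in G \text{ with } d(u)\le1;$$ otherwise $x$ is irregular. A set $A\subset G$ is porous if there is $\lambda>0$ such that for every $a\in A$ there is a sequence $x_n\to a$ with $x_n\ne a$ and $B(x_n,\lambda d(a,x_n))\cap A=\varnothing$ for every $n$, where $B(x,r)=\{y: d(x,y)<r\}$. A set is $\sigma$-porous if it is a countable union of porous sets. Proposition. Let $f\colon G\to\mathbb R$ be Lipschitz with respect to $d$. Then the set of irregular points of $f$ is $\sigma$-porous in $(G,d)$. -/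

import Mathlib

open scoped Manifold ContDiff Topology
open Set Filter MeasureTheory

namespace Carnot

section Group

variable (E : Type*) [NormedAddCommGroup E] [NormedSpace ℝ E]
  (G : Type*) [TopologicalSpace G] [ChartedSpace E G] [Group G]

/-- A stratification of step `s` of the Lie algebra `𝔤` of the Lie group `G`, where the bracket
`⁅·, ·⁆` is that of left-invariant vector fields: linear subspaces
`V 1, …, V s` with `𝔤 = V 1 ⊕ ⋯ ⊕ V s`, `[V 1, V i] = V (i + 1)` for `1 ≤ i < s` and
`[V 1, V s] = 0`. The layers are indexed by `ℕ`, with the convention that `V 0` and `V i`, `i > s`,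
are zero, so that the bracket condition for `i = s` reads `[V 1, V s] = V (s + 1) = 0`. -/
structure Stratification (s : ℕ) where
  /-- The layers. -/
  V : ℕ → Submodule ℝ (GroupLieAlgebra 𝓘(ℝ, E) G)
  layer_zero : V 0 = ⊥
  layer_of_gt : ∀ i, s < i → V i = ⊥
  isInternal : DirectSum.IsInternal V
  span_bracket : ∀ i, 1 ≤ i → i ≤ s →
    Submodule.span ℝ {z | ∃ a ∈ V 1, ∃ b ∈ V i, z = ⁅a, b⁆} = V (i + 1)

variable {E G}

/-- The exponential map `𝔤 → G`: `exp X = γ 1`, where `γ` is the integral curve of the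
left-invariant vector field `X` with `γ 0 = 1`. -/
noncomputable def exp (X : GroupLieAlgebra 𝓘(ℝ, E) G) : G :=
  open Classical in
  if h : ∃ γ : ℝ → G, IsMIntegralCurve (I := 𝓘(ℝ, E)) γ (mulInvariantVectorField X) ∧ γ 0 = 1
  then h.choose 1 else 1

/-- Absolute continuity on `[a, b]` of a curve in the manifold `G`: the curve is continuous on
`[a, b]` and its composition with every smooth real function on `G` is absolutely continuous. -/
def AbsolutelyContinuousCurve (E : Type*) [NormedAddCommGroup E] [NormedSpace ℝ E]
    {G : Type*} [TopologicalSpace G] [ChartedSpace E G] (γ : ℝ → G) (a b : ℝ) : Prop :=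
  ContinuousOn γ (Icc a b) ∧
    ∀ φ : G → ℝ, ContMDiff 𝓘(ℝ, E) 𝓘(ℝ, ℝ) ∞ φ → AbsolutelyContinuousOnInterval (φ ∘ γ) a b

/-- `γ` is a horizontal curve on `[a, b]` with controls `u = (u 1, …, u m)` with respect to the
left-invariant vector fields `X 1, …, X m`: it is absolutely continuous, `u` is integrable and
`γ'(t) = ∑ j, u j (t) X j (γ(t))` for almost every `t ∈ [a, b]`. -/
structure IsHorizontal {m : ℕ} (X : Fin m → GroupLieAlgebra 𝓘(ℝ, E) G) (γ : ℝ → G)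
    (u : ℝ → EuclideanSpace ℝ (Fin m)) (a b : ℝ) : Prop where
  absolutelyContinuous : AbsolutelyContinuousCurve E γ a b
  integrableOn : IntegrableOn u (Icc a b)
  hasMFDerivAt : ∀ᵐ t ∂(volume.restrict (Icc a b)),
    HasMFDerivAt 𝓘(ℝ, ℝ) 𝓘(ℝ, E) γ t
      (ContinuousLinearMap.toSpanSingleton ℝ
        (∑ j, u t j • (mulInvariantVectorField (X j) (γ t) : TangentSpace 𝓘(ℝ, E) (γ t))))

/-- The Carnot-Carathéodory distance: the infimum of the lengths `∫ |u|` of the horizontal curves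
`[0, 1] → G` that join `x` to `y`. -/
noncomputable def ccDist {m : ℕ} (X : Fin m → GroupLieAlgebra 𝓘(ℝ, E) G) (x y : G) : ℝ :=
  sInf {L | ∃ (γ : ℝ → G) (u : ℝ → EuclideanSpace ℝ (Fin m)),
    IsHorizontal X γ u 0 1 ∧ γ 0 = x ∧ γ 1 = y ∧ L = ∫ t in (0 : ℝ)..1, ‖u t‖}

/-- `L` is the directional derivative of `f` at `x` in direction `U`. -/
def HasDirDeriv (f : G → ℝ) (x : G) (U : GroupLieAlgebra 𝓘(ℝ, E) G) (L : ℝ) : Prop :=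
  Tendsto (fun t : ℝ => (f (x * exp (t • U)) - f x) / t) (𝓝[≠] 0) (𝓝 L)

variable {s : ℕ}

theorem Stratification.bijective (S : Stratification E G s) :
    Function.Bijective (DirectSum.coeLinearMap S.V) :=
  S.isInternal

/-- The dilation of the Lie algebra, for any real `t`: the linear map that is multiplication by
`t ^ i` on `V i`. -/
noncomputable def Stratification.algDilation (S : Stratification E G s) (t : ℝ) :
    GroupLieAlgebra 𝓘(ℝ, E) G →ₗ[ℝ] GroupLieAlgebra 𝓘(ℝ, E) G :=
  DirectSum.toModule ℝ ℕ _ (fun i => t ^ i • (S.V i).subtype) ∘ₗ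
    (LinearEquiv.ofBijective (DirectSum.coeLinearMap S.V) S.bijective).symm.toLinearMap

/-- The dilation of the group, `δ_t (exp Y) = exp (δ_t Y)`. -/
noncomputable def Stratification.dilation (S : Stratification E G s) (t : ℝ) (x : G) : G :=
  exp (S.algDilation t (Function.invFun exp x))

/-- `x` is a regular point of `f`: whenever `U ∈ V 1` and the directional derivative `Uf(x)`
exists, the quotients `(f(x δ_t(u) exp(tU)) - f(x δ_t(u))) / t` converge to `Uf(x)` as `t → 0`,
uniformly for `d(u) ≤ 1`. -/
def Stratification.IsRegularPoint (S : Stratification E G s) {m : ℕ}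
    (X : Module.Basis (Fin m) ℝ (S.V 1)) (f : G → ℝ) (x : G) : Prop :=
  ∀ U ∈ S.V 1, ∀ L : ℝ, HasDirDeriv f x U L →
    TendstoUniformlyOn
      (fun (t : ℝ) (u : G) =>
        (f (x * S.dilation t u * exp (t • U)) - f (x * S.dilation t u)) / t)
      (fun _ => L) (𝓝[≠] 0) {u | ccDist (fun j => (X j : GroupLieAlgebra 𝓘(ℝ, E) G)) u 1 ≤ 1}

end Group

section Porous

variable {M : Type*}

/-- The set `A` is porous at the point `a`, with constant `c`, for the distance `d`: there are points
`x n ≠ a` converging to `a` such that the open balls `B(x n, c d(a, x n))` do not meet `A`. -/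
def IsPorousAt (d : M → M → ℝ) (c : ℝ) (A : Set M) (a : M) : Prop :=
  ∃ x : ℕ → M, (∀ n, x n ≠ a) ∧ Tendsto (fun n => d (x n) a) atTop (𝓝 0) ∧
    ∀ n, {y | d y (x n) < c * d a (x n)} ∩ A = ∅

/-- The set `A` is porous: it is porous at each of its points, with a uniform constant. -/
def IsPorous (d : M → M → ℝ) (A : Set M) : Prop :=
  ∃ c : ℝ, 0 < c ∧ ∀ a ∈ A, IsPorousAt d c A a

/-- The set `A` is a countable union of porous sets. -/
def IsSigmaPorous (d : M → M → ℝ) (A : Set M) : Prop :=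
  ∃ P : ℕ → Set M, (∀ n, IsPorous d (P n)) ∧ A = ⋃ n, P n

/-- `f` is Lipschitz for the distance `d`. -/
def IsLipschitz (d : M → M → ℝ) (f : M → ℝ) : Prop :=
  ∃ K : ℝ, ∀ x y, |f x - f y| ≤ K * d x y

end Porous

end Carnot

/-! At an irregular point x some horizontal derivative Uf(x) = L exists, yet for arbitrarily small t
there is u with d(u) ≤ 1 such that the increment of f along exp(tU) at x δ_t(u) misses tL by a fixed
multiple of |t|. Approximating U, L, the size of the error and the scale below which f is almost
linear at x by members of countable sets puts x into one of countably many sets `deviationSet`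
(`exists_mem_deviationSet`). Each of them is porous (`isPorous_deviationSet`): the bad point x
δ_t(u) lies within |t| of x, and a point y of the same set much closer than |t| to the bad point
would have an increment close both to the prescribed slope times t and to the bad increment, which
is absurd.

This comparison needs d(y exp(tU), z exp(tU)) ≤ ε|t| once d(y, z) is a small multiple of |t|. By
left invariance and dilations it reduces to the continuity at 1 of conjugation by exp U, provided
that d(1, ·) and the manifold topology have the same neighbourhoods of 1. One half of this
(`eventually_ccDist_lt`) is Chow's theorem: conjugates of V_1 by reachable points span the algebra,
so products of reachable exponentials fill a neighbourhood of 1, and dilations shorten the curves.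
The other half (`exists_ccDist_lt_mem`) holds because a compactly supported smooth function varies
along a horizontal curve by at most a multiple of the length.

All this rests on the dilations being smooth automorphisms of G, and even their definition is
meaningful only once exp is bijective. The left-trivialized derivative of exp is a polynomial in ad
z, hence commutes with the algebra dilations. By uniqueness for the equation of log(exp z exp(τY)),
the local product does too (`exists_log`), which replaces the Baker-Campbell-Hausdorff formula.
Since dilations shrink any vectors into the domain of the logarithm, exp is a local homeomorphism
with local sections over translates of one fixed neighbourhood; it therefore lifts paths, and simple
connectedness makes it bijective (`bijective_expE`). -/

namespace Carnot

set_option linter.unusedSectionVars false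

/-! ### The chart at the identity -/

section ChartAtOne

variable {E : Type*} [NormedAddCommGroup E] [NormedSpace ℝ E]
  {G : Type*} [TopologicalSpace G] [ChartedSpace E G] [Group G]

variable (E) in
/-- The preferred chart at the identity. -/
noncomputable def chart (g : G) : E := extChartAt 𝓘(ℝ, E) (1 : G) g

variable (G) in
/-- The inverse of the preferred chart at the identity. -/
noncomputable def chartInv (x : E) : G := (extChartAt 𝓘(ℝ, E) (1 : G)).symm x

variable (E G) in
/-- The domain of the preferred chart at the identity. -/
def chartDom : Set G := (extChartAt 𝓘(ℝ, E) (1 : G)).source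

variable (E G) in
/-- The image of the preferred chart at the identity. -/
def chartImg : Set E := (extChartAt 𝓘(ℝ, E) (1 : G)).target

theorem chartInv_chart {g : G} (h : g ∈ chartDom E G) : chartInv G (chart E g) = g :=
  (extChartAt 𝓘(ℝ, E) (1 : G)).left_inv h

theorem chart_chartInv {x : E} (h : x ∈ chartImg E G) : chart E (chartInv G x) = x :=
  (extChartAt 𝓘(ℝ, E) (1 : G)).right_inv h

theorem chart_mem {g : G} (h : g ∈ chartDom E G) : chart E g ∈ chartImg E G :=
  (extChartAt 𝓘(ℝ, E) (1 : G)).map_source h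

theorem chartInv_mem {x : E} (h : x ∈ chartImg E G) : chartInv G x ∈ chartDom E G :=
  (extChartAt 𝓘(ℝ, E) (1 : G)).map_target h

theorem isOpen_chartDom : IsOpen (chartDom E G) := isOpen_extChartAt_source _

theorem isOpen_chartImg : IsOpen (chartImg E G) := isOpen_extChartAt_target _

theorem one_mem_chartDom : (1 : G) ∈ chartDom E G := mem_extChartAt_source _

theorem chart_one_mem : chart E (1 : G) ∈ chartImg E G := chart_mem one_mem_chartDom

@[simp] theorem chartInv_chart_one : chartInv G (chart E (1 : G)) = 1 :=
  chartInv_chart one_mem_chartDom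

theorem chart_injOn : InjOn (chart E) (chartDom E G) :=
  (extChartAt 𝓘(ℝ, E) (1 : G)).injOn

theorem chartDom_mem_nhds_one : chartDom E G ∈ 𝓝 (1 : G) :=
  isOpen_chartDom.mem_nhds one_mem_chartDom

variable [IsManifold 𝓘(ℝ, E) ∞ G]

theorem contMDiffAt_chart {g : G} (h : g ∈ chartDom E G) :
    ContMDiffAt 𝓘(ℝ, E) 𝓘(ℝ, E) ∞ (chart E : G → E) g :=
  contMDiffAt_extChartAt' (by simpa [chartDom] using h)

theorem contMDiffAt_chartInv {x : E} (h : x ∈ chartImg E G) :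
    ContMDiffAt 𝓘(ℝ, E) 𝓘(ℝ, E) ∞ (chartInv G : E → G) x :=
  (contMDiffOn_extChartAt_symm (1 : G)).contMDiffAt (isOpen_chartImg.mem_nhds h)

theorem continuousAt_chart {g : G} (h : g ∈ chartDom E G) : ContinuousAt (chart E : G → E) g :=
  (contMDiffAt_chart h).continuousAt

theorem continuousAt_chartInv {x : E} (h : x ∈ chartImg E G) :
    ContinuousAt (chartInv G : E → G) x :=
  (contMDiffAt_chartInv h).continuousAt

/-- A smooth map into the group is smooth in the chart. -/
theorem contDiffAt_chart_comp {N : Type*} [NormedAddCommGroup N] [NormedSpace ℝ N] {F : N → G}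
    {x : N} (hF : ContMDiffAt 𝓘(ℝ, N) 𝓘(ℝ, E) ∞ F x) (h : F x ∈ chartDom E G) :
    ContDiffAt ℝ ∞ (fun y => chart E (F y)) x :=
  contMDiffAt_iff_contDiffAt.1 ((contMDiffAt_chart h).comp x hF)

theorem contMDiffAt_chartInv_comp {N : Type*} [NormedAddCommGroup N] [NormedSpace ℝ N] {F : N → E}
    {x : N} (hF : ContDiffAt ℝ ∞ F x) (h : F x ∈ chartImg E G) :
    ContMDiffAt 𝓘(ℝ, N) 𝓘(ℝ, E) ∞ (fun y => chartInv G (F y)) x :=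
  (contMDiffAt_chartInv h).comp x hF.contMDiffAt

end ChartAtOne

/-! ### Calculus of left logarithmic derivatives of curves -/

section LeftDeriv

variable {E : Type*} [NormedAddCommGroup E] [NormedSpace ℝ E]
  {G : Type*} [TopologicalSpace G] [ChartedSpace E G] [Group G]

/-- The curve `γ` is continuous at `t` and `c` is the derivative at `s = t` of
`γ(t)⁻¹ γ(s)`, in the chart at the identity. -/
def HasLeftDeriv (γ : ℝ → G) (t : ℝ) (c : E) : Prop :=
  ContinuousAt γ t ∧ HasDerivAt (fun s => chart E ((γ t)⁻¹ * γ s)) c t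

/-- The adjoint representation. -/
noncomputable def Ad (g : G) : E →L[ℝ] E :=
  fderiv ℝ (fun y => chart E (g * chartInv G y * g⁻¹)) (chart E (1 : G))

variable (G) in
/-- The left-invariant frame in the chart. -/
noncomputable def frame (x : E) : E →L[ℝ] E :=
  fderiv ℝ (fun y => chart E (chartInv G x * chartInv G y)) (chart E (1 : G))

theorem HasLeftDeriv.unique {γ : ℝ → G} {t : ℝ} {c c' : E} (h : HasLeftDeriv γ t c)
    (h' : HasLeftDeriv γ t c') : c = c' := h.2.unique h'.2

theorem hasLeftDeriv_const (g : G) (t : ℝ) : HasLeftDeriv (fun _ => g) t (0 : E) :=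
  ⟨continuousAt_const, by simpa using hasDerivAt_const t _⟩

theorem HasLeftDeriv.congr {γ η : ℝ → G} {t : ℝ} {c : E} (h : HasLeftDeriv γ t c)
    (e : η =ᶠ[𝓝 t] γ) : HasLeftDeriv η t c := by
  refine ⟨h.1.congr e.symm, h.2.congr_of_eventuallyEq ?_⟩
  filter_upwards [e] with s hs
  rw [hs, e.self_of_nhds]

variable [LieGroup 𝓘(ℝ, E) ∞ G] [IsTopologicalGroup G]

theorem tendsto_inv_mul {γ : ℝ → G} {t : ℝ} (h : ContinuousAt γ t) :
    Tendsto (fun s => (γ t)⁻¹ * γ s) (𝓝 t) (𝓝 1) := by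
  have := (tendsto_const_nhds (x := (γ t)⁻¹) (f := 𝓝 t)).mul h.tendsto
  rwa [inv_mul_cancel] at this

theorem HasLeftDeriv.eventually_eq {γ : ℝ → G} {t : ℝ} {c : E} (h : HasLeftDeriv γ t c) :
    ∀ᶠ s in 𝓝 t, γ t * chartInv G (chart E ((γ t)⁻¹ * γ s)) = γ s := by
  filter_upwards [tendsto_inv_mul h.1 (chartDom_mem_nhds_one (E := E))] with s hs
  rw [chartInv_chart hs]; group

theorem differentiableAt_conj (g : G) :
    DifferentiableAt ℝ (fun y : E => chart E (g * chartInv G y * g⁻¹)) (chart E (1 : G)) := by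
  refine (contDiffAt_chart_comp ((contMDiffAt_const.mul
    (contMDiffAt_chartInv chart_one_mem)).mul contMDiffAt_const) ?_).differentiableAt (by simp)
  simpa using one_mem_chartDom

theorem hasFDerivAt_conj (g : G) : HasFDerivAt (fun y : E => chart E (g * chartInv G y * g⁻¹))
    (Ad g) (chart E (1 : G)) := (differentiableAt_conj g).hasFDerivAt

theorem tendsto_chartInv : Tendsto (chartInv G) (𝓝 (chart E (1 : G))) (𝓝 1) := by
  simpa using (continuousAt_chartInv (E := E) (G := G) chart_one_mem).tendsto

@[simp] theorem Ad_one : (Ad (1 : G) : E →L[ℝ] E) = ContinuousLinearMap.id ℝ E := by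
  refine (hasFDerivAt_conj (1 : G)).unique ((hasFDerivAt_id _).congr_of_eventuallyEq ?_)
  filter_upwards [isOpen_chartImg.mem_nhds (chart_one_mem (E := E) (G := G))] with y hy
  simp [chart_chartInv hy]

theorem Ad_mul (g h : G) : (Ad (g * h) : E →L[ℝ] E) = (Ad g).comp (Ad h) := by
  have h1 := hasFDerivAt_conj (E := E) h
  have e : chart E (h * chartInv G (chart E (1 : G)) * h⁻¹) = chart E (1 : G) := by simp
  have h2 : HasFDerivAt (fun y : E => chart E (g * chartInv G y * g⁻¹)) (Ad g)
      ((fun y : E => chart E (h * chartInv G y * h⁻¹)) (chart E (1 : G))) := by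
    beta_reduce
    rw [e]
    exact hasFDerivAt_conj (E := E) g
  refine (hasFDerivAt_conj (g * h)).unique ((h2.comp (chart E (1 : G)) h1).congr_of_eventuallyEq ?_)
  have : Tendsto (fun y : E => h * chartInv G y * h⁻¹) (𝓝 (chart E (1 : G))) (𝓝 1) := by
    have := ((tendsto_const_nhds (x := h)).mul (tendsto_chartInv (E := E))).mul
      (tendsto_const_nhds (x := h⁻¹))
    simpa using this
  filter_upwards [this (chartDom_mem_nhds_one (E := E))] with y hy
  simp only [Function.comp]
  rw [chartInv_chart hy]
  congr 1
  group

theorem Ad_mul_apply (g h : G) (c : E) : Ad (g * h) c = Ad g (Ad h c) := by rw [Ad_mul]; rfl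

/-- With h = η(t)⁻¹, the left quotient of γη at t is h (γ(t)⁻¹γ(s)) h⁻¹ · η(t)⁻¹η(s). At (1, 1) the
partial differentials of this expression are Ad h and the identity. -/
theorem HasLeftDeriv.mul {γ η : ℝ → G} {t : ℝ} {a b : E} (hγ : HasLeftDeriv γ t a)
    (hη : HasLeftDeriv η t b) : HasLeftDeriv (fun s => γ s * η s) t (Ad (η t)⁻¹ a + b) := by
  refine ⟨hγ.1.mul hη.1, ?_⟩
  set h := (η t)⁻¹ with hh
  set p := chart E (1 : G) with hp
  let Φ : E × E → E := fun z => chart E (h * chartInv G z.1 * h⁻¹ * chartInv G z.2)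
  have hΦ : DifferentiableAt ℝ Φ (p, p) := by
    refine (contDiffAt_chart_comp (((contMDiffAt_const.mul (contMDiffAt_chartInv_comp
      contDiffAt_fst chart_one_mem)).mul contMDiffAt_const).mul (contMDiffAt_chartInv_comp
      contDiffAt_snd chart_one_mem)) ?_).differentiableAt (by simp)
    change h * chartInv G p * h⁻¹ * chartInv G p ∈ chartDom E G
    rw [show h * chartInv G p * h⁻¹ * chartInv G p = 1 by rw [hp, chartInv_chart_one]; group]
    exact one_mem_chartDom
  have d1 : fderiv ℝ Φ (p, p) (a, 0) = Ad h a := by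
    have h1 : HasFDerivAt (fun y : E => (y, p)) (ContinuousLinearMap.inl ℝ E E) p :=
      hasFDerivAt_prodMk_left _ _
    have h2 := HasFDerivAt.comp (g := Φ) (f := fun y : E => (y, p)) p hΦ.hasFDerivAt h1
    have h3 : (Φ ∘ fun y : E => (y, p)) = fun y => chart E (h * chartInv G y * h⁻¹) := by
      ext y; simp [Φ, hp]
    rw [h3] at h2
    rw [(hasFDerivAt_conj h).unique h2]; simp
  have d2 : fderiv ℝ Φ (p, p) (0, b) = b := by
    have h1 : HasFDerivAt (fun y : E => (p, y)) (ContinuousLinearMap.inr ℝ E E) p :=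
      hasFDerivAt_prodMk_right _ _
    have h2 := HasFDerivAt.comp (g := Φ) (f := fun y : E => (p, y)) p hΦ.hasFDerivAt h1
    have h3 : (Φ ∘ fun y : E => (p, y)) =ᶠ[𝓝 p] id := by
      filter_upwards [isOpen_chartImg.mem_nhds (chart_one_mem (E := E) (G := G))] with y hy
      simp [Φ, hp, chart_chartInv hy]
    have := (h2.congr_of_eventuallyEq h3.symm).unique (hasFDerivAt_id p)
    simpa using congrArg (fun L : E →L[ℝ] E => L b) this
  have hc := hγ.2.prodMk hη.2
  have e : (chart E ((γ t)⁻¹ * γ t), chart E ((η t)⁻¹ * η t)) = (p, p) := by simp [hp]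
  have hΦ' := hΦ.hasFDerivAt
  rw [← e] at hΦ'
  have := hΦ'.comp_hasDerivAt t hc
  rw [e] at this
  have e2 : fderiv ℝ Φ (p, p) (a, b) = Ad h a + b := by
    have : ((a, b) : E × E) = (a, 0) + (0, b) := by simp
    rw [this, map_add, d1, d2]
  rw [e2] at this
  refine this.congr_of_eventuallyEq ?_
  filter_upwards [hγ.eventually_eq, hη.eventually_eq] with s h1 h2
  simp only [Function.comp, Φ]
  congr 1
  conv_lhs => rw [← h1, ← h2]
  simp only [hh]
  group

theorem HasLeftDeriv.const_mul {γ : ℝ → G} {t : ℝ} {a : E} (g : G) (hγ : HasLeftDeriv γ t a) :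
    HasLeftDeriv (fun s => g * γ s) t a := by
  simpa using (hasLeftDeriv_const (E := E) g t).mul hγ

theorem HasLeftDeriv.mul_const {γ : ℝ → G} {t : ℝ} {a : E} (hγ : HasLeftDeriv γ t a) (g : G) :
    HasLeftDeriv (fun s => γ s * g) t (Ad g⁻¹ a) := by
  simpa using hγ.mul (hasLeftDeriv_const (E := E) g t)

/-- The chain rule only provides the existence of a derivative; its value is then forced by the
product rule for γγ⁻¹ = 1. -/
theorem HasLeftDeriv.inv {γ : ℝ → G} {t : ℝ} {a : E} (hγ : HasLeftDeriv γ t a) :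
    HasLeftDeriv (fun s => (γ s)⁻¹) t (-Ad (γ t) a) := by
  set g := γ t with hg
  set p := chart E (1 : G) with hp
  let Φ : E → E := fun y => chart E (g * (chartInv G y)⁻¹ * g⁻¹)
  have hΦ : DifferentiableAt ℝ Φ p := by
    refine (contDiffAt_chart_comp ((contMDiffAt_const.mul
      (contMDiffAt_chartInv chart_one_mem).inv).mul contMDiffAt_const) ?_).differentiableAt
      (by simp)
    change g * (chartInv G p)⁻¹ * g⁻¹ ∈ chartDom E G
    rw [show g * (chartInv G p)⁻¹ * g⁻¹ = 1 by rw [hp, chartInv_chart_one]; group]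
    exact one_mem_chartDom
  have key : HasLeftDeriv (fun s => (γ s)⁻¹) t (fderiv ℝ Φ p a) := by
    refine ⟨hγ.1.inv, ?_⟩
    have e : chart E ((γ t)⁻¹ * γ t) = p := by simp [hp]
    have hΦ' := hΦ.hasFDerivAt
    rw [← e] at hΦ'
    have := hΦ'.comp_hasDerivAt t hγ.2
    rw [e] at this
    refine this.congr_of_eventuallyEq ?_
    filter_upwards [hγ.eventually_eq] with s h1
    simp only [Function.comp, Φ]
    congr 1
    conv_lhs => rw [← h1]
    simp only [hg]
    group
  have h0 := (hγ.mul key)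
  simp only [mul_inv_cancel, inv_inv] at h0
  have := h0.unique (hasLeftDeriv_const 1 t)
  rw [← hg] at this
  rwa [← eq_neg_of_add_eq_zero_right this]

theorem differentiableAt_mul_chart {x y : E} (hx : x ∈ chartImg E G) (hy : y ∈ chartImg E G)
    (h : chartInv G x * chartInv G y ∈ chartDom E G) :
    ContDiffAt ℝ ∞ (fun z : E × E => chart E (chartInv G z.1 * chartInv G z.2)) (x, y) :=
  contDiffAt_chart_comp ((contMDiffAt_chartInv_comp contDiffAt_fst hx).mul
    (contMDiffAt_chartInv_comp contDiffAt_snd hy)) h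

theorem contDiffAt_mul_left_chart {x : E} (hx : x ∈ chartImg E G) :
    ContDiffAt ℝ ∞ (fun y : E => chart E (chartInv G x * chartInv G y)) (chart E (1 : G)) :=
  contDiffAt_chart_comp (contMDiffAt_const.mul
    (contMDiffAt_chartInv chart_one_mem)) (by simpa using chartInv_mem hx)

theorem hasFDerivAt_frame {x : E} (hx : x ∈ chartImg E G) :
    HasFDerivAt (fun y : E => chart E (chartInv G x * chartInv G y)) (frame G x)
      (chart E (1 : G)) :=
  ((contDiffAt_mul_left_chart hx).differentiableAt (by simp)).hasFDerivAt

theorem frame_one : frame G (chart E (1 : G)) = ContinuousLinearMap.id ℝ E := by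
  refine (hasFDerivAt_frame chart_one_mem).unique ((hasFDerivAt_id _).congr_of_eventuallyEq ?_)
  filter_upwards [isOpen_chartImg.mem_nhds (chart_one_mem (E := E) (G := G))] with y hy
  simp [chart_chartInv hy]

/-- The derivative of a curve in a left translate of the chart at the identity. -/
theorem HasLeftDeriv.hasDerivAt_chart {γ : ℝ → G} {t : ℝ} {c : E} (hγ : HasLeftDeriv γ t c)
    {g : G} (hg : g⁻¹ * γ t ∈ chartDom E G) :
    HasDerivAt (fun s => chart E (g⁻¹ * γ s)) (frame G (chart E (g⁻¹ * γ t)) c) t := by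
  have h1 := hasFDerivAt_frame (chart_mem hg)
  have e : chart E ((γ t)⁻¹ * γ t) = chart E (1 : G) := by simp
  rw [← e] at h1
  refine (h1.comp_hasDerivAt t hγ.2).congr_of_eventuallyEq ?_
  filter_upwards [hγ.eventually_eq] with s hs
  simp only [Function.comp]
  congr 1
  conv_lhs => rw [← hs]
  rw [chartInv_chart hg, mul_assoc]

/-- Near x the curve, read in the chart translated to γ x, has zero derivative, so it is locally
constant; connectedness does the rest. -/
theorem eq_of_hasLeftDeriv_zero {γ : ℝ → G} {s : Set ℝ} (ho : IsOpen s) (hs : IsPreconnected s)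
    (h : ∀ t ∈ s, HasLeftDeriv γ t (0 : E)) {a b : ℝ} (ha : a ∈ s) (hb : b ∈ s) : γ a = γ b := by
  refine hs.induction₂ (fun x y => γ x = γ y) (fun x hx => ?_) (fun _ _ _ _ _ _ => Eq.trans)
    (fun _ _ _ _ => Eq.symm) ha hb
  refine mem_nhdsWithin_of_mem_nhds ?_
  have hc := tendsto_inv_mul (h x hx).1
  obtain ⟨ε, hε, hball⟩ := Metric.eventually_nhds_iff_ball.1
    ((hc.eventually (chartDom_mem_nhds_one (E := E))).and (ho.mem_nhds hx))
  refine Metric.eventually_nhds_iff_ball.2 ⟨ε, hε, fun y hy => ?_⟩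
  have hd : ∀ z ∈ Metric.ball x ε, HasDerivAt (fun s => chart E ((γ x)⁻¹ * γ s)) 0 z := by
    intro z hz
    simpa using (h z (hball z hz).2).hasDerivAt_chart (hball z hz).1
  have := Metric.isOpen_ball.is_const_of_deriv_eq_zero (convex_ball x ε).isPreconnected
    (fun z hz => (hd z hz).differentiableAt.differentiableWithinAt) (fun z hz => (hd z hz).deriv)
    (Metric.mem_ball_self hε) hy
  have := chart_injOn (hball x (Metric.mem_ball_self hε)).1 (hball y hy).1 this
  exact mul_left_cancel this

/-- The quotient γη⁻¹ has left derivative Ad(η)(c - c) = 0. This uniqueness principle identifies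
curves in G throughout. -/
theorem eqOn_of_hasLeftDeriv {γ η : ℝ → G} {s : Set ℝ} (ho : IsOpen s) (hs : IsPreconnected s)
    {c : ℝ → E} (h : ∀ t ∈ s, HasLeftDeriv γ t (c t)) (h' : ∀ t ∈ s, HasLeftDeriv η t (c t))
    {a : ℝ} (ha : a ∈ s) (e : γ a = η a) : EqOn γ η s := by
  intro b hb
  have : ∀ t ∈ s, HasLeftDeriv (fun t => γ t * (η t)⁻¹) t (0 : E) := by
    intro t ht
    simpa using (h t ht).mul (h' t ht).inv
  have := eq_of_hasLeftDeriv_zero ho hs this ha hb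
  simp only [e, mul_inv_cancel] at this
  exact (mul_inv_eq_one.1 this.symm)

end LeftDeriv

/-! ### Left derivatives versus manifold derivatives -/

section Manifold

variable {E : Type*} [NormedAddCommGroup E] [NormedSpace ℝ E]
  {G : Type*} [TopologicalSpace G] [ChartedSpace E G] [Group G]

/-- A topological group that is locally Euclidean is Hausdorff. -/
theorem t2Space_of_chartedSpace (E : Type*) [NormedAddCommGroup E]
    (G : Type*) [TopologicalSpace G] [ChartedSpace E G] [Group G] [IsTopologicalGroup G] :
    T2Space G := by
  have : T1Space G := by
    refine t1Space_iff_exists_open.2 fun x y hxy => ?_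
    by_cases hy : y ∈ (chartAt E x).source
    · have hne : chartAt E x x ≠ chartAt E x y := fun h =>
        hxy ((chartAt E x).injOn (mem_chart_source E x) hy h)
      refine ⟨(chartAt E x).source ∩ chartAt E x ⁻¹' {chartAt E x y}ᶜ,
        (chartAt E x).isOpen_inter_preimage isOpen_compl_singleton,
        ⟨mem_chart_source E x, hne⟩, fun h => h.2 rfl⟩
    · exact ⟨_, (chartAt E x).open_source, mem_chart_source E x, hy⟩
  infer_instance

variable [LieGroup 𝓘(ℝ, E) ∞ G] [IsTopologicalGroup G]

theorem hasMFDerivAt_chart_one :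
    HasMFDerivAt 𝓘(ℝ, E) 𝓘(ℝ, E) (chart E : G → E) (1 : G) (ContinuousLinearMap.id ℝ E) := by
  refine ⟨continuousAt_chart one_mem_chartDom, ?_⟩
  refine HasFDerivAt.hasFDerivWithinAt ((hasFDerivAt_id _).congr_of_eventuallyEq ?_)
  filter_upwards [isOpen_chartImg.mem_nhds (chart_one_mem (E := E) (G := G))] with y hy
  exact chart_chartInv hy

theorem hasMFDerivAt_chartInv :
    HasMFDerivAt 𝓘(ℝ, E) 𝓘(ℝ, E) (chartInv G : E → G) (chart E (1 : G))
      (ContinuousLinearMap.id ℝ E) := by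
  refine ⟨continuousAt_chartInv chart_one_mem, ?_⟩
  refine HasFDerivAt.hasFDerivWithinAt ((hasFDerivAt_id _).congr_of_eventuallyEq ?_)
  filter_upwards [isOpen_chartImg.mem_nhds (chart_one_mem (E := E) (G := G))] with y hy
  have : writtenInExtChartAt 𝓘(ℝ, E) 𝓘(ℝ, E) (chart E (1 : G)) (chartInv G) y
    = extChartAt 𝓘(ℝ, E) (chartInv G (chart E (1 : G))) (chartInv G y) := rfl
  rw [this, chartInv_chart_one]
  exact chart_chartInv hy

theorem hasMFDerivAt_mul_left (g h : G) :
    HasMFDerivAt 𝓘(ℝ, E) 𝓘(ℝ, E) (fun x : G => g * x) h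
      (mfderiv 𝓘(ℝ, E) 𝓘(ℝ, E) (fun x : G => g * x) h) :=
  ((contMDiff_mul_left (n := ∞) (I := 𝓘(ℝ, E))).contMDiffAt.mdifferentiableAt
    (by simp)).hasMFDerivAt

theorem hasMFDerivAt_chart_mul_left (g : G) :
    HasMFDerivAt 𝓘(ℝ, E) 𝓘(ℝ, E) (fun x : G => chart E (g⁻¹ * x)) g
      (mfderiv 𝓘(ℝ, E) 𝓘(ℝ, E) (fun x : G => chart E (g⁻¹ * x)) g) := by
  refine MDifferentiableAt.hasMFDerivAt (ContMDiffAt.mdifferentiableAt (n := ∞) ?_ (by simp))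
  refine (contMDiffAt_chart ?_).comp g (contMDiff_mul_left.contMDiffAt)
  simpa using one_mem_chartDom

/-- The field at g is the image of c under the differential of x ↦ gx, and composing the translated
chart with this translation gives back the chart at 1, whose differential at 1 is the identity. -/
theorem mfderiv_chart_mulInvariantVectorField (g : G) (c : GroupLieAlgebra 𝓘(ℝ, E) G) :
    mfderiv 𝓘(ℝ, E) 𝓘(ℝ, E) (fun x : G => chart E (g⁻¹ * x)) g (mulInvariantVectorField c g)
      = c := by
  have h1 := hasMFDerivAt_mul_left (E := E) g 1
  have h2 := hasMFDerivAt_chart_mul_left (E := E) g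
  have h2' : HasMFDerivAt 𝓘(ℝ, E) 𝓘(ℝ, E) (fun x : G => chart E (g⁻¹ * x)) (g * 1)
      (mfderiv 𝓘(ℝ, E) 𝓘(ℝ, E) (fun x : G => chart E (g⁻¹ * x)) (g * 1)) := by
    rw [mul_one]; exact h2
  have h3 := h2'.comp (1 : G) h1
  have e : ((fun x : G => chart E (g⁻¹ * x)) ∘ fun x => g * x) = chart E := by
    ext x; simp
  rw [e] at h3
  have h4 := hasMFDerivAt_unique h3 hasMFDerivAt_chart_one
  have h5 := congrArg (fun L : E →L[ℝ] E => L c) h4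
  have h6 : mfderiv 𝓘(ℝ, E) 𝓘(ℝ, E) (fun x : G => chart E (g⁻¹ * x)) (g * 1)
      (mfderiv 𝓘(ℝ, E) 𝓘(ℝ, E) (fun x : G => g * x) 1 c) = c := h5
  have h7 : ∀ g' : G, g' = g → ∀ v : E,
      (mfderiv 𝓘(ℝ, E) 𝓘(ℝ, E) (fun x : G => chart E (g⁻¹ * x)) g' : E →L[ℝ] E) v
      = (mfderiv 𝓘(ℝ, E) 𝓘(ℝ, E) (fun x : G => chart E (g⁻¹ * x)) g : E →L[ℝ] E) v := by
    rintro g' rfl v; rfl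
  exact (h7 _ (mul_one g) _).symm.trans h6

/-- A curve has derivative `c (γ t)`, for the left-invariant field `c`, if and only if it has left
derivative `c`. -/
theorem hasMFDerivAt_iff_hasLeftDeriv {γ : ℝ → G} {t : ℝ} {c : GroupLieAlgebra 𝓘(ℝ, E) G} :
    HasMFDerivAt 𝓘(ℝ, ℝ) 𝓘(ℝ, E) γ t
      (ContinuousLinearMap.toSpanSingleton ℝ
        (mulInvariantVectorField c (γ t) : TangentSpace 𝓘(ℝ, E) (γ t))) ↔
    HasLeftDeriv (E := E) γ t c := by
  constructor
  · intro h
    refine ⟨h.1, ?_⟩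
    have h2 := (hasMFDerivAt_chart_mul_left (E := E) (γ t)).comp t h
    let L : ℝ →L[ℝ] E := (mfderiv 𝓘(ℝ, E) 𝓘(ℝ, E) (fun x : G => chart E ((γ t)⁻¹ * x)) (γ t)).comp
      (ContinuousLinearMap.toSpanSingleton ℝ
        (mulInvariantVectorField c (γ t) : TangentSpace 𝓘(ℝ, E) (γ t)))
    have h3 : HasFDerivAt (fun s => chart E ((γ t)⁻¹ * γ s)) L t := h2.hasFDerivAt
    have hL : L 1 = c := by
      refine Eq.trans ?_ (mfderiv_chart_mulInvariantVectorField (γ t) c)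
      change mfderiv 𝓘(ℝ, E) 𝓘(ℝ, E) (fun x : G => chart E ((γ t)⁻¹ * x)) (γ t)
        ((1 : ℝ) • mulInvariantVectorField c (γ t)) = _
      rw [one_smul]
    have h4 := h3.hasDerivAt
    rwa [hL] at h4
  · intro h
    set g := γ t with hg
    have h1 : HasMFDerivAt 𝓘(ℝ, ℝ) 𝓘(ℝ, E) (fun s => chart E (g⁻¹ * γ s)) t
      (ContinuousLinearMap.toSpanSingleton ℝ c : ℝ →L[ℝ] E) := h.2.hasFDerivAt.hasMFDerivAt
    have e : chart E (g⁻¹ * γ t) = chart E (1 : G) := by simp [hg]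
    have h2 : HasMFDerivAt 𝓘(ℝ, E) 𝓘(ℝ, E) (chartInv G : E → G) (chart E (g⁻¹ * γ t))
      (ContinuousLinearMap.id ℝ E) := by rw [e]; exact hasMFDerivAt_chartInv
    have h3 := h2.comp t h1
    have e2 : chartInv G (chart E (g⁻¹ * γ t)) = 1 := by rw [e]; simp
    have h4 : HasMFDerivAt 𝓘(ℝ, E) 𝓘(ℝ, E) (fun x : G => g * x)
        (chartInv G (chart E (g⁻¹ * γ t)))
        (mfderiv 𝓘(ℝ, E) 𝓘(ℝ, E) (fun x : G => g * x) (1 : G) : E →L[ℝ] E) := by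
      rw [e2]; exact hasMFDerivAt_mul_left (E := E) g 1
    have h5 := h4.comp t h3
    have h6 := h5.congr_of_eventuallyEq (f₁ := γ) (by
      filter_upwards [h.eventually_eq] with s hs using hs.symm)
    refine (congrArg (HasMFDerivAt 𝓘(ℝ, ℝ) 𝓘(ℝ, E) γ t) ?_).mpr h6
    refine ContinuousLinearMap.ext fun r => ?_
    change r • (mfderiv 𝓘(ℝ, E) 𝓘(ℝ, E) (fun x : G => g * x) (1 : G) c)
      = mfderiv 𝓘(ℝ, E) 𝓘(ℝ, E) (fun x : G => g * x) (1 : G) (r • c)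
    rw [map_smul]

end Manifold

/-! ### The exponential map and one-parameter subgroups -/

section Exp

variable {E : Type*} [NormedAddCommGroup E] [NormedSpace ℝ E]
  {G : Type*} [TopologicalSpace G] [ChartedSpace E G] [Group G]

variable (G) in
/-- The exponential map as a map on the model space. -/
noncomputable def expE (x : E) : G := exp (E := E) (G := G) x

theorem HasLeftDeriv.comp_mul {γ : ℝ → G} {r t : ℝ} {c : E} (h : HasLeftDeriv γ (r * t) c) :
    HasLeftDeriv (fun s => γ (r * s)) t (r • c) := by
  have hc : HasDerivAt (fun s : ℝ => r * s) r t := by simpa using (hasDerivAt_id t).const_mul r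
  exact ⟨ContinuousAt.comp (f := fun s : ℝ => r * s) h.1 hc.continuousAt, h.2.scomp t hc⟩

theorem HasLeftDeriv.comp_add_const {γ : ℝ → G} {r t : ℝ} {c : E}
    (h : HasLeftDeriv γ (t + r) c) : HasLeftDeriv (fun s => γ (s + r)) t c := by
  have hc : HasDerivAt (fun s : ℝ => s + r) 1 t := by simpa using (hasDerivAt_id t).add_const r
  refine ⟨ContinuousAt.comp (f := fun s : ℝ => s + r) h.1 hc.continuousAt, ?_⟩
  simpa [Function.comp_def] using h.2.scomp t hc

variable [FiniteDimensional ℝ E] [LieGroup 𝓘(ℝ, E) ∞ G] [IsTopologicalGroup G]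

theorem isMIntegralCurveOn_of_hasLeftDeriv {γ : ℝ → G} {X : GroupLieAlgebra 𝓘(ℝ, E) G}
    {s : Set ℝ} (h : ∀ t ∈ s, HasLeftDeriv (E := E) γ t X) :
    IsMIntegralCurveOn (I := 𝓘(ℝ, E)) γ (mulInvariantVectorField X) s := by
  intro t ht
  exact (hasMFDerivAt_iff_hasLeftDeriv.2 (h t ht)).hasMFDerivWithinAt

theorem lieGroup_minSmoothness : LieGroup 𝓘(ℝ, E) (minSmoothness ℝ 3) G := by
  rw [minSmoothness_of_isRCLikeNormedField]
  exact LieGroup.of_le (n := ∞) (by exact WithTop.coe_le_coe.2 le_top)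

/-- Left translates of a local integral curve through 1 are integral curves through every point, on
an interval of the same length. This uniform existence time makes the field complete. -/
theorem exists_hasLeftDeriv (X : E) :
    ∃ γ : ℝ → G, γ 0 = 1 ∧ ∀ t, HasLeftDeriv γ t X := by
  have := t2Space_of_chartedSpace E G
  have := lieGroup_minSmoothness (E := E) (G := G)
  have hv := contMDiff_mulInvariantVectorField (I := 𝓘(ℝ, E)) (G := G) (X : GroupLieAlgebra 𝓘(ℝ, E) G)
  replace hv := hv.of_le (m := 1) (by rw [minSmoothness_of_isRCLikeNormedField]; norm_num)
  obtain ⟨γ₀, h0, hγ₀⟩ := exists_isMIntegralCurveAt_of_contMDiffAt_boundaryless 0 (hv.contMDiffAt (x := 1))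
  obtain ⟨ε, hε, hball⟩ := Metric.eventually_nhds_iff_ball.1 hγ₀
  obtain ⟨γ, h1, hγ⟩ := exists_isMIntegralCurve_of_isMIntegralCurveOn hv hε (fun g => by
    refine ⟨fun t => g * γ₀ t, by simp [h0], isMIntegralCurveOn_of_hasLeftDeriv fun t ht => ?_⟩
    refine HasLeftDeriv.const_mul g (hasMFDerivAt_iff_hasLeftDeriv.1 (hball t ?_))
    rw [Real.ball_eq_Ioo]; simpa using ht) 1
  exact ⟨γ, h1, fun t => hasMFDerivAt_iff_hasLeftDeriv.1 (hγ t)⟩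

/-- The integral curve in the definition of exp is an arbitrary choice; uniqueness lets any curve
with the right left derivative compute it. -/
theorem expE_smul_eq {γ : ℝ → G} {X : E} (h0 : γ 0 = 1) (h : ∀ t, HasLeftDeriv γ t X) (t : ℝ) :
    expE G (t • X) = γ t := by
  have h' : ∀ s, HasLeftDeriv (fun s => γ (t * s)) s (t • X) := fun s => (h _).comp_mul
  have hex : ∃ γ : ℝ → G, IsMIntegralCurve (I := 𝓘(ℝ, E)) γ
      (mulInvariantVectorField ((t • X : E) : GroupLieAlgebra 𝓘(ℝ, E) G)) ∧ γ 0 = 1 :=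
    ⟨_, fun s => hasMFDerivAt_iff_hasLeftDeriv.2 (h' s), by simp [h0]⟩
  have e : expE G (t • X) = hex.choose 1 := by
    unfold expE exp
    exact dif_pos hex
  obtain ⟨h1, h2⟩ := hex.choose_spec
  rw [e]
  have := eqOn_of_hasLeftDeriv isOpen_univ isPreconnected_univ (c := fun _ => t • X)
    (fun s _ => hasMFDerivAt_iff_hasLeftDeriv.1 (h1 s)) (fun s _ => h' s) (mem_univ 0)
    (by rw [h2]; simp [h0]) (mem_univ 1)
  simpa using this

theorem hasLeftDeriv_expE_smul (X : E) (t : ℝ) : HasLeftDeriv (fun s : ℝ => expE G (s • X)) t X := by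
  obtain ⟨γ, h0, h⟩ := exists_hasLeftDeriv (G := G) X
  have : (fun s : ℝ => expE G (s • X)) = γ := funext (expE_smul_eq h0 h)
  rw [this]; exact h t

@[simp] theorem expE_zero : expE G (0 : E) = 1 := by
  obtain ⟨γ, h0, h⟩ := exists_hasLeftDeriv (G := G) (0 : E)
  simpa [h0] using expE_smul_eq h0 h 0

theorem expE_eq {γ : ℝ → G} {X : E} (h0 : γ 0 = 1) (h : ∀ t, HasLeftDeriv γ t X) :
    expE G X = γ 1 := by
  simpa using expE_smul_eq h0 h 1

theorem expE_conj (g : G) (X : E) : g * expE G X * g⁻¹ = expE G (Ad g X) := by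
  have := expE_eq (γ := fun s => g * expE G (s • X) * g⁻¹) (X := Ad g X) (by simp) fun t => ?_
  · simpa using this.symm
  simpa using ((hasLeftDeriv_expE_smul X t).const_mul g).mul_const g⁻¹

theorem expE_add_smul (X : E) (s t : ℝ) :
    expE G ((s + t) • X) = expE G (s • X) * expE G (t • X) := by
  have := eqOn_of_hasLeftDeriv isOpen_univ isPreconnected_univ (c := fun _ => X)
    (γ := fun t => expE G ((t + s) • X)) (η := fun t => expE G (s • X) * expE G (t • X))
    (fun t _ => (hasLeftDeriv_expE_smul X (t + s)).comp_add_const)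
    (fun t _ => (hasLeftDeriv_expE_smul X t).const_mul _) (mem_univ 0) (by simp) (mem_univ t)
  simpa [add_comm] using this

theorem expE_neg (X : E) : expE G (-X) = (expE G X)⁻¹ := by
  have := expE_add_smul (G := G) X 1 (-1)
  simp only [add_neg_cancel, zero_smul, expE_zero, one_smul, neg_smul] at this
  exact (inv_eq_of_mul_eq_one_right this.symm).symm

end Exp

/-! ### The bracket as the derivative of the adjoint representation -/

section Bracket

variable {E : Type*} [NormedAddCommGroup E] [NormedSpace ℝ E]
  {G : Type*} [TopologicalSpace G] [ChartedSpace E G] [Group G]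

variable (G) in
/-- The Lie bracket on the model space. -/
noncomputable def bra (x y : E) : E :=
  (Bracket.bracket : GroupLieAlgebra 𝓘(ℝ, E) G → GroupLieAlgebra 𝓘(ℝ, E) G →
    GroupLieAlgebra 𝓘(ℝ, E) G) x y

variable (G) in
/-- The multiplication in the chart. -/
noncomputable def mulChart (z : E × E) : E := chart E (chartInv G z.1 * chartInv G z.2)

variable [FiniteDimensional ℝ E] [LieGroup 𝓘(ℝ, E) ∞ G] [IsTopologicalGroup G]

theorem mulChart_one_right {x : E} (hx : x ∈ chartImg E G) :
    mulChart G (x, chart E (1 : G)) = x := by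
  simp [mulChart, chart_chartInv hx]

theorem contDiffAt_mulChart_right {x : E} (hx : x ∈ chartImg E G) :
    ContDiffAt ℝ ∞ (mulChart G) (x, chart E (1 : G)) :=
  differentiableAt_mul_chart hx chart_one_mem (by simpa using chartInv_mem hx)

theorem contDiffAt_mulChart_left {x : E} (hx : x ∈ chartImg E G) :
    ContDiffAt ℝ ∞ (mulChart G) (chart E (1 : G), x) :=
  differentiableAt_mul_chart chart_one_mem hx (by simpa using chartInv_mem hx)

theorem frame_apply {x : E} (hx : x ∈ chartImg E G) (Y : E) :
    frame G x Y = fderiv ℝ (mulChart G) (x, chart E (1 : G)) (0, Y) := by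
  have h1 : HasFDerivAt (fun y : E => (x, y)) (ContinuousLinearMap.inr ℝ E E) (chart E (1 : G)) :=
    hasFDerivAt_prodMk_right _ _
  have h2 := HasFDerivAt.comp (g := mulChart G) (f := fun y : E => (x, y)) (chart E (1 : G))
    ((contDiffAt_mulChart_right hx).differentiableAt (by simp)).hasFDerivAt h1
  rw [(hasFDerivAt_frame hx).unique h2]; simp

/-- The derivative of the left-invariant frame, in terms of the second derivative of the
multiplication. -/
theorem hasFDerivAt_frame_apply (Y : E) : HasFDerivAt (fun x => frame G x Y)
    (((fderiv ℝ (fderiv ℝ (mulChart G)) (chart E (1 : G), chart E (1 : G))).flip (0, Y)).comp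
      (ContinuousLinearMap.inl ℝ E E)) (chart E (1 : G)) := by
  set p := chart E (1 : G) with hp
  have h : HasFDerivAt (fderiv ℝ (mulChart G)) (fderiv ℝ (fderiv ℝ (mulChart G)) (p, p)) (p, p) :=
    (((contDiffAt_mulChart_right (G := G) (chart_one_mem (E := E))).fderiv_right (m := 1)
      (by exact WithTop.coe_le_coe.2 le_top)).differentiableAt (by simp)).hasFDerivAt
  have h1 : HasFDerivAt (fun x : E => (x, p)) (ContinuousLinearMap.inl ℝ E E) p :=
    hasFDerivAt_prodMk_left _ _
  have h2 := (HasFDerivAt.comp (g := fderiv ℝ (mulChart G)) (f := fun x : E => (x, p)) p h h1)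
  have h3 := h2.clm_apply (hasFDerivAt_const ((0, Y) : E × E) p)
  refine (h3.congr_of_eventuallyEq ?_).congr_fderiv ?_
  · filter_upwards [isOpen_chartImg.mem_nhds (chart_one_mem (E := E) (G := G))] with x hx
    exact frame_apply hx Y
  · ext v; simp

theorem mulInvariantVectorField_chartInv {x : E} (hx : x ∈ chartImg E G)
    (X : GroupLieAlgebra 𝓘(ℝ, E) G) :
    VectorField.mpullbackWithin 𝓘(ℝ, E) 𝓘(ℝ, E) (extChartAt 𝓘(ℝ, E) (1 : G)).symm
      (mulInvariantVectorField X) (range 𝓘(ℝ, E)) x = frame G x X := by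
  rw [VectorField.mpullbackWithin_apply]
  refine (isInvertible_mfderivWithin_extChartAt_symm hx).inverse_apply_eq.2 ?_
  rw [ModelWithCorners.range_eq_univ, mfderivWithin_univ]
  have h1 : HasMFDerivAt 𝓘(ℝ, E) 𝓘(ℝ, E) (chartInv G) x
      (mfderiv 𝓘(ℝ, E) 𝓘(ℝ, E) (chartInv G) x) :=
    ((contMDiffAt_chartInv hx).mdifferentiableAt (by simp)).hasMFDerivAt
  have h2 : HasMFDerivAt 𝓘(ℝ, E) 𝓘(ℝ, E) (fun y : E => mulChart G (x, y)) (chart E (1 : G))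
    (frame (E := E) G x) := (hasFDerivAt_frame hx).hasMFDerivAt
  have h1' : HasMFDerivAt 𝓘(ℝ, E) 𝓘(ℝ, E) (chartInv G) (mulChart G (x, chart E (1 : G)))
      (mfderiv 𝓘(ℝ, E) 𝓘(ℝ, E) (chartInv G) x : E →L[ℝ] E) := by
    rw [mulChart_one_right hx]; exact h1
  have h3 := HasMFDerivAt.comp (f := fun y : E => mulChart G (x, y)) (chart E (1 : G)) h1' h2
  have h4 : HasMFDerivAt 𝓘(ℝ, E) 𝓘(ℝ, E) (fun y : G => chartInv G x * y)
      (chartInv G (chart E (1 : G)))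
      (mfderiv 𝓘(ℝ, E) 𝓘(ℝ, E) (fun y : G => chartInv G x * y) 1 : E →L[ℝ] E) := by
    rw [chartInv_chart_one]; exact hasMFDerivAt_mul_left _ _
  have h5 := h4.comp _ hasMFDerivAt_chartInv
  have e : (chartInv G ∘ fun y : E => mulChart G (x, y)) =ᶠ[𝓝 (chart E (1 : G))]
      ((fun y : G => chartInv G x * y) ∘ chartInv G) := by
    have : Tendsto (fun y : E => chartInv G x * chartInv G y) (𝓝 (chart E (1 : G)))
        (𝓝 (chartInv G x)) := by
      simpa using (tendsto_const_nhds (x := chartInv G x)).mul (tendsto_chartInv (E := E))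
    filter_upwards [this (isOpen_chartDom.mem_nhds (chartInv_mem hx))] with y hy
    exact chartInv_chart hy
  have h6 := hasMFDerivAt_unique h3 (h5.congr_of_eventuallyEq e)
  exact (congrArg (fun L : E →L[ℝ] E => L X) h6).symm

/-- Since the chart has identity derivative at 1, the bracket is that of the two frame fields in the
chart. The frame is the identity at the base point, and its derivative there is a mixed second
derivative of the multiplication. -/
theorem bra_eq (X Y : E) : bra G X Y =
    fderiv ℝ (fderiv ℝ (mulChart G)) (chart E (1 : G), chart E (1 : G)) (X, 0) (0, Y) -
    fderiv ℝ (fderiv ℝ (mulChart G)) (chart E (1 : G), chart E (1 : G)) (Y, 0) (0, X) := by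
  let V : E → E → E := fun Z => VectorField.mpullbackWithin 𝓘(ℝ, E) 𝓘(ℝ, E)
    (extChartAt 𝓘(ℝ, E) (1 : G)).symm
    (mulInvariantVectorField (Z : GroupLieAlgebra 𝓘(ℝ, E) G)) (range 𝓘(ℝ, E))
  let A : E →L[ℝ] E := mfderiv 𝓘(ℝ, E) 𝓘(ℝ, E) (extChartAt 𝓘(ℝ, E) (1 : G)) (1 : G)
  have h0 : bra G X Y = A.inverse (VectorField.lieBracketWithin ℝ (V X) (V Y)
      ((extChartAt 𝓘(ℝ, E) (1 : G)).symm ⁻¹' univ ∩ range 𝓘(ℝ, E)) (chart E (1 : G))) := rfl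
  have hid : A = ContinuousLinearMap.id ℝ E :=
    (hasMFDerivAt_chart_one (E := E) (G := G)).mfderiv
  have hu : ((extChartAt 𝓘(ℝ, E) (1 : G)).symm ⁻¹' univ ∩ range 𝓘(ℝ, E)) = univ := by
    simp
  have hV : ∀ Z : E, V Z =ᶠ[𝓝 (chart E (1 : G))] fun x => frame G x Z := by
    intro Z
    filter_upwards [isOpen_chartImg.mem_nhds (chart_one_mem (E := E) (G := G))] with x hx
    exact mulInvariantVectorField_chartInv hx Z
  have h1 := (hV X).lieBracket_vectorField_eq (𝕜 := ℝ) (hV Y)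
  rw [hu, VectorField.lieBracketWithin_univ] at h0
  have h2 : bra G X Y = VectorField.lieBracket ℝ (fun x => frame G x X) (fun x => frame G x Y)
      (chart E (1 : G)) := by
    rw [← h1, h0, hid]
    simp
  rw [h2, VectorField.lieBracket, (hasFDerivAt_frame_apply X).fderiv,
    (hasFDerivAt_frame_apply Y).fderiv]
  simp [frame_one]

/-- Differentiate x · Y = (Ad(x)Y) · x along x = exp(tX). At t = 0 this gives D(X,0)(0,Y) =
D(0,X)(Y,0) + (d/dt)Ad(x)Y, with D the second derivative of the multiplication; its symmetry turns
the difference of the D terms into `bra_eq`. -/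
theorem hasDerivAt_Ad_expE (X Y : E) :
    HasDerivAt (fun t : ℝ => Ad (expE G (t • X)) Y) (bra G X Y) 0 := by
  set p := chart E (1 : G) with hp
  have hpm : p ∈ chartImg E G := chart_one_mem
  set D := fderiv ℝ (fderiv ℝ (mulChart G)) (p, p) with hD
  have hm := contDiffAt_mulChart_right hpm
  have hDd : HasFDerivAt (fderiv ℝ (mulChart G)) D (p, p) :=
    ((hm.fderiv_right (m := 1) (by exact WithTop.coe_le_coe.2 le_top)).differentiableAt
      (by simp)).hasFDerivAt
  have hsymm : ∀ v w, D v w = D w v := hm.isSymmSndFDerivAt (by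
    rw [minSmoothness_of_isRCLikeNormedField]; exact WithTop.coe_le_coe.2 le_top)
  -- the curve `x(t) = chart (exp (t X))`
  have hx : HasDerivAt (fun t : ℝ => chart E (expE G (t • X))) X 0 := by
    simpa using (hasLeftDeriv_expE_smul (G := G) X 0).2
  have hcont : Tendsto (fun t : ℝ => expE G (t • X)) (𝓝 0) (𝓝 1) := by
    simpa using (hasLeftDeriv_expE_smul (G := G) X 0).1.tendsto
  -- smoothness of the adjoint representation
  let c : E × E → E := fun z => chart E (chartInv G z.1 * chartInv G z.2 * (chartInv G z.1)⁻¹)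
  have hc : ∀ x ∈ chartImg E G, ContDiffAt ℝ ∞ c (x, p) := by
    intro x hx
    have h1 : ContMDiffAt 𝓘(ℝ, E × E) 𝓘(ℝ, E) ∞ (fun z : E × E => chartInv G z.1) (x, p) :=
      contMDiffAt_chartInv_comp contDiffAt_fst hx
    have h2 : ContMDiffAt 𝓘(ℝ, E × E) 𝓘(ℝ, E) ∞ (fun z : E × E => chartInv G z.2) (x, p) :=
      contMDiffAt_chartInv_comp contDiffAt_snd hpm
    refine contDiffAt_chart_comp ((h1.mul h2).mul h1.inv) ?_
    change chartInv G x * chartInv G p * (chartInv G x)⁻¹ ∈ chartDom E G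
    rw [hp, chartInv_chart_one]
    simpa using one_mem_chartDom
  have hAd : ∀ x ∈ chartImg E G, Ad (chartInv G x) Y = fderiv ℝ c (x, p) (0, Y) := by
    intro x hx
    have h1 : HasFDerivAt (fun y : E => (x, y)) (ContinuousLinearMap.inr ℝ E E) p :=
      hasFDerivAt_prodMk_right _ _
    have h2 := HasFDerivAt.comp (g := c) (f := fun y : E => (x, y)) p
      ((hc x hx).differentiableAt (by simp)).hasFDerivAt h1
    rw [(hasFDerivAt_conj (chartInv G x)).unique h2]; simp
  have hdiff : DifferentiableAt ℝ (fun t : ℝ => Ad (expE G (t • X)) Y) 0 := by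
    have h1 : DifferentiableAt ℝ (fderiv ℝ c) (p, p) :=
      (((hc p hpm).fderiv_right (m := 1) (by exact WithTop.coe_le_coe.2 le_top)).differentiableAt
        (by simp))
    have h2 : DifferentiableAt ℝ (fun t : ℝ => (chart E (expE G (t • X)), p)) 0 :=
      hx.differentiableAt.prodMk (differentiableAt_const _)
    have h3 : DifferentiableAt ℝ (fun t : ℝ => fderiv ℝ c (chart E (expE G (t • X)), p)) 0 := by
      refine DifferentiableAt.comp (g := fderiv ℝ c) 0 ?_ h2
      simpa using h1
    refine (h3.clm_apply (differentiableAt_const ((0, Y) : E × E))).congr_of_eventuallyEq ?_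
    filter_upwards [hcont (chartDom_mem_nhds_one (E := E))] with t ht
    change _ = fderiv ℝ c (chart E (expE G (t • X)), p) (0, Y)
    rw [← hAd _ (chart_mem ht), chartInv_chart ht]
  -- the relation `R(x) (Ad(x) Y) = L(x) Y`
  have hrel : ∀ x ∈ chartImg E G, fderiv ℝ (mulChart G) (p, x) (Ad (chartInv G x) Y, 0)
      = frame G x Y := by
    intro x hx
    have hy := hasFDerivAt_conj (E := E) (chartInv G x)
    have h1 : HasFDerivAt (fun y : E => (chart E (chartInv G x * chartInv G y * (chartInv G x)⁻¹), x))
      ((Ad (chartInv G x)).prod (0 : E →L[ℝ] E)) p := hy.prodMk (hasFDerivAt_const _ _)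
    have e : chart E (chartInv G x * chartInv G p * (chartInv G x)⁻¹) = p := by simp [hp]
    have h2 : HasFDerivAt (mulChart G) (fderiv ℝ (mulChart G) (p, x))
        (chart E (chartInv G x * chartInv G p * (chartInv G x)⁻¹), x) := by
      rw [e]
      exact ((contDiffAt_mulChart_left hx).differentiableAt (by simp)).hasFDerivAt
    have h3 := HasFDerivAt.comp (g := mulChart G) (f := fun y : E =>
      (chart E (chartInv G x * chartInv G y * (chartInv G x)⁻¹), x)) p h2 h1
    have e2 : (mulChart G ∘ fun y : E =>
        (chart E (chartInv G x * chartInv G y * (chartInv G x)⁻¹), x)) =ᶠ[𝓝 p]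
        fun y => chart E (chartInv G x * chartInv G y) := by
      have : Tendsto (fun y : E => chartInv G x * chartInv G y * (chartInv G x)⁻¹) (𝓝 p)
          (𝓝 1) := by
        simpa using ((tendsto_const_nhds (x := chartInv G x)).mul
          (tendsto_chartInv (E := E))).mul (tendsto_const_nhds (x := (chartInv G x)⁻¹))
      filter_upwards [this (chartDom_mem_nhds_one (E := E))] with y hy
      simp [mulChart, chartInv_chart hy]
    rw [(hasFDerivAt_frame hx).unique (h3.congr_of_eventuallyEq e2.symm)]
    simp
  -- differentiate the relation along `x(t)`
  have e1 : chart E (expE G ((0 : ℝ) • X)) = p := by simp [hp]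
  have hR : HasDerivAt (fun t : ℝ => fderiv ℝ (mulChart G) (p, chart E (expE G (t • X))))
      (D (0, X)) 0 := by
    have h2 : HasDerivAt (fun t : ℝ => (p, chart E (expE G (t • X)))) (0, X) 0 :=
      (hasDerivAt_const _ _).prodMk hx
    refine HasFDerivAt.comp_hasDerivAt (l := fderiv ℝ (mulChart G)) 0 ?_ h2
    rw [e1]; exact hDd
  have hA := hdiff.hasDerivAt.prodMk (hasDerivAt_const (0 : ℝ) (0 : E))
  have hprod := hR.clm_apply hA
  have hF : HasDerivAt (fun t : ℝ => frame G (chart E (expE G (t • X))) Y) (D (X, 0) (0, Y)) 0 := by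
    have h1 : HasFDerivAt (fun x => frame G x Y)
      ((D.flip (0, Y)).comp (ContinuousLinearMap.inl ℝ E E))
      (chart E (expE G ((0 : ℝ) • X))) := by rw [e1]; exact hasFDerivAt_frame_apply Y
    simpa using! h1.comp_hasDerivAt 0 hx
  have hu := hF.unique (hprod.congr_of_eventuallyEq (by
    filter_upwards [hcont (chartDom_mem_nhds_one (E := E))] with t ht
    rw [← hrel _ (chart_mem ht), chartInv_chart ht]))
  have hRp : ∀ v : E, fderiv ℝ (mulChart G) (p, p) (v, 0) = v := by
    intro v
    have h1 : HasFDerivAt (fun y : E => (y, p)) (ContinuousLinearMap.inl ℝ E E) p :=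
      hasFDerivAt_prodMk_left _ _
    have h2 := HasFDerivAt.comp (g := mulChart G) (f := fun y : E => (y, p)) p
      (hm.differentiableAt (by simp)).hasFDerivAt h1
    have e3 : (mulChart G ∘ fun y : E => (y, p)) =ᶠ[𝓝 p] id := by
      filter_upwards [isOpen_chartImg.mem_nhds hpm] with y hy using mulChart_one_right hy
    have := (h2.congr_of_eventuallyEq e3.symm).unique (hasFDerivAt_id p)
    simpa using congrArg (fun L : E →L[ℝ] E => L v) this
  have hb : bra G X Y = deriv (fun t : ℝ => Ad (expE G (t • X)) Y) 0 := by
    rw [bra_eq, ← hp, ← hD, hu]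
    simp only [zero_smul, expE_zero, Ad_one, ContinuousLinearMap.coe_id', id_eq, ← hp]
    rw [hRp, hsymm (0, X) (Y, 0)]
    abel
  rw [hb]; exact hdiff.hasDerivAt

end Bracket

/-! ### Exponentials of nilpotent operators as finite sums -/

section NilpotentExp

variable {E : Type*} [NormedAddCommGroup E] [NormedSpace ℝ E]

/-- The sum `∑_{k < n} t ^ k / k! N ^ k`, which is the exponential of `t N` if `N ^ n = 0`. -/
noncomputable def expSum (n : ℕ) (N : E →L[ℝ] E) (t : ℝ) : E →L[ℝ] E :=
  ∑ k ∈ Finset.range n, (t ^ k / (k.factorial : ℝ)) • N ^ k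

/-- The primitive `∑_{k < n} t ^ (k + 1) / (k + 1)! N ^ k` of `expSum n N`. -/
noncomputable def expSumPrimitive (n : ℕ) (N : E →L[ℝ] E) (t : ℝ) : E →L[ℝ] E :=
  ∑ k ∈ Finset.range n, (t ^ (k + 1) / ((k + 1).factorial : ℝ)) • N ^ k

theorem hasDerivAt_pow_div_factorial (k : ℕ) (t : ℝ) :
    HasDerivAt (fun t : ℝ => t ^ (k + 1) / ((k + 1).factorial : ℝ))
      (t ^ k / (k.factorial : ℝ)) t := by
  have h := (hasDerivAt_pow (k + 1) t).div_const ((k + 1).factorial : ℝ)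
  refine h.congr_deriv ?_
  have h1 : (k : ℝ) + 1 ≠ 0 := by positivity
  rw [Nat.add_sub_cancel, Nat.factorial_succ]
  push_cast
  exact mul_div_mul_left _ _ h1

theorem hasDerivAt_expSumPrimitive (n : ℕ) (N : E →L[ℝ] E) (t : ℝ) :
    HasDerivAt (expSumPrimitive n N) (expSum n N t) t := by
  unfold expSumPrimitive expSum
  exact HasDerivAt.fun_sum fun k _ =>
    HasDerivAt.smul_const (F := E →L[ℝ] E) (hasDerivAt_pow_div_factorial k t) (N ^ k)

theorem hasDerivAt_expSum {n : ℕ} {N : E →L[ℝ] E} (hN : N ^ n = 0) (t : ℝ) :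
    HasDerivAt (expSum n N) (N * expSum n N t) t := by
  cases n with
  | zero =>
    -- For n = 0 the hypothesis reads 1 = 0, so the space is trivial.
    have : (1 : E →L[ℝ] E) = 0 := by simpa using hN
    have h1 : ∀ A : E →L[ℝ] E, A = 0 := fun A => by rw [← mul_one A, this, mul_zero]
    rw [h1 (N * _)]
    have : expSum 0 N = fun _ => 0 := by ext1; exact h1 _
    rw [this]; exact hasDerivAt_const _ _
  | succ n =>
    have e : expSum (n + 1) N = fun t => N * expSumPrimitive n N t + 1 := by
      ext1 t
      simp only [expSum, expSumPrimitive]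
      rw [Finset.sum_range_succ', Finset.mul_sum]
      simp [pow_succ']
    have h := ((hasDerivAt_expSumPrimitive n N t).const_mul N).add_const 1
    rw [e]
    refine h.congr_deriv ?_
    rw [← e]
    have : expSum (n + 1) N t = expSum n N t + (t ^ n / (n.factorial : ℝ)) • N ^ n := by
      simp only [expSum]; rw [Finset.sum_range_succ]
    rw [this, mul_add, mul_smul_comm, ← pow_succ', hN, smul_zero, add_zero]

theorem expSum_zero {n : ℕ} {N : E →L[ℝ] E} (hN : N ^ n = 0) : expSum n N 0 = 1 := by
  cases n with
  | zero => simpa [expSum] using hN.symm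
  | succ n =>
    simp only [expSum]
    rw [Finset.sum_range_succ']
    simp

@[simp] theorem expSumPrimitive_zero (n : ℕ) (N : E →L[ℝ] E) : expSumPrimitive n N 0 = 0 := by
  simp [expSumPrimitive]

theorem expSum_apply_of_apply_eq_zero {n : ℕ} {N : E →L[ℝ] E} (hN : N ^ n = 0) {v : E}
    (hv : N v = 0) (t : ℝ) : expSum n N t v = v := by
  cases n with
  | zero =>
    have h : (N ^ 0) v = (0 : E →L[ℝ] E) v := by rw [hN]
    have : v = 0 := by simpa using h
    simp [this]
  | succ n =>
    simp only [expSum]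
    rw [Finset.sum_range_succ']
    simp [pow_succ, hv]

/-- Uniqueness for the linear equation y' = Ny, which the finite sum solves exactly because N ^ n =
0 kills the leftover term. -/
theorem eq_expSum_apply {n : ℕ} {N : E →L[ℝ] E} (hN : N ^ n = 0) {y : ℝ → E}
    (hy : ∀ t, HasDerivAt y (N (y t)) t) (t : ℝ) : y t = expSum n N t (y 0) := by
  have h1 : ∀ t, HasDerivAt (fun t => expSum n N t (y 0)) (N (expSum n N t (y 0))) t := fun t =>
    by simpa using (hasDerivAt_expSum hN t).clm_apply (hasDerivAt_const t (y 0))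
  have := ODE_solution_unique_univ (v := fun _ x => N x) (s := fun _ => univ) (K := ‖N‖₊)
    (t₀ := 0) (f := y) (g := fun t => expSum n N t (y 0))
    (fun t => (N.lipschitz).lipschitzOnWith) (fun t => ⟨hy t, mem_univ _⟩)
    (fun t => ⟨h1 t, mem_univ _⟩) (by simp [expSum_zero hN])
  exact congrFun this t

end NilpotentExp

/-! ### The derivative of the exponential map -/

section DerivExp

variable {E : Type*} [NormedAddCommGroup E] [NormedSpace ℝ E]
  {G : Type*} [TopologicalSpace G] [ChartedSpace E G] [Group G]

variable (G) in
/-- The Lie bracket as a continuous bilinear map. -/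
noncomputable def adL : E →L[ℝ] E →L[ℝ] E :=
  let β := (fderiv ℝ (fderiv ℝ (mulChart G)) (chart E (1 : G), chart E (1 : G))).bilinearComp
    (ContinuousLinearMap.inl ℝ E E) (ContinuousLinearMap.inr ℝ E E)
  β - β.flip

variable [FiniteDimensional ℝ E] [LieGroup 𝓘(ℝ, E) ∞ G] [IsTopologicalGroup G]

theorem adL_apply (X Y : E) : adL G X Y = bra G X Y := by
  rw [bra_eq]; simp [adL]

theorem adL_self (X : E) : adL G X X = 0 := by simp [adL]

theorem hasDerivAt_Ad_expE' (X Y : E) (t : ℝ) :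
    HasDerivAt (fun t : ℝ => Ad (expE G (t • X)) Y) (adL G X (Ad (expE G (t • X)) Y)) t := by
  have h := hasDerivAt_Ad_expE (G := G) X (Ad (expE G (t • X)) Y)
  rw [← sub_self t] at h
  have h2 := HasDerivAt.comp_sub_const t t h
  rw [adL_apply]
  refine h2.congr_of_eventuallyEq (Eventually.of_forall fun s => ?_)
  change Ad (expE G (s • X)) Y = Ad (expE G ((s - t) • X)) (Ad (expE G (t • X)) Y)
  rw [← Ad_mul_apply, ← expE_add_smul, sub_add_cancel]

/-- Ad(exp(tX))Y solves y' = [X, y] with initial value Y, a linear equation with nilpotent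
coefficient. -/
theorem Ad_expE_smul {n : ℕ} {X : E} (hN : adL G X ^ n = 0) (t : ℝ) :
    Ad (expE G (t • X)) = expSum n (adL G X) t := by
  ext Y
  have := eq_expSum_apply hN (fun t => hasDerivAt_Ad_expE' X Y t) t
  simpa using this

/-- In the product rule the terms in z cancel, so the formula is exact in h and not merely of first
order. The curve runs from 1 to exp(z + h) exp(z)⁻¹, and integrating its velocity e^{t ad z} h
yields the derivative of exp. -/
theorem hasLeftDeriv_expE_mul_expE {n : ℕ} {z : E} (hN : adL G z ^ n = 0) (h : E) (t : ℝ) :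
    HasLeftDeriv (fun s : ℝ => expE G (s • (z + h)) * (expE G (s • z))⁻¹) t
      (expSum n (adL G z) t h) := by
  have h1 := (hasLeftDeriv_expE_smul (G := G) (z + h) t).mul
    (hasLeftDeriv_expE_smul (G := G) z t).inv
  convert h1 using 1
  rw [inv_inv, Ad_expE_smul hN, map_add,
    expSum_apply_of_apply_eq_zero hN (adL_self z)]
  abel

theorem continuousAt_frame : ContinuousAt (frame G) (chart E (1 : G)) := by
  set p := chart E (1 : G) with hp
  have h : ContinuousAt (fderiv ℝ (mulChart G)) (p, p) :=
    (((contDiffAt_mulChart_right (G := G) (chart_one_mem (E := E))).fderiv_right (m := 1)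
      (by exact WithTop.coe_le_coe.2 le_top)).continuousAt)
  have h2 : ContinuousAt (fun x : E => (fderiv ℝ (mulChart G) (x, p)).comp
      (ContinuousLinearMap.inr ℝ E E)) p := by
    have h3 : ContinuousAt (fun x : E => fderiv ℝ (mulChart G) (x, p)) p :=
      ContinuousAt.comp (f := fun x : E => (x, p)) h (by fun_prop)
    exact h3.clm_comp continuousAt_const
  refine h2.congr ?_
  filter_upwards [isOpen_chartImg.mem_nhds (chart_one_mem (E := E) (G := G))] with x hx
  ext Y
  simp [frame_apply hx, hp]

/-- A curve with small left derivative `B'` stays in the chart and is close to `B`. -/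
theorem exists_chart_estimate {ε : ℝ} (hε : 0 < ε) (hε1 : ε ≤ 1) : ∃ r > 0,
    ∀ (γ : ℝ → G) (c B : ℝ → E) (η : ℝ), γ 0 = 1 → (∀ t, HasLeftDeriv γ t (c t)) →
      (∀ t ∈ Icc (0 : ℝ) 1, ‖c t‖ ≤ η) → (∀ t, HasDerivAt B (c t) t) → 2 * η < r →
      γ 1 ∈ chartDom E G ∧ ‖chart E (γ 1) - chart E (1 : G) - (B 1 - B 0)‖ ≤ ε * η := by
  have := t2Space_of_chartedSpace E G
  set p := chart E (1 : G) with hp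
  have hpm : p ∈ chartImg E G := chart_one_mem
  -- On this ball the frame is within ε ≤ 1 of the identity, so the speed in the chart is at most (1
  -- + ε)η ≤ 2η.
  obtain ⟨r, hr, hball⟩ := Metric.eventually_nhds_iff_ball.1
    (Filter.Eventually.and (isOpen_chartImg.mem_nhds hpm)
      (continuousAt_frame (E := E) (G := G) (Metric.ball_mem_nhds _ hε)))
  refine ⟨r, hr, fun γ c B η h0 hγ hc hB hη => ?_⟩
  have hη0 : 0 ≤ η := (norm_nonneg _).trans (hc 0 (by simp))
  have hfr : ∀ x ∈ Metric.ball p r, ∀ v : E, ‖frame G x v - v‖ ≤ ε * ‖v‖ := by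
    intro x hx v
    have h1 := (hball x hx).2
    rw [frame_one, Metric.mem_ball, dist_eq_norm] at h1
    have h2 := (frame G x - ContinuousLinearMap.id ℝ E).le_of_opNorm_le h1.le v
    simpa using h2
  have hcont : Continuous γ := continuous_iff_continuousAt.2 fun t => (hγ t).1
  set O : Set G := {g | g ∈ chartDom E G ∧ chart E g ∈ Metric.ball p r} with hO
  have hOo : IsOpen O := by
    have hch : ContinuousOn (chart E) (chartDom E G) := fun g hg =>
      (continuousAt_chart hg).continuousWithinAt
    exact hch.isOpen_inter_preimage isOpen_chartDom Metric.isOpen_ball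
  have h1O : (1 : G) ∈ O := ⟨one_mem_chartDom, Metric.mem_ball_self hr⟩
  -- the bound as long as the curve stays in the chart
  have hder : ∀ t, γ t ∈ O → HasDerivAt (fun s => chart E (γ s)) (frame G (chart E (γ t)) (c t)) t := by
    intro t ht
    have := (hγ t).hasDerivAt_chart (g := 1) (by simpa using ht.1)
    simpa using this
  have hbd : ∀ T ∈ Icc (0 : ℝ) 1, (∀ t ∈ Icc 0 T, γ t ∈ O) → ‖chart E (γ T) - p‖ ≤ 2 * η := by
    intro T hT h
    have := norm_image_sub_le_of_norm_deriv_le_segment' (f := fun s => chart E (γ s)) (a := 0)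
      (b := T) (C := 2 * η) (fun t ht => (hder t (h t ht)).hasDerivWithinAt) (fun t ht => by
        have h1 := hfr _ (h t ⟨ht.1, ht.2.le⟩).2 (c t)
        have h2 := hc t ⟨ht.1, ht.2.le.trans hT.2⟩
        have h3 := norm_le_norm_add_norm_sub' (frame G (chart E (γ t)) (c t)) (c t)
        have h4 : ε * ‖c t‖ ≤ 1 * η := by gcongr
        linarith) T ⟨hT.1, le_rfl⟩
    rw [h0] at this
    refine this.trans ?_
    have := hT.2
    nlinarith [hT.1]
  set K : Set G := chartInv G '' Metric.closedBall p (2 * η) with hK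
  have hsub : Metric.closedBall p (2 * η) ⊆ Metric.ball p r := Metric.closedBall_subset_ball hη
  have hKc : IsClosed K := by
    refine ((isCompact_closedBall p (2 * η)).image_of_continuousOn fun x hx => ?_).isClosed
    exact (continuousAt_chartInv (hball x (hsub hx)).1).continuousWithinAt
  have hKO : K ⊆ O := by
    rintro _ ⟨x, hx, rfl⟩
    have := (hball x (hsub hx)).1
    exact ⟨chartInv_mem this, by rw [chart_chartInv this]; exact hsub hx⟩
  -- Take the first exit time T from O. Before T the curve stays in the image K of a closed ball of
  -- radius 2η < r; K is compact, hence closed, so γ T lies in K ⊆ O, a contradiction.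
  have hall : ∀ t ∈ Icc (0 : ℝ) 1, γ t ∈ O := by
    by_contra hne
    push Not at hne
    have hDc : IsCompact (Icc (0 : ℝ) 1 ∩ γ ⁻¹' Oᶜ) :=
      isCompact_Icc.inter_right (hOo.isClosed_compl.preimage hcont)
    obtain ⟨t₁, ht₁, ht₁'⟩ := hne
    obtain ⟨T, ⟨hT, hTO⟩, hmin⟩ := hDc.exists_isLeast ⟨t₁, ht₁, ht₁'⟩
    have hlt : ∀ t ∈ Icc (0 : ℝ) 1, t < T → γ t ∈ O := fun t ht htT => by
      by_contra hn
      exact absurd (hmin ⟨ht, hn⟩) (not_le.2 htT)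
    have hT0 : 0 < T := by
      rcases hT.1.eq_or_lt with h | h
      · exact absurd (by rw [← h, h0]; exact h1O) hTO
      · exact h
    have hmem : γ T ∈ K := by
      refine hKc.mem_of_tendsto (b := 𝓝[<] T) (hcont.continuousAt.tendsto.mono_left
        nhdsWithin_le_nhds) ?_
      filter_upwards [Ioo_mem_nhdsLT hT0] with t ht
      have ht1 : t ∈ Icc (0 : ℝ) 1 := ⟨ht.1.le, ht.2.le.trans hT.2⟩
      have h1 := hbd t ht1 fun s hs => hlt s ⟨hs.1, hs.2.trans ht1.2⟩ (hs.2.trans_lt ht.2)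
      exact ⟨chart E (γ t), by rwa [Metric.mem_closedBall, dist_eq_norm],
        chartInv_chart (hlt t ht1 ht.2).1⟩
    exact hTO (hKO hmem)
  refine ⟨(hall 1 (by simp)).1, ?_⟩
  have := norm_image_sub_le_of_norm_deriv_le_segment' (f := fun s => chart E (γ s) - B s) (a := 0)
      (b := 1) (C := ε * η) (fun t ht => ((hder t (hall t ht)).sub (hB t)).hasDerivWithinAt)
      (fun t ht => by
        have h1 := hfr _ (hall t ⟨ht.1, ht.2.le⟩).2 (c t)
        have h2 := hc t ⟨ht.1, ht.2.le⟩
        exact h1.trans (by gcongr)) 1 (by simp)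
  rw [h0, sub_zero, mul_one] at this
  convert this using 2
  rw [← hp]; abel

variable (G) in
/-- The left-trivialized derivative of the exponential map. -/
noncomputable def dexp (n : ℕ) (z : E) : E →L[ℝ] E :=
  (expSum n (adL G z) (-1)).comp (expSumPrimitive n (adL G z) 1)

/-- The derivative is the integral over [0, 1] of e^{t ad z}. The chart estimate with η = C‖h‖ and
precision ε / C bounds the error by ε‖h‖. The second claim is needed because the chart says nothing
about points outside its domain. -/
theorem hasFDerivAt_expE_right {n : ℕ} {z : E} (hN : adL G z ^ n = 0) :
    HasFDerivAt (fun h => chart E (expE G (z + h) * (expE G z)⁻¹))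
      (expSumPrimitive n (adL G z) 1) 0 ∧
    Tendsto (fun h => expE G (z + h) * (expE G z)⁻¹) (𝓝 0) (𝓝 1) := by
  set p := chart E (1 : G) with hp
  -- a bound for the adjoint representation along `exp (t z)`
  obtain ⟨C, hC0, hC⟩ : ∃ C > 0, ∀ t ∈ Icc (0 : ℝ) 1, ‖expSum n (adL G z) t‖ ≤ C := by
    have : ContinuousOn (expSum n (adL G z)) (Icc (0 : ℝ) 1) := fun t _ =>
      (hasDerivAt_expSum hN t).continuousAt.continuousWithinAt
    obtain ⟨C, hC⟩ := isCompact_Icc.exists_bound_of_continuousOn this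
    exact ⟨max C 1, by positivity, fun t ht => (hC t ht).trans (le_max_left _ _)⟩
  have key : ∀ ε > 0, ∀ᶠ h in 𝓝 (0 : E), expE G (z + h) * (expE G z)⁻¹ ∈ chartDom E G ∧
      ‖chart E (expE G (z + h) * (expE G z)⁻¹) - p - expSumPrimitive n (adL G z) 1 h‖ ≤
        ε * ‖h‖ := by
    intro ε hε
    obtain ⟨r, hr, H⟩ := exists_chart_estimate (E := E) (G := G) (ε := min (ε / C) 1)
      (by positivity) (min_le_right _ _)
    have : ∀ᶠ h in 𝓝 (0 : E), 2 * (C * ‖h‖) < r := by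
      have : Tendsto (fun h : E => 2 * (C * ‖h‖)) (𝓝 0) (𝓝 (2 * (C * ‖(0 : E)‖))) :=
        (Continuous.tendsto (by fun_prop) 0)
      rw [norm_zero, mul_zero, mul_zero] at this
      exact this.eventually (gt_mem_nhds hr)
    filter_upwards [this] with h hh
    obtain ⟨h1, h2⟩ := H (fun s : ℝ => expE G (s • (z + h)) * (expE G (s • z))⁻¹)
      (fun t => expSum n (adL G z) t h) (fun t => expSumPrimitive n (adL G z) t h) (C * ‖h‖)
      (by simp) (hasLeftDeriv_expE_mul_expE hN h)
      (fun t ht => (expSum n (adL G z) t).le_of_opNorm_le (hC t ht) h)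
      (fun t => by
        simpa using (hasDerivAt_expSumPrimitive n (adL G z) t).clm_apply (hasDerivAt_const t h)) hh
    simp only [one_smul, expSumPrimitive_zero, zero_apply, sub_zero] at h1 h2
    refine ⟨h1, h2.trans ?_⟩
    calc min (ε / C) 1 * (C * ‖h‖) ≤ (ε / C) * (C * ‖h‖) := by
          gcongr; exact min_le_left _ _
      _ = ε * ‖h‖ := by field_simp
  have hd : HasFDerivAt (fun h => chart E (expE G (z + h) * (expE G z)⁻¹))
      (expSumPrimitive n (adL G z) 1) 0 := by
    rw [hasFDerivAt_iff_isLittleO]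
    refine Asymptotics.isLittleO_iff.2 fun ε hε => ?_
    filter_upwards [key ε hε] with h hh
    simpa [hp] using hh.2
  refine ⟨hd, ?_⟩
  have h1 : Tendsto (fun h => chart E (expE G (z + h) * (expE G z)⁻¹)) (𝓝 0) (𝓝 p) := by
    simpa [hp] using hd.continuousAt.tendsto
  refine ((tendsto_chartInv (E := E) (G := G)).comp h1).congr' ?_
  filter_upwards [key 1 one_pos] with h hh
  exact chartInv_chart hh.1

theorem continuousAt_expE {n : ℕ} {z : E} (hN : adL G z ^ n = 0) : ContinuousAt (expE G) z := by
  have h1 := (hasFDerivAt_expE_right hN).2.mul_const (expE G z)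
  rw [one_mul] at h1
  have h2 : Tendsto (fun y => y - z) (𝓝 z) (𝓝 0) := by
    simpa using (tendsto_id (x := 𝓝 z)).sub_const z
  simpa [Function.comp_def] using! h1.comp h2

/-- Conjugation by exp(z)⁻¹ turns the right quotient into the left one, which adds the factor
Ad(exp(-z)) = e^{-ad z}. -/
theorem hasFDerivAt_expE {n : ℕ} {z : E} (hN : adL G z ^ n = 0) :
    HasFDerivAt (fun y => chart E ((expE G z)⁻¹ * expE G y)) (dexp G n z) z := by
  set p := chart E (1 : G) with hp
  obtain ⟨h1, h2⟩ := hasFDerivAt_expE_right hN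
  have e : chart E (expE G (z + 0) * (expE G z)⁻¹) = p := by simp [hp]
  have h3 : HasFDerivAt (fun y : E => chart E ((expE G z)⁻¹ * chartInv G y * (expE G z)⁻¹⁻¹))
      (Ad (expE G z)⁻¹) (chart E (expE G (z + 0) * (expE G z)⁻¹)) := by
    rw [e]; exact hasFDerivAt_conj _
  have h4 := HasFDerivAt.comp (f := fun h => chart E (expE G (z + h) * (expE G z)⁻¹)) 0 h3 h1
  have h5 : HasFDerivAt (fun h => chart E ((expE G z)⁻¹ * expE G (z + h))) (dexp G n z) 0 := by
    have e2 : (Ad (expE G z)⁻¹).comp (expSumPrimitive n (adL G z) 1) = dexp G n z := by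
      have := Ad_expE_smul hN (-1)
      rw [neg_one_smul, expE_neg] at this
      rw [this]; rfl
    rw [← e2]
    refine h4.congr_of_eventuallyEq ?_
    filter_upwards [h2 (chartDom_mem_nhds_one (E := E))] with h hh
    simp only [Function.comp]
    rw [chartInv_chart hh]
    congr 1
    group
  rw [← sub_self z] at h5
  have h6 := HasFDerivAt.comp (f := fun y => y - z) z h5 ((hasFDerivAt_id z).sub_const z)
  simpa [Function.comp_def] using! h6

/-- The chain rule for `exp`. -/
theorem hasLeftDeriv_expE_comp {n : ℕ} {ζ : ℝ → E} {v : E} {t : ℝ}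
    (hN : adL G (ζ t) ^ n = 0) (hζ : HasDerivAt ζ v t) :
    HasLeftDeriv (fun s => expE G (ζ s)) t (dexp G n (ζ t) v) :=
  ⟨ContinuousAt.comp (f := ζ) (continuousAt_expE hN) hζ.continuousAt,
    (hasFDerivAt_expE hN).comp_hasDerivAt t hζ⟩

end DerivExp

/-! ### The grading, algebra dilations and nilpotency -/

section Graded

variable {E : Type*} [NormedAddCommGroup E] [NormedSpace ℝ E] [FiniteDimensional ℝ E]
  {G : Type*} [TopologicalSpace G] [ChartedSpace E G] [Group G]

variable {s : ℕ} (S : Stratification E G s)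

/-- The layers, as subspaces of the model space. -/
def Stratification.lay (i : ℕ) : Submodule ℝ E := S.V i

/-- The dilation of the Lie algebra, as a continuous linear map of the model space. -/
noncomputable def Stratification.dil (t : ℝ) : E →L[ℝ] E :=
  LinearMap.toContinuousLinearMap (S.algDilation t : E →ₗ[ℝ] E)

theorem Stratification.dil_apply (t : ℝ) (x : E) : S.dil t x = S.algDilation t x := rfl

theorem Stratification.lay_zero : S.lay 0 = ⊥ := S.layer_zero

theorem Stratification.lay_of_gt {i : ℕ} (h : s < i) : S.lay i = ⊥ := S.layer_of_gt i h

theorem Stratification.iSup_lay : ⨆ i, S.lay i = ⊤ := S.isInternal.submodule_iSup_eq_top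

theorem Stratification.dil_of_mem {i : ℕ} {x : E} (hx : x ∈ S.lay i) (t : ℝ) :
    S.dil t x = t ^ i • x := by
  rw [S.dil_apply]
  have h : (LinearEquiv.ofBijective (DirectSum.coeLinearMap S.V) S.bijective).symm x =
      DirectSum.lof ℝ ℕ (fun i => S.V i) i ⟨x, hx⟩ := by
    exact (LinearEquiv.symm_apply_eq _).2 (DirectSum.coeLinearMap_lof S.V i ⟨x, hx⟩).symm
  have h2 : S.algDilation t x = DirectSum.toModule ℝ ℕ _ (fun i => t ^ i • (S.V i).subtype)
    ((LinearEquiv.ofBijective (DirectSum.coeLinearMap S.V) S.bijective).symm x) := rfl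
  rw [h2, h, DirectSum.toModule_lof]
  rfl

/-- Induction on the graded decomposition. -/
@[elab_as_elim]
theorem Stratification.lay_induction {p : E → Prop} (x : E) (h : ∀ i, ∀ x ∈ S.lay i, p x)
    (h0 : p 0) (hadd : ∀ x y, p x → p y → p (x + y)) : p x :=
  Submodule.iSup_induction S.lay (motive := p) (by rw [S.iSup_lay]; trivial) h h0 hadd

theorem Stratification.dil_mul (a b : ℝ) (x : E) : S.dil (a * b) x = S.dil a (S.dil b x) := by
  refine S.lay_induction x (fun i x hx => ?_) (by simp) (fun x y h1 h2 => by simp [h1, h2])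
  rw [S.dil_of_mem hx, S.dil_of_mem hx, map_smul, S.dil_of_mem hx, smul_smul, mul_pow, mul_comm]

@[simp] theorem Stratification.dil_one (x : E) : S.dil 1 x = x := by
  refine S.lay_induction x (fun i x hx => ?_) (by simp) (fun x y h1 h2 => by simp [h1, h2])
  simp [S.dil_of_mem hx]

@[simp] theorem Stratification.dil_zero (x : E) : S.dil 0 x = 0 := by
  refine S.lay_induction x (fun i x hx => ?_) (by simp) (fun x y h1 h2 => by simp [h1, h2])
  rcases Nat.eq_zero_or_pos i with rfl | h
  · rw [S.lay_zero, Submodule.mem_bot] at hx; simp [hx]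
  · simp [S.dil_of_mem hx, zero_pow h.ne']

theorem Stratification.continuous_dil : Continuous S.dil := by
  refine continuous_clm_apply.2 fun x => ?_
  refine S.lay_induction x (fun i x hx => ?_) (by simpa using continuous_const)
    (fun x y h1 h2 => by simpa using! h1.add h2)
  simp only [S.dil_of_mem hx]
  fun_prop

theorem Stratification.dil_inv_dil {t : ℝ} (ht : t ≠ 0) (x : E) : S.dil t⁻¹ (S.dil t x) = x := by
  rw [← S.dil_mul, inv_mul_cancel₀ ht, S.dil_one]

theorem Stratification.dil_dil_inv {t : ℝ} (ht : t ≠ 0) (x : E) : S.dil t (S.dil t⁻¹ x) = x := by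
  rw [← S.dil_mul, mul_inv_cancel₀ ht, S.dil_one]

/-- Every bounded set is contracted into a neighborhood of zero by some dilation. -/
theorem Stratification.exists_dil_mem {B : Set E} (hB : B ∈ 𝓝 0) (R : ℝ) :
    ∃ r : ℝ, 0 < r ∧ ∀ x, ‖x‖ ≤ R → S.dil r x ∈ B := by
  obtain ⟨ε, hε, hball⟩ := Metric.mem_nhds_iff.1 hB
  have h0 : S.dil 0 = 0 := by ext x; simp
  have h1 : Tendsto (fun r => ‖S.dil r‖ * |R|) (𝓝[>] 0) (𝓝 0) := by
    have : Tendsto (fun r => ‖S.dil r‖ * |R|) (𝓝 0) (𝓝 (‖S.dil 0‖ * |R|)) :=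
      (S.continuous_dil.norm.mul continuous_const).tendsto 0
    rw [h0, norm_zero, zero_mul] at this
    exact this.mono_left nhdsWithin_le_nhds
  obtain ⟨r, hr, hr0⟩ := ((h1.eventually (gt_mem_nhds hε)).and self_mem_nhdsWithin).exists
  refine ⟨r, hr0, fun x hx => hball ?_⟩
  rw [mem_ball_zero_iff]
  refine ((S.dil r).le_opNorm x).trans_lt (lt_of_le_of_lt ?_ hr)
  gcongr
  exact hx.trans (le_abs_self R)

variable [LieGroup 𝓘(ℝ, E) ∞ G] [IsTopologicalGroup G]

theorem adL_leibniz (x y z : E) :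
    adL G x (adL G y z) = adL G (adL G x y) z + adL G y (adL G x z) := by
  have := lieGroup_minSmoothness (E := E) (G := G)
  simp only [adL_apply]
  exact (leibniz_lie : ∀ x y z : GroupLieAlgebra 𝓘(ℝ, E) G, ⁅x, ⁅y, z⁆⁆ = ⁅⁅x, y⁆, z⁆ + ⁅y, ⁅x, z⁆⁆) x y z

theorem Stratification.span_adL {i : ℕ} (h1 : 1 ≤ i) (h2 : i ≤ s) :
    Submodule.span ℝ {z | ∃ a ∈ S.lay 1, ∃ b ∈ S.lay i, z = adL G a b} = S.lay (i + 1) := by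
  have h := S.span_bracket i h1 h2
  refine Eq.trans ?_ h
  simp only [adL_apply]
  rfl

theorem Stratification.adL_mem_one {j : ℕ} {x y : E} (hx : x ∈ S.lay 1) (hy : y ∈ S.lay j) :
    adL G x y ∈ S.lay (1 + j) := by
  rcases Nat.eq_zero_or_pos j with rfl | hj
  · rw [S.lay_zero, Submodule.mem_bot] at hy; simp [hy]
  rcases le_or_gt j s with h | h
  · rw [add_comm, ← S.span_adL hj h]
    exact Submodule.subset_span ⟨x, hx, y, hy, rfl⟩
  · rw [S.lay_of_gt h, Submodule.mem_bot] at hy; simp [hy]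

/-- Induction on i: the layer i + 1 is spanned by brackets [a, b] with a in the first layer and b in
layer i, and the Jacobi identity rewrites [[a, b], y] through brackets already controlled. -/
theorem Stratification.adL_mem {i : ℕ} : ∀ {j : ℕ} {x y : E}, x ∈ S.lay i → y ∈ S.lay j →
    adL G x y ∈ S.lay (i + j) := by
  induction i with
  | zero =>
    intro j x y hx hy
    rw [S.lay_zero, Submodule.mem_bot] at hx; simp [hx]
  | succ i ih =>
    intro j x y hx hy
    rcases Nat.eq_zero_or_pos i with rfl | hi
    · simpa using S.adL_mem_one hx hy
    rcases le_or_gt i s with h | h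
    · rw [← S.span_adL hi h] at hx
      induction hx using Submodule.span_induction with
      | mem x hx =>
        obtain ⟨a, ha, b, hb, rfl⟩ := hx
        have h1 := adL_leibniz (G := G) a b y
        have h2 : adL G (adL G a b) y = adL G a (adL G b y) - adL G b (adL G a y) := by
          rw [h1]; abel
        rw [h2]
        have h3 := S.adL_mem_one ha (ih hb hy)
        have h4 := ih hb (S.adL_mem_one ha hy)
        rw [show 1 + (i + j) = i + 1 + j by ring] at h3
        rw [show i + (1 + j) = i + 1 + j by ring] at h4
        exact Submodule.sub_mem _ h3 h4
      | zero => simp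
      | add x y _ _ h1 h2 => simpa using Submodule.add_mem _ h1 h2
      | smul c x _ h1 => simpa using Submodule.smul_mem _ c h1
    · rw [S.lay_of_gt (by omega), Submodule.mem_bot] at hx; simp [hx]

theorem Stratification.adL_dil (t : ℝ) (x y : E) :
    adL G (S.dil t x) (S.dil t y) = S.dil t (adL G x y) := by
  refine S.lay_induction x (fun i x hx => ?_) (by simp) (fun x y h1 h2 => by simp [h1, h2])
  refine S.lay_induction y (fun j y hy => ?_) (by simp) (fun x y h1 h2 => by simp [h1, h2])
  rw [S.dil_of_mem hx, S.dil_of_mem hy, S.dil_of_mem (S.adL_mem hx hy)]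
  simp [smul_smul, pow_add, mul_comm]

/-- Every layer carrying part of z has positive degree, so ad z maps the sum F k of the layers of
degree at least k into F (k + 1), and F (s + 1) = 0. -/
theorem Stratification.adL_pow (S : Stratification E G s) (z : E) : adL G z ^ (s + 1) = 0 := by
  let F : ℕ → Submodule ℝ E := fun k => ⨆ i, ⨆ (_ : k ≤ i), S.lay i
  have hle : ∀ {k i : ℕ}, k ≤ i → S.lay i ≤ F k := fun {k i} h =>
    le_iSup₂_of_le (f := fun i (_ : k ≤ i) => S.lay i) i h le_rfl
  have hF : ∀ k, F k ≤ (F (k + 1)).comap (adL G z : E →ₗ[ℝ] E) := by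
    intro k
    refine iSup₂_le fun i hi y hy => ?_
    rw [Submodule.mem_comap]
    change adL G z y ∈ F (k + 1)
    refine S.lay_induction z (fun j z hz => ?_) (by simp)
      (fun x x' h1 h2 => by simpa using Submodule.add_mem _ h1 h2)
    rcases Nat.eq_zero_or_pos j with rfl | hj
    · rw [S.lay_zero, Submodule.mem_bot] at hz; simp [hz]
    · exact hle (by omega) (S.adL_mem hz hy)
  have hpow : ∀ k, ∀ y, (adL G z ^ k) y ∈ F k := by
    intro k
    induction k with
    | zero =>
      intro y
      have : F 0 = ⊤ := by simp [F, S.iSup_lay]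
      rw [this]; trivial
    | succ k ih =>
      intro y
      rw [pow_succ', mul_apply_eq_comp]
      exact hF k (ih y)
  have hbot : F (s + 1) = ⊥ := by
    refine le_bot_iff.1 (iSup₂_le fun i hi => ?_)
    rw [S.lay_of_gt (by omega)]
  ext y
  have := hpow (s + 1) y
  rw [hbot, Submodule.mem_bot] at this
  simpa using this

/-- A subspace that contains the first layer and is stable under brackets with it is everything. -/
theorem Stratification.eq_top_of_stable {m : Submodule ℝ E} (h1 : S.lay 1 ≤ m)
    (h2 : ∀ a ∈ S.lay 1, ∀ b ∈ m, adL G a b ∈ m) : m = ⊤ := by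
  have : ∀ i, S.lay (i + 1) ≤ m := by
    intro i
    induction i with
    | zero => exact h1
    | succ i ih =>
      rcases le_or_gt (i + 1) s with h | h
      · rw [← S.span_adL (by omega) h, Submodule.span_le]
        rintro _ ⟨a, ha, b, hb, rfl⟩
        exact h2 a ha b (ih hb)
      · rw [S.lay_of_gt (by omega)]; exact bot_le
  refine top_le_iff.1 (S.iSup_lay.symm.trans_le (iSup_le fun i => ?_))
  cases i with
  | zero => rw [S.lay_zero]; exact bot_le
  | succ i => exact this i

theorem Stratification.adL_dil_pow (t : ℝ) (z : E) (k : ℕ) (y : E) :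
    (adL G (S.dil t z) ^ k) (S.dil t y) = S.dil t ((adL G z ^ k) y) := by
  induction k with
  | zero => simp
  | succ k ih => rw [pow_succ', pow_succ', mul_apply_eq_comp, ih, S.adL_dil]; rfl

/-- `dexp` is a product of polynomials in ad z, and a dilation preserves brackets. This identity is
what transports dilations from the algebra to the group. -/
theorem Stratification.dexp_dil (n : ℕ) (t : ℝ) (z v : E) :
    dexp G n (S.dil t z) (S.dil t v) = S.dil t (dexp G n z v) := by
  have h : ∀ (c : ℕ → ℝ) (y : E),
      (∑ k ∈ Finset.range n, c k • adL G (S.dil t z) ^ k) (S.dil t y) =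
      S.dil t ((∑ k ∈ Finset.range n, c k • adL G z ^ k) y) := by
    intro c y
    simp only [sum_apply, smul_apply, map_sum, map_smul,
      S.adL_dil_pow]
  simp only [dexp, ContinuousLinearMap.comp_apply]
  rw [expSumPrimitive, expSumPrimitive, h, expSum, expSum, h]

end Graded

/-! ### Smoothness of the exponential and the local logarithm -/

section SmoothExp

variable {E : Type*} [NormedAddCommGroup E] [NormedSpace ℝ E] [FiniteDimensional ℝ E]
  {G : Type*} [TopologicalSpace G] [ChartedSpace E G] [Group G]
  [LieGroup 𝓘(ℝ, E) ∞ G] [IsTopologicalGroup G] {n : ℕ}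

theorem continuous_expE (hN : ∀ z : E, adL G z ^ n = 0) : Continuous (expE (E := E) G) :=
  continuous_iff_continuousAt.2 fun z => continuousAt_expE (hN z)

theorem contDiff_dexp (n : ℕ) : ContDiff ℝ ∞ (dexp (E := E) G n) := by
  have hpow : ∀ k, ContDiff ℝ ∞ (fun z : E => adL G z ^ k) := by
    intro k
    induction k with
    | zero => simpa using contDiff_const
    | succ k ih =>
      simp only [pow_succ]
      exact ContDiff.clm_comp ih ((adL G : E →L[ℝ] E →L[ℝ] E).contDiff)
  have h1 : ContDiff ℝ ∞ (fun z : E => expSum n (adL G z) (-1)) := by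
    unfold expSum
    exact ContDiff.sum fun k _ => (hpow k).const_smul (_ : ℝ)
  have h2 : ContDiff ℝ ∞ (fun z : E => expSumPrimitive n (adL G z) 1) := by
    unfold expSumPrimitive
    exact ContDiff.sum fun k _ => (hpow k).const_smul (_ : ℝ)
  exact h1.clm_comp h2

theorem contDiffOn_frame : ContDiffOn ℝ ∞ (frame G) (chartImg E G) := by
  intro x hx
  set p := chart E (1 : G) with hp
  have h : ContDiffAt ℝ ∞ (fderiv ℝ (mulChart G)) (x, p) :=
    (contDiffAt_mulChart_right hx).fderiv_right (m := ∞) (by simp)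
  have h2 : ContDiffAt ℝ ∞ (fun x : E => (fderiv ℝ (mulChart G) (x, p)).comp
      (ContinuousLinearMap.inr ℝ E E)) x := by
    have h3 : ContDiffAt ℝ ∞ (fun x : E => fderiv ℝ (mulChart G) (x, p)) x :=
      ContDiffAt.comp (f := fun x : E => (x, p)) x h (by fun_prop)
    exact h3.clm_comp contDiffAt_const
  refine (h2.congr_of_eventuallyEq ?_).contDiffWithinAt
  filter_upwards [isOpen_chartImg.mem_nhds hx] with x hx
  ext Y
  simp [frame_apply hx, hp]

theorem hasFDerivAt_chart_expE (hN : ∀ z : E, adL G z ^ n = 0) {z : E}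
    (hz : expE G z ∈ chartDom E G) : HasFDerivAt (fun y : E => chart E (expE G y))
      ((frame G (chart E (expE G z))).comp (dexp G n z)) z := by
  have h1 := hasFDerivAt_expE (hN z)
  have h2 := hasFDerivAt_frame (chart_mem hz)
  have e : chart E ((expE G z)⁻¹ * expE G z) = chart E (1 : G) := by simp
  rw [← e] at h2
  have h3 := HasFDerivAt.comp (f := fun y => chart E ((expE G z)⁻¹ * expE G y)) z h2 h1
  refine h3.congr_of_eventuallyEq ?_
  have h4 : Tendsto (fun y => (expE G z)⁻¹ * expE G y) (𝓝 z) (𝓝 1) := by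
    simpa using ((continuous_expE hN).tendsto z).const_mul (expE G z)⁻¹
  filter_upwards [h4 (chartDom_mem_nhds_one (E := E))] with y hy
  simp only [Function.comp]
  rw [chartInv_chart hz, chartInv_chart hy]
  congr 1
  group

/-- Bootstrap: the derivative of chart ∘ exp is a smooth expression in z and in chart ∘ exp itself,
so class C^k implies C^{k+1}. -/
theorem contDiffOn_chart_expE (hN : ∀ z : E, adL G z ^ n = 0) :
    ContDiffOn ℝ ∞ (fun y : E => chart E (expE G y)) ((expE (E := E) G) ⁻¹' chartDom E G) := by
  have ho : IsOpen ((expE (E := E) G) ⁻¹' chartDom E G) := isOpen_chartDom.preimage (continuous_expE hN)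
  rw [contDiffOn_infty]
  intro k
  induction k with
  | zero =>
    exact contDiffOn_zero.2 fun z hz => (hasFDerivAt_chart_expE hN hz).continuousAt.continuousWithinAt
  | succ k ih =>
    rw [Nat.cast_add, Nat.cast_one, contDiffOn_succ_iff_fderiv_of_isOpen ho]
    refine ⟨fun z hz => (hasFDerivAt_chart_expE hN hz).differentiableAt.differentiableWithinAt,
      fun h => absurd h (by simp), ?_⟩
    have : ContDiffOn ℝ k (fun z => (frame G (chart E (expE G z))).comp (dexp G n z))
        ((expE (E := E) G) ⁻¹' chartDom E G) := by
      refine ContDiffOn.clm_comp ?_ ((contDiff_dexp n).of_le (by exact_mod_cast le_top)).contDiffOn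
      exact (contDiffOn_frame.of_le (by exact_mod_cast le_top)).comp ih fun z hz => chart_mem hz
    exact this.congr fun z hz => (hasFDerivAt_chart_expE hN hz).fderiv

theorem contDiffAt_chart_expE (hN : ∀ z : E, adL G z ^ n = 0) :
    ContDiffAt ℝ ∞ (fun y : E => chart E (expE G y)) 0 := by
  refine (contDiffOn_chart_expE hN).contDiffAt
    ((isOpen_chartDom.preimage (continuous_expE hN)).mem_nhds ?_)
  simpa using one_mem_chartDom

theorem fderiv_chart_expE (hN : ∀ z : E, adL G z ^ n = 0) :
    fderiv ℝ (fun y : E => chart E (expE G y)) 0 = ContinuousLinearMap.id ℝ E := by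
  ext X
  have h1 := ((contDiffAt_chart_expE hN).differentiableAt (by simp)).hasFDerivAt
  have h2 : HasDerivAt (fun t : ℝ => t • X) X 0 := by
    simpa using (hasDerivAt_id (0 : ℝ)).smul_const X
  rw [← zero_smul ℝ X] at h1
  have h3 := h1.comp_hasDerivAt 0 h2
  have h4 : HasDerivAt (fun t : ℝ => chart E (expE G (t • X))) X 0 := by
    simpa using (hasLeftDeriv_expE_smul (G := G) X 0).2
  rw [zero_smul] at h3
  exact h3.unique h4

theorem contMDiffAt_expE (hN : ∀ z : E, adL G z ^ n = 0) :
    ContMDiffAt 𝓘(ℝ, E) 𝓘(ℝ, E) ∞ (expE (E := E) G) 0 := by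
  have e : chart E (expE G (0 : E)) = chart E (1 : G) := by simp
  have h := contMDiffAt_chartInv_comp (G := G) (contDiffAt_chart_expE hN)
    (by rw [e]; exact chart_one_mem)
  refine h.congr_of_eventuallyEq ?_
  have h1 : (expE (E := E) G) ⁻¹' chartDom E G ∈ 𝓝 0 :=
    (isOpen_chartDom.preimage (continuous_expE hN)).mem_nhds (by simpa using one_mem_chartDom)
  filter_upwards [h1] with y hy
  exact (chartInv_chart hy).symm

/-- A smooth local inverse of the exponential map. -/
theorem exists_local_log (hN : ∀ z : E, adL G z ^ n = 0) : ∃ ℓ : G → E, ℓ 1 = 0 ∧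
    (∀ᶠ z in 𝓝 (0 : E), ℓ (expE G z) = z) ∧ (∀ᶠ g in 𝓝 (1 : G), expE G (ℓ g) = g) ∧
    ContMDiffAt 𝓘(ℝ, E) 𝓘(ℝ, E) ∞ ℓ 1 := by
  set e : E → E := fun y => chart E (expE G y) with he
  have hc : ContDiffAt ℝ ∞ e 0 := contDiffAt_chart_expE hN
  have hd : HasFDerivAt e ((ContinuousLinearEquiv.refl ℝ E : E ≃L[ℝ] E) : E →L[ℝ] E) 0 := by
    have := (hc.differentiableAt (by simp)).hasFDerivAt
    rw [fderiv_chart_expE hN] at this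
    exact this
  have hs : HasStrictFDerivAt e ((ContinuousLinearEquiv.refl ℝ E : E ≃L[ℝ] E) : E →L[ℝ] E) 0 :=
    hc.hasStrictFDerivAt' hd (by simp)
  have e0 : e 0 = chart E (1 : G) := by simp [he]
  set ψ := hs.localInverse e _ 0 with hψ
  have h0 : ψ (chart E (1 : G)) = 0 := by
    rw [← e0]; exact hs.localInverse_apply_image
  have h1 : ∀ᶠ z in 𝓝 (0 : E), ψ (e z) = z := hs.eventually_left_inverse
  have h2 : ∀ᶠ y in 𝓝 (chart E (1 : G)), e (ψ y) = y := by
    rw [← e0]; exact hs.eventually_right_inverse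
  have h3 : ContDiffAt ℝ ∞ ψ (chart E (1 : G)) := by
    rw [← e0]; exact hc.to_localInverse hd (by simp)
  have h4 : Tendsto (fun g : G => ψ (chart E g)) (𝓝 1) (𝓝 0) := by
    have := h3.continuousAt.tendsto.comp (continuousAt_chart (one_mem_chartDom (E := E) (G := G)))
    rwa [h0] at this
  refine ⟨fun g => ψ (chart E g), h0, h1, ?_, ?_⟩
  · have h5 : Tendsto (fun g : G => expE G (ψ (chart E g))) (𝓝 1) (𝓝 1) := by
      have := ((continuous_expE hN).tendsto (0 : E)).comp h4
      rwa [expE_zero] at this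
    filter_upwards [(continuousAt_chart (one_mem_chartDom (E := E) (G := G))).tendsto.eventually h2,
      h5 (chartDom_mem_nhds_one (E := E)), chartDom_mem_nhds_one (E := E) (G := G)] with g h6 h7 h8
    exact chart_injOn h7 h8 h6
  · exact h3.contMDiffAt.comp (1 : G) (contMDiffAt_chart one_mem_chartDom)

theorem HasLeftDeriv.differentiableAt_comp {γ : ℝ → G} {t : ℝ} {c : E} (h : HasLeftDeriv γ t c)
    {ℓ : G → E} (hℓ : MDifferentiableAt 𝓘(ℝ, E) 𝓘(ℝ, E) ℓ (γ t)) :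
    DifferentiableAt ℝ (fun s => ℓ (γ s)) t := by
  have h1 := hasMFDerivAt_iff_hasLeftDeriv.2 h
  have h2 := (hℓ.hasMFDerivAt.comp t h1).mdifferentiableAt
  exact mdifferentiableAt_iff_differentiableAt.1 h2

/-- A local logarithm, in terms of which the local product of `E` commutes with the dilations. -/
theorem Stratification.exists_log {s : ℕ} (S : Stratification E G s) :
    ∃ (ℓ : G → E) (O : Set G) (r : ℝ), ContMDiffAt 𝓘(ℝ, E) 𝓘(ℝ, E) ∞ ℓ 1 ∧ ℓ 1 = 0 ∧ IsOpen O ∧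
      1 ∈ O ∧ (∀ g ∈ O, expE G (ℓ g) = g ∧ ContinuousAt ℓ g) ∧ 0 < r ∧
      (∀ z ∈ Metric.ball (0 : E) r, ℓ (expE G z) = z) ∧
      ∀ z ∈ Metric.ball (0 : E) r, ∀ Y ∈ Metric.ball (0 : E) r, expE G z * expE G Y ∈ O ∧
        ∀ t, expE G (S.dil t (ℓ (expE G z * expE G Y))) =
          expE G (S.dil t z) * expE G (S.dil t Y) := by
  have hN := S.adL_pow
  obtain ⟨ℓ, h0, h1, h2, h3⟩ := exists_local_log hN
  have h4 : ∀ᶠ g in 𝓝 (1 : G), MDifferentiableAt 𝓘(ℝ, E) 𝓘(ℝ, E) ℓ g := by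
    obtain ⟨u, hu, h⟩ := contMDiffAt_iff_contMDiffOn_nhds (n := 1) (by simp) |>.1
      (h3.of_le (by simp))
    filter_upwards [eventually_mem_nhds_iff.2 hu] with g hg using
      (h.contMDiffAt hg).mdifferentiableAt (by simp)
  obtain ⟨O, hO, hOo, h1O⟩ := eventually_nhds_iff.1 (h2.and h4)
  have h5 : Tendsto (fun z : E × E => expE G z.1 * expE G z.2) (𝓝 (0, 0)) (𝓝 1) := by
    have : Continuous (fun z : E × E => expE G z.1 * expE G z.2) :=
      ((continuous_expE hN).comp continuous_fst).mul ((continuous_expE hN).comp continuous_snd)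
    simpa using this.tendsto (0, 0)
  obtain ⟨r, hr, hball⟩ := Metric.eventually_nhds_iff_ball.1 (h5 (hOo.mem_nhds h1O))
  obtain ⟨r', hr', hball'⟩ := Metric.eventually_nhds_iff_ball.1 h1
  have hprod : ∀ z Y : E, ‖z‖ < r → ‖Y‖ < r → expE G z * expE G Y ∈ O := fun z Y hz hY =>
    hball (z, Y) (by rw [mem_ball_iff_norm]; simp [hz, hY])
  refine ⟨ℓ, O, min (r / 2) r', h3, h0, hOo, h1O, fun g hg => ⟨(hO g hg).1, (hO g hg).2.continuousAt⟩,
    by positivity, fun z hz => hball' z (Metric.ball_subset_ball (min_le_right _ _) hz), ?_⟩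
  intro z hz Y hY
  have hz' := hball' z (Metric.ball_subset_ball (min_le_right _ _) hz)
  rw [mem_ball_zero_iff] at hz hY
  have hz1 : ‖z‖ < r := by linarith [min_le_left (r / 2) r']
  have hY1 : ‖Y‖ < r / 2 := by linarith [min_le_left (r / 2) r']
  refine ⟨hprod z Y hz1 (by linarith), fun t => ?_⟩
  -- The logarithm w of exp(z) exp(τY) satisfies dexp(w) w' = Y. Hence exp(δ_t w) has left
  -- derivative δ_t Y, as has exp(δ_t z) exp(τ δ_t Y), and the two agree at τ = 0. The bound r / 2
  -- on Y keeps w defined on (-2, 2), an open interval containing 0 and 1.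
  let w : ℝ → E := fun τ => ℓ (expE G z * expE G (τ • Y))
  have hO' : ∀ τ ∈ Ioo (-2 : ℝ) 2, expE G z * expE G (τ • Y) ∈ O := by
    intro τ hτ
    refine hprod z _ hz1 ?_
    rw [norm_smul, Real.norm_eq_abs]
    have : |τ| < 2 := abs_lt.2 hτ
    nlinarith [norm_nonneg Y, abs_nonneg τ]
  have hL : ∀ τ, HasLeftDeriv (fun τ : ℝ => expE G z * expE G (τ • Y)) τ Y := fun τ =>
    (hasLeftDeriv_expE_smul Y τ).const_mul _
  have hw : ∀ τ ∈ Ioo (-2 : ℝ) 2, DifferentiableAt ℝ w τ := fun τ hτ =>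
    (hL τ).differentiableAt_comp (hO _ (hO' τ hτ)).2
  have hd : ∀ τ ∈ Ioo (-2 : ℝ) 2, dexp G (s + 1) (w τ) (deriv w τ) = Y := by
    intro τ hτ
    have h6 := hasLeftDeriv_expE_comp (hN (w τ)) (hw τ hτ).hasDerivAt
    refine (h6.congr (η := fun τ : ℝ => expE G z * expE G (τ • Y)) ?_).unique (hL τ)
    filter_upwards [isOpen_Ioo.mem_nhds hτ] with σ hσ
    exact (hO _ (hO' σ hσ)).1.symm
  have key := eqOn_of_hasLeftDeriv (γ := fun τ => expE G (S.dil t (w τ)))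
    (η := fun τ : ℝ => expE G (S.dil t z) * expE G (τ • S.dil t Y)) (c := fun _ => S.dil t Y)
    isOpen_Ioo isPreconnected_Ioo (s := Ioo (-2 : ℝ) 2) (fun τ hτ => by
      have h6 := hasLeftDeriv_expE_comp (hN _)
        ((S.dil t).hasFDerivAt.comp_hasDerivAt τ (hw τ hτ).hasDerivAt)
      simp only [Function.comp] at h6
      rw [S.dexp_dil, hd τ hτ] at h6
      exact h6)
    (fun τ _ => (hasLeftDeriv_expE_smul _ τ).const_mul _) (a := 0) (by simp)
    (by simp [w, hz'])
  simpa [w] using key (show (1 : ℝ) ∈ Ioo (-2 : ℝ) 2 by norm_num)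

end SmoothExp

/-! ### Path lifting and the monodromy argument -/

section PathLifting

open scoped unitInterval

variable {M : Type*} [TopologicalSpace M] {G : Type*} [TopologicalSpace G] [Group G]
  [IsTopologicalGroup G]

/-- Path lifting along a map that has local sections of uniform size. -/
theorem exists_path_lift {p : M → G} {O : Set G} (hO : O ∈ 𝓝 1)
    (hp : ∀ z, ∃ φ : G → M, ContinuousOn φ O ∧ φ 1 = z ∧ ∀ h ∈ O, p (φ h) = p z * h)
    (γ : C(I, G)) {z₀ : M} (h₀ : p z₀ = γ 0) :
    ∃ Γ : C(I, M), Γ 0 = z₀ ∧ ∀ t, p (Γ t) = γ t := by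
  have hW : Tendsto (fun x : G × G => x.1⁻¹ * x.2) (𝓝 (1, 1)) (𝓝 1) := by
    have : Continuous (fun x : G × G => x.1⁻¹ * x.2) := by fun_prop
    simpa using this.tendsto (1, 1)
  have hW2 := hW hO
  rw [mem_map, nhds_prod_eq, mem_prod_same_iff] at hW2
  obtain ⟨W', hW', hsub⟩ := hW2
  obtain ⟨W, hWW', hWo, h1W⟩ := mem_nhds_iff.1 hW'
  -- On each subinterval γ stays in one translate gW, so quotients of its values there lie in O. As
  -- O does not depend on the point of M, the lift extends across each subinterval by a single local
  -- section.
  obtain ⟨t, t0, tm, ⟨N, hN⟩, hcov⟩ := exists_monotone_Icc_subset_open_cover_unitInterval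
    (c := fun g : G => (fun τ => g⁻¹ * γ τ) ⁻¹' W)
    (fun g => hWo.preimage (by fun_prop)) (fun τ _ => mem_iUnion.2 ⟨γ τ, by simpa using h1W⟩)
  have key : ∀ n, ∃ Γ : I → M, ContinuousOn Γ (Icc 0 (t n)) ∧ Γ 0 = z₀ ∧
      ∀ τ ≤ t n, p (Γ τ) = γ τ := by
    intro n
    induction n with
    | zero =>
      refine ⟨fun _ => z₀, continuousOn_const, rfl, fun τ hτ => ?_⟩
      rw [t0] at hτ
      rw [h₀, le_antisymm hτ bot_le]
    | succ n ih =>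
      obtain ⟨Γ, hc, hz, hl⟩ := ih
      obtain ⟨φ, hφ, hφ1, hφp⟩ := hp (Γ (t n))
      obtain ⟨g, hg⟩ := hcov n
      have hin : ∀ τ ∈ Icc (t n) (t (n + 1)), (γ (t n))⁻¹ * γ τ ∈ O := by
        intro τ hτ
        have h1 := hg hτ
        have h2 := hg (left_mem_Icc.2 (tm n.le_succ))
        have h3 : ((g⁻¹ * γ (t n), g⁻¹ * γ τ) : G × G) ∈ W' ×ˢ W' := ⟨hWW' h2, hWW' h1⟩
        simpa [mul_assoc] using hsub h3
      classical
      refine ⟨fun τ => if τ ≤ t n then Γ τ else φ ((γ (t n))⁻¹ * γ τ), ?_, ?_, fun τ hτ => ?_⟩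
      · have hunion : Icc 0 (t (n + 1)) = Icc 0 (t n) ∪ Icc (t n) (t (n + 1)) :=
          (Icc_union_Icc_eq_Icc bot_le (tm n.le_succ)).symm
        rw [hunion]
        refine ContinuousOn.union_of_isClosed (hc.congr fun τ hτ => if_pos hτ.2) ?_
          isClosed_Icc isClosed_Icc
        have hs : ContinuousOn (fun τ => φ ((γ (t n))⁻¹ * γ τ)) (Icc (t n) (t (n + 1))) :=
          hφ.comp (by fun_prop) hin
        refine hs.congr fun τ hτ => ?_
        rcases eq_or_lt_of_le hτ.1 with h | h
        · subst h; simp [hφ1]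
        · exact if_neg (not_le.2 h)
      · simp only []
        rw [if_pos (show (0 : I) ≤ t n from bot_le), hz]
      · by_cases h : τ ≤ t n
        · simp only [if_pos h]; exact hl τ h
        · simp only [if_neg h]
          rw [hφp _ (hin τ ⟨(not_le.1 h).le, hτ⟩), hl _ le_rfl]; group
  obtain ⟨Γ, hc, hz, hl⟩ := key N
  rw [hN N le_rfl] at hc hl
  have hu : (Icc 0 1 : Set I) = univ := eq_univ_of_forall fun τ => ⟨bot_le, le_top⟩
  rw [hu, continuousOn_univ] at hc
  exact ⟨⟨Γ, hc⟩, hz, fun τ => hl τ le_top⟩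

/-- A local homeomorphism to a simply connected group with local sections of uniform size is
bijective. -/
theorem bijective_of_local_sections [PathConnectedSpace M] [T2Space M] [SimplyConnectedSpace G]
    {p : M → G} (hloc : IsLocalHomeomorph p) {O : Set G} (hO : O ∈ 𝓝 1)
    (hp : ∀ z, ∃ φ : G → M, ContinuousOn φ O ∧ φ 1 = z ∧ ∀ h ∈ O, p (φ h) = p z * h) :
    Function.Bijective p := by
  constructor
  · intro a b hab
    -- The image of a path from a to b is a loop, which is null-homotopic. Every stage of the
    -- homotopy lifts from a, and by monodromy all lifts end at the same point: b for the path
    -- itself, a for the constant one.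
    let α : Path a b := PathConnectedSpace.somePath a b
    let β : Path (p a) (p a) := (α.map hloc.continuous).cast rfl hab
    obtain ⟨F⟩ : β.Homotopic (Path.refl (p a)) := SimplyConnectedSpace.paths_homotopic _ _
    have hlift : ∀ t : I, ∃ Γ : C(I, M), Γ 0 = a ∧ ∀ s, p (Γ s) = F (t, s) := by
      intro t
      refine exists_path_lift hO hp ⟨fun s => F (t, s), by fun_prop⟩ ?_
      simp
    choose Γ hΓ0 hΓ using hlift
    have huniq : ∀ (Γ' : C(I, M)) (t : I), Γ' 0 = a → (∀ s, p (Γ' s) = F (t, s)) → Γ t = Γ' := by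
      intro Γ' t h0 h
      ext s
      refine congr_fun ((T2Space.isSeparatedMap p).eq_of_comp_eq hloc.isLocallyInjective
        (Γ t).continuous Γ'.continuous (funext fun s => ?_) 0 ((hΓ0 t).trans h0.symm)) s
      simp [hΓ, h]
    have hmon := hloc.monodromy_theorem (T2Space.isSeparatedMap p) F Γ hΓ
      (fun t => by rw [hΓ0, hΓ0]) 1
    rw [huniq (α : C(I, M)) 0 α.source fun s => by simp [β],
      huniq (ContinuousMap.const I a) 1 rfl fun s => by simp] at hmon
    simpa using hmon
  · intro g
    let a : M := Classical.arbitrary M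
    let α : Path (p a) g := PathConnectedSpace.somePath _ _
    obtain ⟨Γ, -, h⟩ := exists_path_lift hO hp (α : C(I, G)) (z₀ := a) α.source.symm
    exact ⟨Γ 1, (h 1).trans α.target⟩

end PathLifting

/-! ### Bijectivity of the exponential map -/

section ExpBijective

variable {E : Type*} [NormedAddCommGroup E] [NormedSpace ℝ E] [FiniteDimensional ℝ E]
  {G : Type*} [TopologicalSpace G] [ChartedSpace E G] [Group G]
  [LieGroup 𝓘(ℝ, E) ∞ G] [IsTopologicalGroup G] {s : ℕ}

/-- Shrink z and log h by a dilation l into the domain of the logarithm, multiply there, and dilate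
back by l⁻¹. Only l depends on z; the neighbourhood O does not. -/
theorem Stratification.exists_local_section (S : Stratification E G s) : ∃ O ∈ 𝓝 (1 : G), ∀ z : E,
    ∃ φ : G → E, ContinuousOn φ O ∧ φ 1 = z ∧ ∀ h ∈ O, expE G (φ h) = expE G z * h := by
  obtain ⟨ℓ, O, r, h1, h2, hO, h1O, h3, hr, h4, h5⟩ := S.exists_log
  have hnear : {g : G | ‖ℓ g‖ < 1} ∈ 𝓝 (1 : G) := by
    have := h1.continuousAt.norm
    refine this.eventually_lt continuousAt_const (by simp [h2])
  refine ⟨O ∩ {g : G | ‖ℓ g‖ < 1}, inter_mem (hO.mem_nhds h1O) hnear, fun z => ?_⟩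
  obtain ⟨l, hl, hlb⟩ := S.exists_dil_mem (Metric.ball_mem_nhds (0 : E) hr) (max ‖z‖ 1)
  have hz := hlb z (le_max_left _ _)
  have hY : ∀ h ∈ O ∩ {g : G | ‖ℓ g‖ < 1}, S.dil l (ℓ h) ∈ Metric.ball (0 : E) r := fun h hh =>
    hlb _ (le_trans (le_of_lt hh.2) (le_max_right _ _))
  refine ⟨fun h => S.dil l⁻¹ (ℓ (expE G (S.dil l z) * expE G (S.dil l (ℓ h)))), ?_, ?_, ?_⟩
  · intro h hh
    refine ContinuousAt.continuousWithinAt ?_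
    have hc : ContinuousAt (fun h => expE G (S.dil l z) * expE G (S.dil l (ℓ h))) h := by
      have h6 : ContinuousAt (fun h => S.dil l (ℓ h)) h :=
        (S.dil l).continuous.continuousAt.comp (h3 h hh.1).2
      have h7 : ContinuousAt (fun h => expE G (S.dil l (ℓ h))) h :=
        ((continuous_expE S.adL_pow).continuousAt).comp h6
      exact continuousAt_const.mul h7
    have h8 : ContinuousAt ℓ (expE G (S.dil l z) * expE G (S.dil l (ℓ h))) :=
      (h3 _ (h5 _ hz _ (hY h hh)).1).2
    exact (S.dil l⁻¹).continuous.continuousAt.comp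
      (ContinuousAt.comp (f := fun h => expE G (S.dil l z) * expE G (S.dil l (ℓ h))) h8 hc)
  · simp only [h2, map_zero, expE_zero, mul_one]
    rw [h4 _ hz, S.dil_inv_dil hl.ne']
  · intro h hh
    rw [(h5 _ hz _ (hY h hh)).2, S.dil_inv_dil hl.ne', S.dil_inv_dil hl.ne', (h3 h hh.1).1]

/-- Injectivity is known only near 0. For w near w₀, Y w is a small logarithm of exp(-w₀) exp(w), so
exp w = exp w' forces Y w = Y w'. Since Y is computed from a product of shrunken vectors, this gives
exp(δ_l w) = exp(δ_l w'), where the logarithm near 0 applies. -/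
theorem Stratification.exists_injOn_expE (S : Stratification E G s) (w₀ : E) :
    ∃ U ∈ 𝓝 w₀, InjOn (expE (E := E) G) U := by
  obtain ⟨ℓ, O, r, h1, h2, hO, h1O, h3, hr, h4, h5⟩ := S.exists_log
  obtain ⟨l, hl, hlb⟩ := S.exists_dil_mem (Metric.ball_mem_nhds (0 : E) hr) (‖w₀‖ + 1)
  have hz : S.dil l (-w₀) ∈ Metric.ball (0 : E) r := hlb _ (by simp)
  let q : E → G := fun w => expE G (S.dil l (-w₀)) * expE G (S.dil l w)
  let Y : E → E := fun w => S.dil l⁻¹ (ℓ (q w))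
  have hq1 : q w₀ = 1 := by
    simp only [q, map_neg, expE_neg, inv_mul_cancel]
  have hq : ContinuousAt q w₀ := by
    have : Continuous q := continuous_const.mul
      ((continuous_expE S.adL_pow).comp (S.dil l).continuous)
    exact this.continuousAt
  have hYc : ContinuousAt Y w₀ := by
    have h6 : ContinuousAt ℓ (q w₀) := by rw [hq1]; exact h1.continuousAt
    exact (S.dil l⁻¹).continuous.continuousAt.comp (ContinuousAt.comp (f := q) h6 hq)
  have hY0 : Y w₀ = 0 := by simp [Y, hq1, h2]
  have hnear : ∀ᶠ w in 𝓝 w₀, Y w ∈ Metric.ball (0 : E) r :=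
    hYc.eventually_mem (by rw [hY0]; exact Metric.ball_mem_nhds _ hr)
  have hnear2 : ∀ᶠ w in 𝓝 w₀, ‖w‖ < ‖w₀‖ + 1 :=
    (continuousAt_id.norm).eventually_lt continuousAt_const (by simp)
  refine ⟨_, hnear.and hnear2, ?_⟩
  intro w hw w' hw' he
  have hb : ∀ w : E, ‖w‖ < ‖w₀‖ + 1 → S.dil l w ∈ Metric.ball (0 : E) r := fun w hw =>
    hlb _ hw.le
  have hexp : ∀ w : E, ‖w‖ < ‖w₀‖ + 1 → expE G (Y w) = expE G (-w₀) * expE G w := fun w hw => by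
    rw [(h5 _ hz _ (hb w hw)).2, S.dil_inv_dil hl.ne', S.dil_inv_dil hl.ne']
  have hYY : Y w = Y w' := by
    rw [← h4 _ hw.1, ← h4 _ hw'.1, hexp w hw.2, hexp w' hw'.2, he]
  have hll : ℓ (q w) = ℓ (q w') := by
    have := congrArg (S.dil l) hYY
    simpa only [Y, S.dil_dil_inv hl.ne'] using this
  have hqq : q w = q w' := by
    change expE G (S.dil l (-w₀)) * expE G (S.dil l w) = expE G (S.dil l (-w₀)) * expE G (S.dil l w')
    rw [← (h3 _ (h5 _ hz _ (hb w hw.2)).1).1, ← (h3 _ (h5 _ hz _ (hb w' hw'.2)).1).1]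
    exact congrArg (expE G) hll
  have hee : expE G (S.dil l w) = expE G (S.dil l w') := mul_left_cancel hqq
  have := congrArg ℓ hee
  rw [h4 _ (hb w hw.2), h4 _ (hb w' hw'.2)] at this
  have := congrArg (S.dil l⁻¹) this
  rwa [S.dil_inv_dil hl.ne', S.dil_inv_dil hl.ne'] at this

theorem Stratification.isOpenMap_expE (S : Stratification E G s) :
    IsOpenMap (expE (E := E) G) := by
  obtain ⟨O, hO, h⟩ := S.exists_local_section
  refine IsOpenMap.of_nhds_le fun z => ?_
  obtain ⟨φ, hφ, h1, h2⟩ := h z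
  have hs : Tendsto (fun g => φ ((expE G z)⁻¹ * g)) (𝓝 (expE G z)) (𝓝 z) := by
    have h3 : Tendsto (fun g => (expE G z)⁻¹ * g) (𝓝 (expE G z)) (𝓝 1) := by
      simpa using (continuous_const_mul (expE G z)⁻¹).tendsto (expE G z)
    have h4 := (hφ.continuousAt hO).tendsto
    rw [h1] at h4
    exact h4.comp h3
  intro A hA
  rw [mem_map] at hA
  have h3 : Tendsto (fun g => (expE G z)⁻¹ * g) (𝓝 (expE G z)) (𝓝 1) := by
    simpa using (continuous_const_mul (expE G z)⁻¹).tendsto (expE G z)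
  filter_upwards [hs hA, h3 hO] with g hg hg2
  have h5 : expE G (φ ((expE G z)⁻¹ * g)) ∈ A := hg
  rwa [h2 _ hg2, mul_inv_cancel_left] at h5

theorem Stratification.isLocalHomeomorph_expE (S : Stratification E G s) :
    IsLocalHomeomorph (expE (E := E) G) := by
  rw [isLocalHomeomorph_iff_isOpenEmbedding_restrict]
  intro z
  obtain ⟨U, hU, hinj⟩ := S.exists_injOn_expE z
  obtain ⟨V, hVU, hV, hz⟩ := mem_nhds_iff.1 hU
  exact ⟨V, hV.mem_nhds hz, .of_continuous_injective_isOpenMap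
    ((continuous_expE S.adL_pow).comp continuous_subtype_val)
    (injOn_iff_injective.1 (hinj.mono hVU)) (S.isOpenMap_expE.domRestrict hV)⟩

/-- The exponential map of a simply connected stratified group is a bijection. -/
theorem Stratification.bijective_expE [SimplyConnectedSpace G] (S : Stratification E G s) :
    Function.Bijective (expE (E := E) G) := by
  obtain ⟨O, hO, h⟩ := S.exists_local_section
  exact bijective_of_local_sections S.isLocalHomeomorph_expE hO h

end ExpBijective

/-! ### Group dilations are smooth automorphisms -/

section Dilation

variable {E : Type*} [NormedAddCommGroup E] [NormedSpace ℝ E] [FiniteDimensional ℝ E]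
  {G : Type*} [TopologicalSpace G] [ChartedSpace E G] [Group G]
  [LieGroup 𝓘(ℝ, E) ∞ G] [IsTopologicalGroup G] [SimplyConnectedSpace G] {s : ℕ}
  (S : Stratification E G s)

theorem Stratification.dilation_expE (t : ℝ) (Y : E) :
    S.dilation t (expE G Y) = expE G (S.dil t Y) := by
  have h : Function.invFun (exp : GroupLieAlgebra 𝓘(ℝ, E) G → G) (expE G Y) = Y :=
    Function.leftInverse_invFun S.bijective_expE.1 Y
  unfold Stratification.dilation
  rw [h]
  rfl

theorem Stratification.exists_expE_eq (S : Stratification E G s) (g : G) :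
    ∃ Y : E, expE G Y = g :=
  S.bijective_expE.2 g

theorem Stratification.dilation_one_right (t : ℝ) : S.dilation t (1 : G) = 1 := by
  rw [← expE_zero (E := E) (G := G), S.dilation_expE, map_zero]

theorem Stratification.dilation_dilation (t t' : ℝ) (g : G) :
    S.dilation t (S.dilation t' g) = S.dilation (t * t') g := by
  obtain ⟨Y, rfl⟩ := S.exists_expE_eq g
  simp only [S.dilation_expE, S.dil_mul]

theorem Stratification.dilation_one_left (g : G) : S.dilation 1 g = g := by
  obtain ⟨Y, rfl⟩ := S.exists_expE_eq g
  simp [S.dilation_expE, S.dil_one]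

/-- Shrink both logarithms by l into the domain of the local product. Dilating that product by l⁻¹
gives gh, and dilating it by t l⁻¹ gives the product of the dilated factors. -/
theorem Stratification.dilation_mul (t : ℝ) (g h : G) :
    S.dilation t (g * h) = S.dilation t g * S.dilation t h := by
  obtain ⟨a, rfl⟩ := S.exists_expE_eq g
  obtain ⟨b, rfl⟩ := S.exists_expE_eq h
  obtain ⟨ℓ, O, r, h1, h2, hO, h1O, h3, hr, h4, h5⟩ := S.exists_log
  obtain ⟨l, hl, hlb⟩ := S.exists_dil_mem (Metric.ball_mem_nhds (0 : E) hr) (max ‖a‖ ‖b‖)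
  have key := (h5 _ (hlb a (le_max_left _ _)) _ (hlb b (le_max_right _ _))).2
  have e1 := key l⁻¹
  rw [S.dil_inv_dil hl.ne', S.dil_inv_dil hl.ne'] at e1
  have e2 := congrArg (S.dilation t) e1
  have e3 := key (t * l⁻¹)
  rw [S.dilation_expE] at e2
  have e4 : ∀ z : E, S.dil (t * l⁻¹) z = S.dil t (S.dil l⁻¹ z) := fun z => S.dil_mul _ _ _
  simp only [e4, S.dil_inv_dil hl.ne'] at e3
  rw [← e2, S.dilation_expE, S.dilation_expE, e3]

/-- The dilation as a group homomorphism. -/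
noncomputable def Stratification.dilationHom (t : ℝ) : G →* G where
  toFun := S.dilation t
  map_one' := S.dilation_one_right t
  map_mul' := S.dilation_mul t

theorem Stratification.dilation_inv (t : ℝ) (g : G) :
    S.dilation t g⁻¹ = (S.dilation t g)⁻¹ :=
  map_inv (S.dilationHom t) g

/-- Near 1 the dilation is exp ∘ δ_t ∘ log; the homomorphism property carries smoothness to every
other point. -/
theorem Stratification.contMDiff_dilation (t : ℝ) :
    ContMDiff 𝓘(ℝ, E) 𝓘(ℝ, E) ∞ (S.dilation t : G → G) := by
  obtain ⟨ℓ, O, r, h1, h2, hO, h1O, h3, hr, h4, h5⟩ := S.exists_log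
  have hone : ContMDiffAt 𝓘(ℝ, E) 𝓘(ℝ, E) ∞ (S.dilation t : G → G) 1 := by
    have h6 : ContMDiffAt 𝓘(ℝ, E) 𝓘(ℝ, E) ∞ (fun g => S.dil t (ℓ g)) (1 : G) :=
      (S.dil t).contDiff.contMDiff.contMDiffAt.comp (1 : G) h1
    have h7 : ContMDiffAt 𝓘(ℝ, E) 𝓘(ℝ, E) ∞ (expE (E := E) G) (S.dil t (ℓ 1)) := by
      rw [h2, map_zero]; exact contMDiffAt_expE S.adL_pow
    refine (ContMDiffAt.comp (f := fun g => S.dil t (ℓ g)) (1 : G) h7 h6).congr_of_eventuallyEq ?_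
    filter_upwards [hO.mem_nhds h1O] with g hg
    conv_lhs => rw [← (h3 g hg).1]
    rw [S.dilation_expE]; rfl
  intro g
  have h6 : ContMDiffAt 𝓘(ℝ, E) 𝓘(ℝ, E) ∞ (fun x : G => g⁻¹ * x) g :=
    contMDiffAt_const.mul contMDiffAt_id
  have h7 : ContMDiffAt 𝓘(ℝ, E) 𝓘(ℝ, E) ∞ (S.dilation t : G → G) (g⁻¹ * g) := by
    rwa [inv_mul_cancel]
  have h8 : ContMDiffAt 𝓘(ℝ, E) 𝓘(ℝ, E) ∞
      (fun x : G => S.dilation t g * S.dilation t (g⁻¹ * x)) g :=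
    contMDiffAt_const.mul (ContMDiffAt.comp (f := fun x : G => g⁻¹ * x) g h7 h6)
  refine h8.congr_of_eventuallyEq (.of_forall fun x => ?_)
  beta_reduce
  rw [← S.dilation_mul, mul_inv_cancel_left]

/-- After a left translation the curve passes through 1 at time t, where it has a logarithm and
`dexp_dil` applies. -/
theorem Stratification.hasLeftDeriv_dilation (τ : ℝ) {γ : ℝ → G} {t : ℝ} {c : E}
    (h : HasLeftDeriv γ t c) : HasLeftDeriv (fun x => S.dilation τ (γ x)) t (S.dil τ c) := by
  obtain ⟨ℓ, O, r, h1, h2, hO, h1O, h3, hr, h4, h5⟩ := S.exists_log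
  let β : ℝ → G := fun x => (γ t)⁻¹ * γ x
  have hβ : HasLeftDeriv β t c := h.const_mul _
  have hβ1 : β t = 1 := inv_mul_cancel _
  have hθ : DifferentiableAt ℝ (fun x => ℓ (β x)) t :=
    hβ.differentiableAt_comp (by rw [hβ1]; exact h1.mdifferentiableAt (by simp))
  have hev : ∀ᶠ x in 𝓝 t, expE G (ℓ (β x)) = β x := by
    have : ∀ᶠ x in 𝓝 t, β x ∈ O := hβ.1.eventually_mem (by rw [hβ1]; exact hO.mem_nhds h1O)
    filter_upwards [this] with x hx using (h3 _ hx).1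
  have e1 : dexp G (s + 1) (ℓ (β t)) (deriv (fun x => ℓ (β x)) t) = c :=
    ((hasLeftDeriv_expE_comp (S.adL_pow _) hθ.hasDerivAt).congr
      (hev.mono fun x hx => hx.symm)).unique hβ
  have e2 := hasLeftDeriv_expE_comp (S.adL_pow _)
    ((S.dil τ).hasFDerivAt.comp_hasDerivAt t hθ.hasDerivAt)
  simp only [Function.comp] at e2
  rw [S.dexp_dil, e1] at e2
  refine (e2.const_mul (S.dilation τ (γ t))).congr ?_
  filter_upwards [hev] with x hx
  rw [← S.dilation_expE, hx, ← S.dilation_mul, mul_inv_cancel_left]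

end Dilation

/-! ### Reparametrization of absolutely continuous functions -/

section AbsolutelyContinuous

theorem absolutelyContinuousOnInterval_comp {M : Type*} [PseudoMetricSpace M]
    {f : ℝ → M} {a b c d : ℝ} (hf : AbsolutelyContinuousOnInterval f a b) {k : ℝ → ℝ}
    (hk : Monotone k ∨ Antitone k) {K : NNReal} (hK : LipschitzWith K k)
    (hm : MapsTo k (uIcc c d) (uIcc a b)) : AbsolutelyContinuousOnInterval (f ∘ k) c d := by
  rw [absolutelyContinuousOnInterval_iff] at hf ⊢
  intro ε hε
  obtain ⟨δ, hδ, h⟩ := hf ε hε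
  -- The images of the intervals have at most K times their total length; K + 1 avoids dividing by
  -- zero.
  refine ⟨δ / (K + 1), by positivity, fun I hI hsum => ?_⟩
  refine h (I.1, fun i => (k (I.2 i).1, k (I.2 i).2)) ⟨fun i hi => ?_, ?_⟩ ?_
  · exact ⟨hm (hI.1 i hi).1, hm (hI.1 i hi).2⟩
  -- A common point z of two image intervals would, by monotonicity, make the original half-open
  -- intervals overlap. Strict monotonicity is not needed, since z lies strictly above one endpoint
  -- value of each image.
  · intro i hi j hj hij
    have h1 := hI.2 hi hj hij
    simp only [Function.onFun, Set.disjoint_left] at h1 ⊢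
    intro z hz hz'
    rw [mem_uIoc] at hz hz'
    have hlt : ∀ x y, k x < z → z ≤ k y → (Monotone k → x < y) ∧ (Antitone k → y < x) :=
      fun x y hx hy => ⟨fun hm => hm.reflect_lt (hx.trans_le hy),
        fun hm => hm.reflect_lt (hx.trans_le hy)⟩
    have key : ∀ x y x' y' : ℝ, x < y → x' < y' → x < y' → x' < y →
        min y y' ∈ Ioc x y ∩ Ioc x' y' := fun x y x' y' h1 h2 h3 h4 =>
      ⟨⟨lt_min h1 h3, min_le_left _ _⟩, ⟨lt_min h4 h2, min_le_right _ _⟩⟩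
    have fin : ∀ x y x' y' : ℝ, (uIoc x y = uIoc (I.2 i).1 (I.2 i).2) →
        (uIoc x' y' = uIoc (I.2 j).1 (I.2 j).2) → k x < z → z ≤ k y → k x' < z → z ≤ k y' →
        False := by
      intro x y x' y' e e' g1 g2 g3 g4
      rw [← e, ← e'] at h1
      rcases hk with hk | hk
      · have := key x y x' y' ((hlt _ _ g1 g2).1 hk) ((hlt _ _ g3 g4).1 hk)
          ((hlt _ _ g1 g4).1 hk) ((hlt _ _ g3 g2).1 hk)
        exact h1 (Ioc_subset_uIoc this.1) (Ioc_subset_uIoc this.2)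
      · have := key y x y' x' ((hlt _ _ g1 g2).2 hk) ((hlt _ _ g3 g4).2 hk)
          ((hlt _ _ g3 g2).2 hk) ((hlt _ _ g1 g4).2 hk)
        exact h1 (Ioc_subset_uIoc' this.1) (Ioc_subset_uIoc' this.2)
    rcases hz with hz | hz <;> rcases hz' with hz' | hz'
    · exact fin _ _ _ _ rfl rfl hz.1 hz.2 hz'.1 hz'.2
    · exact fin _ _ _ _ rfl (uIoc_comm _ _) hz.1 hz.2 hz'.1 hz'.2
    · exact fin _ _ _ _ (uIoc_comm _ _) rfl hz.1 hz.2 hz'.1 hz'.2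
    · exact fin _ _ _ _ (uIoc_comm _ _) (uIoc_comm _ _) hz.1 hz.2 hz'.1 hz'.2
  · calc ∑ i ∈ Finset.range I.1, dist (k (I.2 i).1) (k (I.2 i).2)
        ≤ ∑ i ∈ Finset.range I.1, (K : ℝ) * dist (I.2 i).1 (I.2 i).2 :=
          Finset.sum_le_sum fun i _ => hK.dist_le_mul _ _
      _ = K * ∑ i ∈ Finset.range I.1, dist (I.2 i).1 (I.2 i).2 := (Finset.mul_sum _ _ _).symm
      _ ≤ (K + 1) * ∑ i ∈ Finset.range I.1, dist (I.2 i).1 (I.2 i).2 := by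
          gcongr
          simp
      _ < (K + 1) * (δ / (K + 1)) := by gcongr
      _ = δ := by field_simp

theorem ae_comp_affine {P : ℝ → Prop} (h : ∀ᵐ t, P t) {a : ℝ} (ha : a ≠ 0) (b : ℝ) :
    ∀ᵐ t, P (a * t + b) := by
  have h1 : Measure.QuasiMeasurePreserving (fun t : ℝ => a * t + b) volume volume := by
    have h2 : Measure.QuasiMeasurePreserving (fun t : ℝ => a * t) volume volume := by
      refine ⟨by fun_prop, ?_⟩
      rw [Real.map_volume_mul_left ha]
      exact Measure.smul_absolutelyContinuous
    exact (measurePreserving_add_right volume b).quasiMeasurePreserving.comp h2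
  exact h1.ae h

end AbsolutelyContinuous

/-! ### Horizontal curves and their lengths -/

section Length

variable {E : Type*} [NormedAddCommGroup E] [NormedSpace ℝ E] [FiniteDimensional ℝ E]
  {G : Type*} [TopologicalSpace G] [ChartedSpace E G] [Group G]
  [LieGroup 𝓘(ℝ, E) ∞ G] [IsTopologicalGroup G] {m : ℕ}

theorem AbsolutelyContinuousCurve.map {γ : ℝ → G} {a b : ℝ}
    (h : AbsolutelyContinuousCurve E γ a b) {F : G → G} (hF : ContMDiff 𝓘(ℝ, E) 𝓘(ℝ, E) ∞ F) :
    AbsolutelyContinuousCurve E (fun t => F (γ t)) a b :=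
  ⟨hF.continuous.comp_continuousOn h.1, fun φ hφ => h.2 (φ ∘ F) (hφ.comp hF)⟩

theorem AbsolutelyContinuousCurve.comp {γ : ℝ → G} {a b c d : ℝ} (hab : a ≤ b) (hcd : c ≤ d)
    (h : AbsolutelyContinuousCurve E γ a b) {k : ℝ → ℝ}
    (hk : Monotone k ∨ Antitone k) {K : NNReal} (hK : LipschitzWith K k)
    (hm : MapsTo k (Icc c d) (Icc a b)) : AbsolutelyContinuousCurve E (fun t => γ (k t)) c d :=
  ⟨h.1.comp hK.continuous.continuousOn hm, fun φ hφ =>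
    absolutelyContinuousOnInterval_comp (h.2 φ hφ) hk hK (by rwa [uIcc_of_le hab, uIcc_of_le hcd])⟩

/-- The left-invariant vector field with coefficients `v` in the frame `X`. -/
noncomputable def combo (X : Fin m → E) : EuclideanSpace ℝ (Fin m) →L[ℝ] E :=
  ∑ j, (EuclideanSpace.proj j : EuclideanSpace ℝ (Fin m) →L[ℝ] ℝ).smulRight (X j)

theorem combo_apply (X : Fin m → E) (v : EuclideanSpace ℝ (Fin m)) :
    combo X v = ∑ j, v j • X j := by
  simp [combo]

theorem isHorizontal_iff {X : Fin m → E} {γ : ℝ → G} {u : ℝ → EuclideanSpace ℝ (Fin m)} :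
    IsHorizontal (E := E) (G := G) X γ u 0 1 ↔ AbsolutelyContinuousCurve E γ 0 1 ∧
      IntervalIntegrable u volume 0 1 ∧
      ∀ᵐ t, t ∈ Icc (0 : ℝ) 1 → HasLeftDeriv γ t (combo X (u t)) := by
  have key : ∀ t, (∑ j, u t j •
      (mulInvariantVectorField (I := 𝓘(ℝ, E)) (G := G) (X j) (γ t) : TangentSpace 𝓘(ℝ, E) (γ t))) =
      mulInvariantVectorField (I := 𝓘(ℝ, E)) (combo X (u t) : E) (γ t) := by
    intro t
    let D : E →L[ℝ] E := mfderiv 𝓘(ℝ, E) 𝓘(ℝ, E) (fun x => γ t * x) 1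
    change ∑ j, u t j • D (X j) = D (combo X (u t))
    rw [combo_apply, map_sum]
    simp only [map_smul]
  constructor
  · rintro ⟨h1, h2, h3⟩
    refine ⟨h1, ?_, ?_⟩
    · rw [intervalIntegrable_iff_integrableOn_Icc_of_le zero_le_one]; exact h2
    · rw [ae_restrict_iff' measurableSet_Icc] at h3
      filter_upwards [h3] with t ht htm
      have := ht htm
      rw [key] at this
      exact hasMFDerivAt_iff_hasLeftDeriv.1 this
  · rintro ⟨h1, h2, h3⟩
    refine ⟨h1, ?_, ?_⟩
    · rw [intervalIntegrable_iff_integrableOn_Icc_of_le zero_le_one] at h2; exact h2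
    · rw [ae_restrict_iff' measurableSet_Icc]
      filter_upwards [h3] with t ht htm
      rw [key]
      exact hasMFDerivAt_iff_hasLeftDeriv.2 (ht htm)

/-- The set of lengths of the horizontal curves from `x` to `y`. -/
def lengths (X : Fin m → E) (x y : G) : Set ℝ :=
  {L | ∃ (γ : ℝ → G) (u : ℝ → EuclideanSpace ℝ (Fin m)),
    (AbsolutelyContinuousCurve E γ 0 1 ∧ IntervalIntegrable u volume 0 1 ∧
      ∀ᵐ t, t ∈ Icc (0 : ℝ) 1 → HasLeftDeriv γ t (combo X (u t))) ∧
    γ 0 = x ∧ γ 1 = y ∧ L = ∫ t in (0 : ℝ)..1, ‖u t‖}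

theorem ccDist_eq (X : Fin m → E) (x y : G) :
    ccDist (E := E) X x y = sInf (lengths X x y) := by
  unfold ccDist lengths
  simp only [isHorizontal_iff]

variable {X : Fin m → E} {x y z : G} {L L' : ℝ}

theorem nonneg_of_mem_lengths (h : L ∈ lengths X x y) : 0 ≤ L := by
  obtain ⟨γ, u, -, -, -, rfl⟩ := h
  exact intervalIntegral.integral_nonneg zero_le_one fun _ _ => norm_nonneg _

theorem mul_left_mem_lengths (g : G) (h : L ∈ lengths X x y) : L ∈ lengths X (g * x) (g * y) := by
  obtain ⟨γ, u, ⟨h1, h2, h3⟩, rfl, rfl, hL⟩ := h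
  refine ⟨fun t => g * γ t, u, ⟨h1.map (contMDiff_mul_left (a := g)), h2, ?_⟩, rfl, rfl, hL⟩
  filter_upwards [h3] with t ht htm using (ht htm).const_mul g

theorem lengths_mul_left (g : G) : lengths X (g * x) (g * y) = lengths X x y := by
  refine Subset.antisymm (fun L h => ?_) fun L h => mul_left_mem_lengths g h
  simpa using mul_left_mem_lengths g⁻¹ h

theorem HasLeftDeriv.comp_affine {γ : ℝ → G} {a b t : ℝ} {c : E}
    (h : HasLeftDeriv γ (a * t + b) c) : HasLeftDeriv (fun x => γ (a * x + b)) t (a • c) := by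
  refine ⟨ContinuousAt.comp (f := fun x => a * x + b) h.1 (by fun_prop), ?_⟩
  have h1 : HasDerivAt (fun x : ℝ => a * x + b) a t := by
    simpa using ((hasDerivAt_id t).const_mul a).add_const b
  exact h.2.scomp (h := fun x : ℝ => a * x + b) t h1

theorem lengths_symm (h : L ∈ lengths X x y) : L ∈ lengths X y x := by
  obtain ⟨γ, u, ⟨h1, h2, h3⟩, rfl, rfl, rfl⟩ := h
  refine ⟨fun t => γ (-1 * t + 1), fun t => -u (-1 * t + 1), ⟨?_, ?_, ?_⟩, by simp, by simp, ?_⟩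
  · refine h1.comp zero_le_one zero_le_one (.inr fun a b h => by linarith) (K := 1)
      (LipschitzWith.of_dist_le_mul fun a b => ?_) fun t ht => ?_
    · rw [Real.dist_eq, Real.dist_eq, abs_sub_comm a b]
      simp only [NNReal.coe_one, one_mul]
      exact le_of_eq (congrArg _ (by ring))
    · constructor <;> linarith [ht.1, ht.2]
  · have := (h2.comp_sub_left (c := 1) (by simp)).symm
    simp only [sub_self, sub_zero] at this
    refine (this.neg).congr ?_
    intro t _
    simp [neg_add_eq_sub]
  · filter_upwards [ae_comp_affine h3 (a := -1) (by norm_num) 1] with t ht htm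
    have := (ht (by constructor <;> linarith [htm.1, htm.2])).comp_affine
    simpa using this
  · simp only [norm_neg, neg_mul, one_mul, neg_add_eq_sub]
    rw [intervalIntegral.integral_comp_sub_left (fun t => ‖u t‖) 1]
    simp

end Length

/-! ### Concatenation, dilation and a lower bound for lengths -/

section Length

variable {E : Type*} [NormedAddCommGroup E] [NormedSpace ℝ E] [FiniteDimensional ℝ E]
  {G : Type*} [TopologicalSpace G] [ChartedSpace E G] [Group G]
  [LieGroup 𝓘(ℝ, E) ∞ G] [IsTopologicalGroup G] {m : ℕ}
  {X : Fin m → E} {x y z : G} {L L' : ℝ}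

theorem add_mem_lengths (h : L ∈ lengths X x y) (h' : L' ∈ lengths X y z) :
    L + L' ∈ lengths X x z := by
  obtain ⟨γ, u, ⟨h1, h2, h3⟩, rfl, hy, rfl⟩ := h
  obtain ⟨γ', u', ⟨h1', h2', h3'⟩, hy', rfl, rfl⟩ := h'
  have hm1 : Monotone fun t : ℝ => min (2 * t) 1 := fun a b h => min_le_min (by linarith) le_rfl
  have hm2 : Monotone fun t : ℝ => max (2 * t - 1) 0 := fun a b h =>
    max_le_max (by linarith) le_rfl
  have hl : LipschitzWith 2 fun t : ℝ => 2 * t := by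
    refine LipschitzWith.of_dist_le_mul fun a b => ?_
    rw [Real.dist_eq, Real.dist_eq, ← mul_sub, abs_mul]
    simp
  have hl1 : LipschitzWith 2 fun t : ℝ => min (2 * t) 1 := hl.min_const 1
  have hl2' : LipschitzWith 2 fun t : ℝ => 2 * t - 1 := by
    refine LipschitzWith.of_dist_le_mul fun a b => ?_
    have := hl.dist_le_mul a b
    simpa [Real.dist_eq] using this
  have hl2 : LipschitzWith 2 fun t : ℝ => max (2 * t - 1) 0 := hl2'.max_const 0
  have hr1 : MapsTo (fun t : ℝ => min (2 * t) 1) (Icc 0 1) (Icc 0 1) := fun t ht =>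
    ⟨le_min (by linarith [ht.1]) zero_le_one, min_le_right _ _⟩
  have hr2 : MapsTo (fun t : ℝ => max (2 * t - 1) 0) (Icc 0 1) (Icc 0 1) := fun t ht =>
    ⟨le_max_right _ _, max_le (by linarith [ht.2]) zero_le_one⟩
  have c1 := h1.comp zero_le_one zero_le_one (.inl hm1) hl1 hr1
  have c2 := h1'.comp zero_le_one zero_le_one (.inl hm2) hl2 hr2
  -- At every time one of the two curve factors is frozen at y, so the product concatenates the
  -- curves without a case distinction.
  let β : ℝ → G := fun t => γ (min (2 * t) 1) * y⁻¹ * γ' (max (2 * t - 1) 0)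
  have e1 : ∀ t : ℝ, t ≤ 1 / 2 → β t = γ (2 * t) := fun t ht => by
    simp only [β]
    rw [min_eq_left (by linarith), max_eq_right (by linarith), hy']; group
  have e2 : ∀ t : ℝ, 1 / 2 ≤ t → β t = γ' (2 * t - 1) := fun t ht => by
    simp only [β]
    rw [min_eq_right (by linarith), max_eq_left (by linarith), hy]; group
  let w : ℝ → EuclideanSpace ℝ (Fin m) := fun t =>
    if t ≤ 1 / 2 then (2 : ℝ) • u (2 * t) else (2 : ℝ) • u' (2 * t - 1)
  have w1 : ∀ t : ℝ, t ≤ 1 / 2 → w t = (2 : ℝ) • u (2 * t) := fun t ht => if_pos ht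
  have w2 : ∀ t : ℝ, 1 / 2 < t → w t = (2 : ℝ) • u' (2 * t - 1) := fun t ht =>
    if_neg (not_le.2 ht)
  have i1 : IntervalIntegrable w volume 0 (1 / 2) := by
    have := (h2.comp_mul_left (c := 2) (by simp) (by simp)).smul (2 : ℝ)
    simp only [zero_div] at this
    refine this.congr fun t ht => ?_
    rw [uIoc_of_le (by norm_num)] at ht
    exact (w1 t ht.2).symm
  have i2 : IntervalIntegrable w volume (1 / 2) 1 := by
    have := ((h2'.comp_sub_right 1 (by simp)).comp_mul_left (c := 2) (by simp) (by simp)).smul (2 : ℝ)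
    norm_num at this
    refine this.congr fun t ht => ?_
    rw [uIoc_of_le (by norm_num)] at ht
    exact (w2 t ht.1).symm
  refine ⟨β, w, ⟨⟨?_, fun φ hφ => ?_⟩, i1.trans i2, ?_⟩, ?_, ?_, ?_⟩
  · exact (c1.1.mul continuousOn_const).mul c2.1
  · have := ((c1.2 φ hφ).fun_add (c2.2 φ hφ)).fun_add
      (LipschitzOnWith.absolutelyContinuousOnInterval (f := fun _ => -φ y) (K := 0)
        (LipschitzWith.const' (-φ y)).lipschitzOnWith)
    -- For the same reason φ ∘ β is a sum of two reparametrized absolutely continuous functions and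
    -- a constant.
    have he : φ ∘ β = fun t => (φ ∘ fun t => γ (min (2 * t) 1)) t +
        (φ ∘ fun t => γ' (max (2 * t - 1) 0)) t + -φ y := by
      funext t
      rcases le_total t (1 / 2) with ht | ht
      · simp only [Function.comp, e1 t ht]
        rw [min_eq_left (by linarith), max_eq_right (by linarith), hy']; ring
      · simp only [Function.comp, e2 t ht]
        rw [min_eq_right (by linarith), max_eq_left (by linarith), hy]; ring
    rw [he]
    exact this
  · filter_upwards [ae_comp_affine h3 two_ne_zero 0, ae_comp_affine h3' two_ne_zero (-1),
      Measure.ae_ne volume (1 / 2 : ℝ)] with t ht ht' hne htm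
    rcases lt_or_gt_of_ne hne with hlt | hgt
    · have := (ht (by constructor <;> linarith [htm.1])).comp_affine
      rw [w1 t hlt.le, map_smul, ← add_zero (2 * t)]
      refine this.congr ?_
      filter_upwards [eventually_lt_nhds hlt] with x hx
      rw [e1 x hx.le, add_zero]
    · have := (ht' (by constructor <;> linarith [htm.2])).comp_affine
      rw [w2 t hgt, map_smul, sub_eq_add_neg]
      refine this.congr ?_
      filter_upwards [eventually_gt_nhds hgt] with x hx
      rw [e2 x hx.le, sub_eq_add_neg]
  · rw [e1 0 (by norm_num), mul_zero]
  · rw [e2 1 (by norm_num)]; norm_num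
  · rw [← intervalIntegral.integral_add_adjacent_intervals i1.norm i2.norm]
    congr 1
    · have : ∫ t in (0 : ℝ)..(1 / 2), ‖w t‖ = ∫ t in (0 : ℝ)..(1 / 2), 2 * ‖u (2 * t)‖ := by
        refine intervalIntegral.integral_congr_ae (.of_forall fun t ht => ?_)
        rw [uIoc_of_le (by norm_num)] at ht
        rw [w1 t ht.2, norm_smul]; simp
      rw [this, intervalIntegral.integral_const_mul,
        intervalIntegral.mul_integral_comp_mul_left (f := fun t => ‖u t‖)]
      norm_num
    · have : ∫ t in (1 / 2 : ℝ)..1, ‖w t‖ = ∫ t in (1 / 2 : ℝ)..1, 2 * ‖u' (2 * t - 1)‖ := by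
        refine intervalIntegral.integral_congr_ae (.of_forall fun t ht => ?_)
        rw [uIoc_of_le (by norm_num)] at ht
        rw [w2 t ht.1, norm_smul]; simp
      rw [this, intervalIntegral.integral_const_mul,
        intervalIntegral.mul_integral_comp_mul_sub (f := fun t => ‖u' t‖)]
      norm_num

theorem contMDiff_expE_smul {n : ℕ} (hN : ∀ z : E, adL G z ^ n = 0) (U : E) :
    ContMDiff 𝓘(ℝ, ℝ) 𝓘(ℝ, E) ∞ (fun t : ℝ => expE G (t • U)) := by
  intro t₀
  have h1 : ContMDiffAt 𝓘(ℝ, ℝ) 𝓘(ℝ, E) ∞ (fun t : ℝ => (t - t₀) • U) t₀ :=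
    ContDiff.contMDiff (by fun_prop) t₀
  have h2 : ContMDiffAt 𝓘(ℝ, E) 𝓘(ℝ, E) ∞ (expE (E := E) G) ((t₀ - t₀) • U) := by
    rw [sub_self, zero_smul]; exact contMDiffAt_expE hN
  have h3 : ContMDiffAt 𝓘(ℝ, ℝ) 𝓘(ℝ, E) ∞
      (fun t : ℝ => expE G (t₀ • U) * expE G ((t - t₀) • U)) t₀ :=
    contMDiffAt_const.mul (ContMDiffAt.comp (f := fun t : ℝ => (t - t₀) • U) t₀ h2 h1)
  refine h3.congr_of_eventuallyEq (.of_forall fun t => ?_)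
  beta_reduce
  rw [← expE_add_smul, add_sub_cancel]

theorem norm_mem_lengths {n : ℕ} (hN : ∀ z : E, adL G z ^ n = 0) (x : G)
    (v : EuclideanSpace ℝ (Fin m)) : ‖v‖ ∈ lengths X x (x * expE G (combo X v)) := by
  have hs : ContMDiff 𝓘(ℝ, ℝ) 𝓘(ℝ, E) ∞ (fun t : ℝ => x * expE G (t • combo X v)) :=
    contMDiff_const.mul (contMDiff_expE_smul hN _)
  refine ⟨fun t => x * expE G (t • combo X v), fun _ => v, ⟨⟨hs.continuous.continuousOn,
    fun φ hφ => ?_⟩, intervalIntegrable_const, .of_forall fun t _ =>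
      (hasLeftDeriv_expE_smul _ t).const_mul x⟩, by simp, by simp, by simp⟩
  have h1 : ContDiff ℝ ∞ (φ ∘ fun t : ℝ => x * expE G (t • combo X v)) :=
    (hφ.comp hs).contDiff
  exact (h1.of_le (by simp)).contDiffOn.absolutelyContinuousOnInterval

/-- The left-invariant differential of a smooth function. -/
noncomputable def leftDiff (ψ : G → ℝ) (g : G) : E →L[ℝ] ℝ :=
  fderiv ℝ (fun y : E => ψ (g * chartInv G y)) (chart E (1 : G))

theorem hasDerivAt_comp_of_hasLeftDeriv {ψ : G → ℝ} (hψ : ContMDiff 𝓘(ℝ, E) 𝓘(ℝ, ℝ) ∞ ψ)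
    {γ : ℝ → G} {t : ℝ} {c : E} (h : HasLeftDeriv γ t c) :
    HasDerivAt (fun s => ψ (γ s)) (leftDiff ψ (γ t) c) t := by
  have h1 : ContMDiffAt 𝓘(ℝ, E) 𝓘(ℝ, ℝ) ∞ (fun y : E => ψ (γ t * chartInv G y))
      (chart E (1 : G)) :=
    hψ.contMDiffAt.comp _ (contMDiffAt_const.mul (contMDiffAt_chartInv chart_one_mem))
  have h2 : HasFDerivAt (fun y : E => ψ (γ t * chartInv G y)) (leftDiff ψ (γ t))
      (chart E ((γ t)⁻¹ * γ t)) := by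
    rw [inv_mul_cancel]
    exact (h1.contDiffAt.differentiableAt (by simp)).hasFDerivAt
  refine (h2.comp_hasDerivAt t h.2).congr_of_eventuallyEq ?_
  filter_upwards [h.eventually_eq] with s hs
  exact congrArg ψ hs.symm

theorem continuous_leftDiff {ψ : G → ℝ} (hψ : ContMDiff 𝓘(ℝ, E) 𝓘(ℝ, ℝ) ∞ ψ) :
    Continuous (leftDiff (E := E) ψ) := by
  rw [continuous_iff_continuousAt]
  intro g
  set p := chart E (1 : G)
  let Φ : E × E → ℝ := fun z => ψ (g * chartInv G z.1 * chartInv G z.2)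
  have h1 : ContMDiffAt 𝓘(ℝ, E × E) 𝓘(ℝ, ℝ) ∞ Φ (p, p) :=
    hψ.contMDiffAt.comp _ ((contMDiffAt_const.mul (contMDiffAt_chartInv_comp contDiffAt_fst
      chart_one_mem)).mul (contMDiffAt_chartInv_comp contDiffAt_snd chart_one_mem))
  have h2 : ContDiffAt ℝ ∞ Φ (p, p) := h1.contDiffAt
  have h3 : ContDiffAt ℝ ∞ (fun z : E => fderiv ℝ (fun y => Φ (z, y)) p) p :=
    ContDiffAt.fderiv (f := fun z y => Φ (z, y)) (g := fun _ => p) (n := ∞) (m := ∞)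
      (by exact h2) contDiffAt_const (by simp)
  have h4 : Tendsto (fun x : G => g⁻¹ * x) (𝓝 g) (𝓝 1) := by
    simpa using (continuous_const_mul g⁻¹).tendsto g
  have h5 : ContinuousAt (fun x : G => chart E (g⁻¹ * x)) g := by
    refine ContinuousAt.comp (f := fun x : G => g⁻¹ * x) ?_ (by fun_prop)
    rw [inv_mul_cancel]
    exact continuousAt_chart one_mem_chartDom
  have h6 : ContinuousAt (fun z : E => fderiv ℝ (fun y => Φ (z, y)) p) (chart E (g⁻¹ * g)) := by
    rw [inv_mul_cancel]; exact h3.continuousAt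
  refine (ContinuousAt.comp (f := fun x : G => chart E (g⁻¹ * x)) h6 h5).congr ?_
  filter_upwards [h4 (chartDom_mem_nhds_one (E := E))] with x hx
  simp only [Function.comp, Φ, leftDiff]
  rw [chartInv_chart hx, mul_inv_cancel_left]

theorem exists_bound_leftDiff {ψ : G → ℝ} (hψ : ContMDiff 𝓘(ℝ, E) 𝓘(ℝ, ℝ) ∞ ψ)
    (hc : HasCompactSupport ψ) : ∃ C, 0 < C ∧ ∀ g, ‖leftDiff (E := E) ψ g‖ ≤ C := by
  obtain ⟨C, hC⟩ := hc.exists_bound_of_continuousOn (continuous_leftDiff (E := E) hψ).continuousOn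
  refine ⟨max C 1, by positivity, fun g => ?_⟩
  by_cases hg : g ∈ tsupport ψ
  · exact (hC g hg).trans (le_max_left _ _)
  · have h0 : ψ =ᶠ[𝓝 g] 0 := notMem_tsupport_iff_eventuallyEq.1 hg
    have h1 : Tendsto (fun y : E => g * chartInv G y) (𝓝 (chart E (1 : G))) (𝓝 g) := by
      have := ((continuousAt_chartInv (E := E) (G := G) chart_one_mem).tendsto).const_mul g
      simpa using this
    have h2 : (fun y : E => ψ (g * chartInv G y)) =ᶠ[𝓝 (chart E (1 : G))] fun _ => 0 := by
      filter_upwards [h1 h0] with y hy using hy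
    have : leftDiff (E := E) ψ g = 0 := by
      rw [leftDiff, h2.fderiv_eq, fderiv_const_apply]
    rw [this, norm_zero]
    positivity

/-- The fundamental theorem of calculus along the curve: absolute continuity is defined by testing
with smooth functions, and the derivative of ψ ∘ γ is the left differential of ψ applied to the
control. -/
theorem abs_sub_le_of_mem_lengths {ψ : G → ℝ} (hψ : ContMDiff 𝓘(ℝ, E) 𝓘(ℝ, ℝ) ∞ ψ)
    {C : ℝ} (hC : ∀ g, ‖leftDiff (E := E) ψ g‖ ≤ C) (h : L ∈ lengths X x y) :
    |ψ y - ψ x| ≤ C * ‖combo X‖ * L := by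
  obtain ⟨γ, u, ⟨h1, h2, h3⟩, rfl, rfl, rfl⟩ := h
  have hac := h1.2 ψ hψ
  have := hac.integral_deriv_eq_sub
  have hb : ∀ᵐ t, t ∈ Ioc (0 : ℝ) 1 → ‖deriv (ψ ∘ γ) t‖ ≤ C * ‖combo X‖ * ‖u t‖ := by
    filter_upwards [h3] with t ht htm
    have hd := (hasDerivAt_comp_of_hasLeftDeriv hψ (ht ⟨htm.1.le, htm.2⟩)).deriv
    have hd' : deriv (ψ ∘ γ) t = leftDiff (E := E) ψ (γ t) (combo X (u t)) := hd
    rw [hd']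
    calc ‖leftDiff (E := E) ψ (γ t) (combo X (u t))‖
          ≤ ‖leftDiff (E := E) ψ (γ t)‖ * (‖combo X‖ * ‖u t‖) :=
          (leftDiff (E := E) ψ (γ t)).le_opNorm_of_le ((combo X).le_opNorm _)
      _ ≤ C * (‖combo X‖ * ‖u t‖) := by gcongr; exact hC _
      _ = _ := by ring
  have key := intervalIntegral.norm_integral_le_of_norm_le (μ := volume) zero_le_one hb
    ((h2.norm).const_mul _)
  rw [this, intervalIntegral.integral_const_mul] at key
  exact key

/-- Points that can be reached from `1` by short horizontal curves are close to `1`. -/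
theorem exists_lengths_lt_mem (X : Fin m → E) {N : Set G} (hN : N ∈ 𝓝 (1 : G)) :
    ∃ ε > 0, ∀ y : G, ∀ L ∈ lengths X 1 y, L < ε → y ∈ N := by
  have := t2Space_of_chartedSpace E G
  have : IsManifold 𝓘(ℝ, E) ∞ G := inferInstance
  obtain ⟨f, hf, -⟩ := (SmoothBumpFunction.nhds_basis_support (I := 𝓘(ℝ, E)) hN).mem_iff.1 hN
  obtain ⟨C, hC0, hC⟩ := exists_bound_leftDiff (E := E) f.contMDiff f.hasCompactSupport
  -- The bump function is 1 at the identity and 0 outside N, so leaving N costs a length L with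
  -- C‖combo X‖L ≥ 1. The added 1 covers `combo X = 0`.
  refine ⟨1 / (C * ‖combo X‖ + 1), by positivity, fun y L hL hlt => ?_⟩
  by_contra hy
  have h1 := abs_sub_le_of_mem_lengths f.contMDiff hC hL
  have h2 : f y = 0 := by
    by_contra h
    exact hy (hf (subset_closure h))
  rw [h2, f.eq_one] at h1
  have h3 := nonneg_of_mem_lengths hL
  rw [lt_div_iff₀ (by positivity)] at hlt
  norm_num at h1
  linarith

/-- The velocity lies in the first layer, where δ_τ is multiplication by τ, so the dilated curve has
control τu. -/
theorem dilation_mem_lengths [SimplyConnectedSpace G] {s : ℕ} (S : Stratification E G s)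
    (hX : ∀ j, X j ∈ S.lay 1) (τ : ℝ) (h : L ∈ lengths X x y) :
    |τ| * L ∈ lengths X (S.dilation τ x) (S.dilation τ y) := by
  obtain ⟨γ, u, ⟨h1, h2, h3⟩, rfl, rfl, rfl⟩ := h
  refine ⟨fun t => S.dilation τ (γ t), fun t => τ • u t,
    ⟨h1.map (S.contMDiff_dilation τ), h2.smul τ, ?_⟩, rfl, rfl, ?_⟩
  · filter_upwards [h3] with t ht htm
    have hmem : combo X (u t) ∈ S.lay 1 := by
      rw [combo_apply]
      exact Submodule.sum_mem _ fun j _ => Submodule.smul_mem _ _ (hX j)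
    rw [map_smul]
    have := S.hasLeftDeriv_dilation τ (ht htm)
    rwa [S.dil_of_mem hmem, pow_one] at this
  · simp only [norm_smul, Real.norm_eq_abs, intervalIntegral.integral_const_mul]

end Length

/-! ### Chow's theorem: connecting points by short horizontal curves -/

section Chow

variable {E : Type*} [NormedAddCommGroup E] [NormedSpace ℝ E] [FiniteDimensional ℝ E]
  {G : Type*} [TopologicalSpace G] [ChartedSpace E G] [Group G]
  [LieGroup 𝓘(ℝ, E) ∞ G] [IsTopologicalGroup G] {m : ℕ}
  {X : Fin m → E} {g h : G} {L L' : ℝ}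

theorem mul_mem_lengths_one (hg : L ∈ lengths X 1 g) (hh : L' ∈ lengths X 1 h) :
    L + L' ∈ lengths X 1 (g * h) := by
  have := mul_left_mem_lengths g hh
  rw [mul_one] at this
  exact add_mem_lengths hg this

theorem inv_mem_lengths_one (hg : L ∈ lengths X 1 g) : L ∈ lengths X 1 g⁻¹ := by
  simpa using mul_left_mem_lengths g⁻¹ (lengths_symm hg)

variable {s : ℕ} (S : Stratification E G s)

theorem Stratification.norm_mem_lengths_one (S : Stratification E G s) (X : Fin m → E)
    (v : EuclideanSpace ℝ (Fin m)) : ‖v‖ ∈ lengths X 1 (expE G (combo X v)) := by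
  simpa using norm_mem_lengths (X := X) S.adL_pow 1 v

theorem Stratification.zero_mem_lengths (S : Stratification E G s) (X : Fin m → E) (g : G) :
    0 ∈ lengths X g g := by
  simpa using norm_mem_lengths (X := X) S.adL_pow g 0

/-- The subgroup of the points that can be reached from `1` by horizontal curves. -/
def Stratification.reachable (S : Stratification E G s) (X : Fin m → E) : Subgroup G where
  carrier := {g | (lengths X 1 g).Nonempty}
  one_mem' := ⟨0, S.zero_mem_lengths X 1⟩
  mul_mem' := fun ⟨_, hg⟩ ⟨_, hh⟩ => ⟨_, mul_mem_lengths_one hg hh⟩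
  inv_mem' := fun ⟨_, hg⟩ => ⟨_, inv_mem_lengths_one hg⟩

/-- The span M is stable under Ad of reachable points, in particular of exp(ta) with a in the first
layer. Differentiating at t = 0 inside the closed subspace M gives stability under ad a, and the
first layer generates the algebra. -/
theorem Stratification.span_Ad_reachable (hX : ∀ U ∈ S.lay 1, ∃ v, combo X v = U) :
    Submodule.span ℝ {w : E | ∃ h ∈ S.reachable X, ∃ U ∈ S.lay 1, w = Ad h U} = ⊤ := by
  set M := Submodule.span ℝ {w : E | ∃ h ∈ S.reachable X, ∃ U ∈ S.lay 1, w = Ad h U} with hM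
  refine S.eq_top_of_stable (fun U hU => Submodule.subset_span ⟨1, one_mem _, U, hU, by simp [Ad_one]⟩)
    fun a ha b hb => ?_
  have hstab : ∀ g ∈ S.reachable X, ∀ b ∈ M, Ad g b ∈ M := by
    intro g hg b hb
    have : M ≤ M.comap ((Ad g : E →L[ℝ] E) : E →ₗ[ℝ] E) := by
      rw [hM, Submodule.span_le]
      rintro _ ⟨h, hh, U, hU, rfl⟩
      exact Submodule.subset_span ⟨g * h, mul_mem hg hh, U, hU, by simp [Ad_mul_apply]⟩
    exact this hb
  have hmem : ∀ t : ℝ, Ad (expE G (t • a)) b ∈ M := by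
    intro t
    obtain ⟨v, hv⟩ := hX _ ((S.lay 1).smul_mem t ha)
    refine hstab _ ⟨‖v‖, ?_⟩ b hb
    rw [← hv]
    exact S.norm_mem_lengths_one X v
  have hd := hasDerivAt_Ad_expE (G := G) a b
  rw [adL_apply]
  have hcl : IsClosed (M : Set E) := Submodule.closed_of_finiteDimensional M
  rw [hasDerivAt_iff_tendsto_slope] at hd
  refine hcl.mem_of_tendsto hd (.of_forall fun t => ?_)
  rw [slope_def_module]
  exact M.smul_mem _ (M.sub_mem (hmem t) (hmem 0))

variable {ι : Type*}

/-- The product of the exponentials of `t k • W k`, `k` in the list `l`. -/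
noncomputable def expProd (G : Type*) [TopologicalSpace G] [ChartedSpace E G] [Group G]
    (W : ι → E) (l : List ι) (t : ι → ℝ) : G :=
  (l.map fun k => expE G (t k • W k)).prod

theorem contMDiffAt_expProd [Fintype ι] {n : ℕ} (hN : ∀ z : E, adL G z ^ n = 0) (W : ι → E)
    (l : List ι) : ContMDiffAt 𝓘(ℝ, ι → ℝ) 𝓘(ℝ, E) ∞ (expProd G W l) 0 := by
  induction l with
  | nil => exact contMDiffAt_const
  | cons k l ih =>
    have h1 : ContMDiffAt 𝓘(ℝ, ι → ℝ) 𝓘(ℝ, E) ∞ (fun t : ι → ℝ => t k • W k) 0 :=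
      ContDiff.contMDiff (by fun_prop) 0
    have h2 : ContMDiffAt 𝓘(ℝ, E) 𝓘(ℝ, E) ∞ (expE (E := E) G) ((0 : ι → ℝ) k • W k) := by
      rw [Pi.zero_apply, zero_smul]; exact contMDiffAt_expE hN
    exact (ContMDiffAt.comp (f := fun t : ι → ℝ => t k • W k) 0 h2 h1).mul ih

theorem expProd_zero (W : ι → E) (l : List ι) : expProd G W l 0 = 1 := by
  induction l with
  | nil => rfl
  | cons k l ih =>
    change expE G ((0 : ι → ℝ) k • W k) * expProd G W l 0 = 1
    simp [ih]

theorem hasLeftDeriv_expProd (W : ι → E) (l : List ι) (v : ι → ℝ) :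
    HasLeftDeriv (fun τ : ℝ => expProd G W l (τ • v)) 0 (l.map fun k => v k • W k).sum := by
  induction l with
  | nil => exact hasLeftDeriv_const 1 0
  | cons k l ih =>
    have h1 := (hasLeftDeriv_expE_smul (G := G) (v k • W k) 0).mul ih
    simp only [zero_smul, expProd_zero, inv_one, Ad_one] at h1
    refine h1.congr (.of_forall fun τ => ?_)
    simp [expProd, smul_smul]

theorem exists_bound_expProd {W : ι → E}
    (hW : ∀ k, ∃ R, ∀ t : ℝ, |t| ≤ 1 → ∃ L ∈ lengths X 1 (expE G (t • W k)), L ≤ R)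
    (h1 : (0 : ℝ) ∈ lengths X 1 (1 : G)) (l : List ι) :
    ∃ R, ∀ t : ι → ℝ, (∀ k, |t k| ≤ 1) → ∃ L ∈ lengths X 1 (expProd G W l t), L ≤ R := by
  induction l with
  | nil => exact ⟨0, fun t _ => ⟨0, h1, le_rfl⟩⟩
  | cons k l ih =>
    obtain ⟨R, hR⟩ := ih
    obtain ⟨R', hR'⟩ := hW k
    refine ⟨R' + R, fun t ht => ?_⟩
    obtain ⟨L, hL, hle⟩ := hR t ht
    obtain ⟨L', hL', hle'⟩ := hR' (t k) (ht k)
    exact ⟨L' + L, mul_mem_lengths_one hL' hL, by linarith⟩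

/-- A neighborhood of `1` can be reached from `1` by horizontal curves of bounded length. -/
theorem Stratification.exists_reachable_nhds (hX : ∀ U ∈ S.lay 1, ∃ v, combo X v = U) :
    ∃ R, ∀ᶠ g in 𝓝 (1 : G), ∃ L ∈ lengths X 1 g, L ≤ R := by
  -- A basis of the algebra made of vectors Ad h U with h reachable. Since exp(t Ad h U) = h exp(tU)
  -- h⁻¹, each direction is reached by a curve to h, a horizontal segment and a curve back.
  obtain ⟨b, hb, hspan, hli⟩ := exists_linearIndependent ℝ
    {w : E | ∃ h ∈ S.reachable X, ∃ U ∈ S.lay 1, w = Ad h U}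
  rw [S.span_Ad_reachable hX] at hspan
  have : Finite b := hli.finite
  have : Fintype b := Fintype.ofFinite b
  let W : b → E := Subtype.val
  have hW : ∀ k, ∃ R, ∀ t : ℝ, |t| ≤ 1 → ∃ L ∈ lengths X 1 (expE G (t • W k)), L ≤ R := by
    rintro ⟨w, hw⟩
    obtain ⟨h, ⟨L, hL⟩, U, hU, rfl⟩ := hb hw
    obtain ⟨v, rfl⟩ := hX U hU
    refine ⟨L + ‖v‖ + L, fun t ht => ⟨L + ‖t • v‖ + L, ?_, ?_⟩⟩
    · have := mul_mem_lengths_one (mul_mem_lengths_one hL (S.norm_mem_lengths_one X (t • v)))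
        (inv_mem_lengths_one hL)
      rwa [expE_conj, map_smul, map_smul] at this
    · rw [norm_smul, Real.norm_eq_abs]
      nlinarith [norm_nonneg v]
  obtain ⟨R, hR⟩ := exists_bound_expProd hW (S.zero_mem_lengths X 1) (Finset.univ : Finset b).toList
  refine ⟨R, ?_⟩
  set Ψ : (b → ℝ) → G := expProd G W (Finset.univ : Finset b).toList with hΨ
  have hΨ0 : Ψ 0 = 1 := expProd_zero _ _
  have hc := contMDiffAt_expProd (G := G) S.adL_pow W (Finset.univ : Finset b).toList
  rw [← hΨ] at hc
  set F : (b → ℝ) → E := fun t => chart E (Ψ t) with hF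
  have hFc : ContDiffAt ℝ ∞ F 0 := contDiffAt_chart_comp hc (by rw [hΨ0]; exact one_mem_chartDom)
  have hs := hFc.hasStrictFDerivAt (by simp)
  have hd : ∀ v, fderiv ℝ F 0 v = ∑ k, v k • W k := by
    intro v
    have h2 : HasDerivAt (fun τ : ℝ => τ • v) v 0 := by
      simpa using (hasDerivAt_id (0 : ℝ)).smul_const v
    have h3 : HasFDerivAt F (fderiv ℝ F 0) ((0 : ℝ) • v) := by
      rw [zero_smul]; exact hs.hasFDerivAt
    have h4 := h3.comp_hasDerivAt 0 h2
    have h5 := (hasLeftDeriv_expProd (G := G) W (Finset.univ : Finset b).toList v).2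
    simp only [zero_smul, expProd_zero, inv_one, one_mul, Finset.sum_map_toList] at h5
    exact h4.unique h5
  have hsurj : (fderiv ℝ F 0).range = ⊤ := by
    rw [LinearMap.range_eq_top]
    intro w
    have : w ∈ Submodule.span ℝ (range W) := by
      rw [Subtype.range_coe, hspan]; trivial
    obtain ⟨c, hc⟩ := (Submodule.mem_span_range_iff_exists_fun ℝ).1 this
    exact ⟨c, (hd c).trans hc⟩
  -- The product of exponentials is a submersion at 0, so images of boxes of parameters are
  -- neighbourhoods of 1.
  have hmap := hs.map_nhds_eq_of_surj hsurj
  have hbox : ∀ᶠ t in 𝓝 (0 : b → ℝ), (∀ k, |t k| ≤ 1) ∧ Ψ t ∈ chartDom E G := by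
    refine Eventually.and ?_ (hc.continuousAt.eventually_mem
      (by rw [hΨ0]; exact chartDom_mem_nhds_one))
    filter_upwards [Metric.closedBall_mem_nhds (0 : b → ℝ) zero_lt_one] with t ht k
    rw [mem_closedBall_zero_iff] at ht
    exact (norm_le_pi_norm t k).trans ht
  have himg : ∀ᶠ y in 𝓝 (chart E (1 : G)), ∃ t, ((∀ k, |t k| ≤ 1) ∧ Ψ t ∈ chartDom E G) ∧
      F t = y := by
    have h6 : F 0 = chart E (1 : G) := by rw [hF]; beta_reduce; rw [hΨ0]
    rw [← h6, ← hmap, eventually_map]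
    filter_upwards [hbox] with t ht using ⟨t, ht, rfl⟩
  have hch := (continuousAt_chart (one_mem_chartDom (E := E) (G := G))).tendsto.eventually himg
  filter_upwards [hch, chartDom_mem_nhds_one (E := E) (G := G)] with g hg hgm
  obtain ⟨t, ⟨ht, htm⟩, he⟩ := hg
  rw [← chart_injOn htm hgm he]
  exact hR t ht

variable [SimplyConnectedSpace G]

theorem Stratification.continuous_dilation (t : ℝ) : Continuous (S.dilation t : G → G) :=
  (S.contMDiff_dilation t).continuous

/-- Any point can be reached from `1` by a horizontal curve. -/
theorem Stratification.lengths_nonempty (hX : ∀ U ∈ S.lay 1, ∃ v, combo X v = U)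
    (hX' : ∀ j, X j ∈ S.lay 1) (x y : G) : (lengths X x y).Nonempty := by
  have key : ∀ g : G, (lengths X 1 g).Nonempty := by
    intro g
    obtain ⟨R, hR⟩ := S.exists_reachable_nhds hX
    obtain ⟨Y, rfl⟩ := S.exists_expE_eq g
    have h1 : ∀ᶠ Y in 𝓝 (0 : E), ∃ L ∈ lengths X 1 (expE G Y), L ≤ R := by
      have h0 : Tendsto (expE (E := E) G) (𝓝 0) (𝓝 1) := by
        simpa using (continuous_expE (G := G) S.adL_pow).tendsto 0
      exact h0.eventually hR
    obtain ⟨r, hr, h⟩ := S.exists_dil_mem h1 ‖Y‖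
    obtain ⟨L, hL, -⟩ := h Y le_rfl
    have h2 := dilation_mem_lengths S hX' r⁻¹ hL
    rw [S.dilation_one_right, S.dilation_expE, S.dil_inv_dil hr.ne'] at h2
    exact ⟨_, h2⟩
  obtain ⟨L, hL⟩ := key (x⁻¹ * y)
  have := mul_left_mem_lengths x hL
  rw [mul_one, mul_inv_cancel_left] at this
  exact ⟨L, this⟩

/-- Points close to `1` can be reached from `1` by short horizontal curves. -/
theorem Stratification.eventually_exists_lengths_lt (hX : ∀ U ∈ S.lay 1, ∃ v, combo X v = U)
    (hX' : ∀ j, X j ∈ S.lay 1) {ε : ℝ} (hε : 0 < ε) :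
    ∀ᶠ g in 𝓝 (1 : G), ∃ L ∈ lengths X 1 g, L < ε := by
  obtain ⟨R, hR⟩ := S.exists_reachable_nhds hX
  -- For g near 1, δ_{1/r} g is still reached with length at most R; dilating back by r gives length
  -- at most r|R| < ε.
  set r := ε / (|R| + 1) with hr
  have hr0 : 0 < r := by positivity
  have h1 : Tendsto (S.dilation r⁻¹ : G → G) (𝓝 1) (𝓝 1) := by
    have := (S.continuous_dilation r⁻¹).tendsto (1 : G)
    rwa [S.dilation_one_right] at this
  filter_upwards [h1.eventually hR] with g hg
  obtain ⟨L, hL, hle⟩ := hg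
  have h2 := dilation_mem_lengths S hX' r hL
  rw [S.dilation_one_right, S.dilation_dilation, mul_inv_cancel₀ hr0.ne', S.dilation_one_left] at h2
  refine ⟨_, h2, ?_⟩
  rw [abs_of_pos hr0, hr, div_mul_eq_mul_div, div_lt_iff₀ (by positivity)]
  have := le_abs_self R
  nlinarith

end Chow

/-! ### Invariance, homogeneity and topology of the distance -/

section Distance

variable {E : Type*} [NormedAddCommGroup E] [NormedSpace ℝ E] [FiniteDimensional ℝ E]
  {G : Type*} [TopologicalSpace G] [ChartedSpace E G] [Group G]
  [LieGroup 𝓘(ℝ, E) ∞ G] [IsTopologicalGroup G] [SimplyConnectedSpace G] {m s : ℕ}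
  (S : Stratification E G s) {X : Fin m → E}

theorem ccDist_nonneg (X : Fin m → E) (x y : G) : 0 ≤ ccDist (E := E) X x y := by
  rw [ccDist_eq]
  exact Real.sInf_nonneg fun L hL => nonneg_of_mem_lengths hL

theorem ccDist_le {x y : G} {L : ℝ} (h : L ∈ lengths X x y) : ccDist (E := E) X x y ≤ L := by
  rw [ccDist_eq]
  exact csInf_le ⟨0, fun L hL => nonneg_of_mem_lengths hL⟩ h

theorem ccDist_mul_left (X : Fin m → E) (g x y : G) :
    ccDist (E := E) X (g * x) (g * y) = ccDist (E := E) X x y := by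
  rw [ccDist_eq, ccDist_eq, lengths_mul_left]

theorem ccDist_comm (X : Fin m → E) (x y : G) :
    ccDist (E := E) X x y = ccDist (E := E) X y x := by
  rw [ccDist_eq, ccDist_eq]
  exact congrArg sInf (Subset.antisymm (fun _ => lengths_symm) fun _ => lengths_symm)

variable (hX : ∀ U ∈ S.lay 1, ∃ v, combo X v = U) (hX' : ∀ j, X j ∈ S.lay 1)

include hX hX' in
-- Needs Chow's theorem: the infimum of an empty set of lengths would be 0 by convention.
theorem Stratification.exists_lengths_lt {x y : G} {c : ℝ} (h : ccDist (E := E) X x y < c) :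
    ∃ L ∈ lengths X x y, L < c := by
  rw [ccDist_eq] at h
  exact exists_lt_of_csInf_lt (S.lengths_nonempty hX hX' x y) h

include hX hX' in
theorem Stratification.ccDist_dilation_le (t : ℝ) (x y : G) :
    ccDist (E := E) X (S.dilation t x) (S.dilation t y) ≤ |t| * ccDist (E := E) X x y := by
  have key : ∀ L ∈ lengths X x y, ccDist (E := E) X (S.dilation t x) (S.dilation t y) ≤ |t| * L :=
    fun L hL => ccDist_le (dilation_mem_lengths S hX' t hL)
  rcases eq_or_ne t 0 with rfl | ht
  · obtain ⟨L, hL⟩ := S.lengths_nonempty hX hX' x y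
    simpa using key L hL
  · rw [← div_le_iff₀' (abs_pos.2 ht), ccDist_eq X x y]
    refine le_csInf (S.lengths_nonempty hX hX' x y) fun L hL => ?_
    rw [div_le_iff₀' (abs_pos.2 ht)]
    exact key L hL

include hX hX' in
theorem Stratification.eventually_ccDist_lt {ε : ℝ} (hε : 0 < ε) :
    ∀ᶠ g in 𝓝 (1 : G), ccDist (E := E) X 1 g < ε := by
  filter_upwards [S.eventually_exists_lengths_lt hX hX' hε] with g hg
  obtain ⟨L, hL, h⟩ := hg
  exact (ccDist_le hL).trans_lt h

include hX hX' in
theorem Stratification.exists_ccDist_lt_mem {N : Set G} (hN : N ∈ 𝓝 (1 : G)) :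
    ∃ ε > 0, ∀ y : G, ccDist (E := E) X 1 y < ε → y ∈ N := by
  obtain ⟨ε, hε, h⟩ := exists_lengths_lt_mem X hN
  refine ⟨ε, hε, fun y hy => ?_⟩
  obtain ⟨L, hL, hlt⟩ := S.exists_lengths_lt hX hX' hy
  exact h y L hL hlt

include hX hX' in
/-- Right translation by `exp (t U)` is continuous at the scale `t`, uniformly in `t`. -/
theorem Stratification.exists_ccDist_mul_exp_le {U : E} (hU : U ∈ S.lay 1) {ε : ℝ} (hε : 0 < ε) :
    ∃ c > 0, ∀ t : ℝ, t ≠ 0 → ∀ y z : G, ccDist (E := E) X y z < c * |t| →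
      ccDist (E := E) X (y * expE G (t • U)) (z * expE G (t • U)) ≤ ε * |t| := by
  have h1 : Tendsto (fun v : G => (expE G U)⁻¹ * v * expE G U) (𝓝 1) (𝓝 1) := by
    have : Continuous (fun v : G => (expE G U)⁻¹ * v * expE G U) := by fun_prop
    simpa using this.tendsto 1
  obtain ⟨c, hc, h⟩ := S.exists_ccDist_lt_mem hX hX'
    (h1.eventually (S.eventually_ccDist_lt hX hX' hε))
  refine ⟨c, hc, fun t ht y z hyz => ?_⟩
  have ht' := abs_pos.2 ht
  -- Rescaled to unit size, the displacement v satisfies d(1, v) < c, and z exp(tU) = y exp(tU)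
  -- δ_t(exp(-U) v exp(U)). The claim becomes continuity at 1 of conjugation by exp(-U), the same
  -- for all t.
  set v := S.dilation t⁻¹ (y⁻¹ * z) with hv
  have hvd : S.dilation t v = y⁻¹ * z := by
    rw [hv, S.dilation_dilation, mul_inv_cancel₀ ht, S.dilation_one_left]
  have hvlt : ccDist (E := E) X 1 v < c := by
    have h2 := S.ccDist_dilation_le hX hX' t⁻¹ 1 (y⁻¹ * z)
    rw [S.dilation_one_right, ← hv] at h2
    have h3 : ccDist (E := E) X 1 (y⁻¹ * z) = ccDist (E := E) X y z := by
      rw [← ccDist_mul_left X y, mul_one, mul_inv_cancel_left]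
    rw [h3, abs_inv, inv_mul_eq_div] at h2
    exact h2.trans_lt ((div_lt_iff₀ ht').2 hyz)
  have h4 : ccDist (E := E) X 1 ((expE G U)⁻¹ * v * expE G U) < ε := h v hvlt
  have h5 : expE G (t • U) = S.dilation t (expE G U) := by
    rw [S.dilation_expE, S.dil_of_mem hU, pow_one]
  have h6 : z * expE G (t • U) = y * expE G (t • U) *
      S.dilation t ((expE G U)⁻¹ * v * expE G U) := by
    rw [S.dilation_mul, S.dilation_mul, S.dilation_inv, hvd, ← h5]; group
  rw [h6, ← mul_one (y * expE G (t • U)), mul_assoc (y * expE G (t • U)) 1, one_mul,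
    ccDist_mul_left]
  have h7 := S.ccDist_dilation_le hX hX' t 1 ((expE G U)⁻¹ * v * expE G U)
  rw [S.dilation_one_right] at h7
  refine h7.trans ?_
  rw [mul_comm]
  gcongr

include hX hX' in
theorem Stratification.ccDist_mul_exp_smul_le {U V : E} (hU : U ∈ S.lay 1) (hV : V ∈ S.lay 1)
    (t : ℝ) (x : G) : ccDist (E := E) X (x * expE G (t • U)) (x * expE G (t • V)) ≤
      |t| * ccDist (E := E) X (expE G U) (expE G V) := by
  have h : ∀ W ∈ S.lay 1, expE G (t • W) = S.dilation t (expE G W) := fun W hW => by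
    rw [S.dilation_expE, S.dil_of_mem hW, pow_one]
  rw [ccDist_mul_left, h U hU, h V hV]
  exact S.ccDist_dilation_le hX hX' t _ _

include hX hX' in
theorem Stratification.eventually_ccDist_exp_lt (U : E) {ε : ℝ} (hε : 0 < ε) :
    ∀ᶠ V in 𝓝 U, ccDist (E := E) X (expE G U) (expE G V) < ε := by
  have h1 : Tendsto (fun V : E => (expE G U)⁻¹ * expE G V) (𝓝 U) (𝓝 1) := by
    simpa using ((continuous_expE (G := G) S.adL_pow).tendsto U).const_mul (expE G U)⁻¹
  filter_upwards [h1.eventually (S.eventually_ccDist_lt hX hX' hε)] with V hV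
  rwa [← ccDist_mul_left X (expE G U), mul_one, mul_inv_cancel_left] at hV

end Distance

/-! ### Deviation sets: porosity and covering of the irregular points -/

section Porosity

variable {E : Type*} [NormedAddCommGroup E] [NormedSpace ℝ E] [FiniteDimensional ℝ E]
  {G : Type*} [TopologicalSpace G] [ChartedSpace E G] [Group G]
  [LieGroup 𝓘(ℝ, E) ∞ G] [IsTopologicalGroup G] [SimplyConnectedSpace G] {m s : ℕ}
  (S : Stratification E G s) {X : Fin m → E} {f : G → ℝ} {K : ℝ}

/-- The points where `f` has approximate derivative `L` in the direction `U` up to the scale `δ`,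
but where the increments of `f` in the direction `U` at nearby points deviate from it. -/
def Stratification.deviationSet (S : Stratification E G s) (X : Fin m → E) (f : G → ℝ) (U : E)
    (L ε δ : ℝ) : Set G :=
  {x | (∀ t : ℝ, t ≠ 0 → |t| < δ → |f (x * expE G (t • U)) - f x - t * L| ≤ 3 * ε * |t|) ∧
    ∃ᶠ t in 𝓝[≠] (0 : ℝ), ∃ u : G, ccDist (E := E) X u 1 ≤ 1 ∧
      6 * ε * |t| < |f (x * S.dilation t u * expE G (t • U)) - f (x * S.dilation t u) - t * L|}

/-- The holes at a are centred at the bad points a δ_t(u), which lie within |t| of a. If y in A were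
within c|t| of such a centre, the values of f at the two base points and at their translates by
exp(tU) would each differ by at most ε|t|. With the error 3ε|t| allowed at y, the deviation at the
centre would be at most 5ε|t| instead of more than 6ε|t|. -/
theorem Stratification.isPorous_deviationSet (hX : ∀ U ∈ S.lay 1, ∃ v, combo X v = U)
    (hX' : ∀ j, X j ∈ S.lay 1) (hK : 0 < K)
    (hf : ∀ x y, |f x - f y| ≤ K * ccDist (E := E) X x y) {U : E} (hU : U ∈ S.lay 1)
    (L : ℝ) {ε δ : ℝ} (hε : 0 < ε) (hδ : 0 < δ) {A : Set G}
    (hA : A ⊆ S.deviationSet X f U L ε δ) : IsPorous (ccDist (E := E) X) A := by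
  obtain ⟨c₀, hc₀, hc⟩ := S.exists_ccDist_mul_exp_le hX hX' hU (div_pos hε hK)
  -- c₀ controls the translated points and ε / K the base points; f then changes by at most ε|t| in
  -- each pair.
  set c := min c₀ (ε / K) with hcd
  have hcpos : 0 < c := lt_min hc₀ (div_pos hε hK)
  refine ⟨c, hcpos, fun a ha => ?_⟩
  have hfreq := (hA ha).2
  have hsmall : ∀ n : ℕ, ∀ᶠ t in 𝓝[≠] (0 : ℝ), t ≠ 0 ∧ |t| < δ ∧ |t| < 1 / ((n : ℝ) + 1) := by
    intro n
    have h0 : Tendsto (fun t : ℝ => |t|) (𝓝[≠] 0) (𝓝 0) := by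
      have : Tendsto (fun t : ℝ => |t|) (𝓝 0) (𝓝 |0|) := continuous_abs.tendsto 0
      rw [abs_zero] at this
      exact this.mono_left nhdsWithin_le_nhds
    exact eventually_mem_nhdsWithin.and ((h0.eventually_lt_const hδ).and
      (h0.eventually_lt_const (by positivity)))
  have hex : ∀ n : ℕ, ∃ t : ℝ, ∃ u : G, t ≠ 0 ∧ |t| < δ ∧ |t| < 1 / ((n : ℝ) + 1) ∧
      ccDist (E := E) X u 1 ≤ 1 ∧
      6 * ε * |t| < |f (a * S.dilation t u * expE G (t • U)) - f (a * S.dilation t u) - t * L| := by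
    intro n
    obtain ⟨t, ⟨u, h1, h2⟩, h3, h4, h5⟩ := (hfreq.and_eventually (hsmall n)).exists
    exact ⟨t, u, h3, h4, h5, h1, h2⟩
  choose t u ht0 htδ htn hu hdev using hex
  have hdist : ∀ n, ccDist (E := E) X a (a * S.dilation (t n) (u n)) ≤ |t n| := by
    intro n
    have h1 := S.ccDist_dilation_le hX hX' (t n) 1 (u n)
    rw [S.dilation_one_right, ccDist_comm X 1 (u n)] at h1
    have h2 : ccDist (E := E) X a (a * S.dilation (t n) (u n)) =
        ccDist (E := E) X 1 (S.dilation (t n) (u n)) := by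
      conv_lhs => rw [← mul_one a, mul_assoc, one_mul]
      exact ccDist_mul_left X a _ _
    rw [h2]
    calc _ ≤ _ := h1
      _ ≤ |t n| * 1 := by gcongr; exact hu n
      _ = |t n| := mul_one _
  refine ⟨fun n => a * S.dilation (t n) (u n), fun n hn => ?_, ?_, fun n => ?_⟩
  -- At a itself the deviation is at most 3ε|t|, so a is not a bad point.
  · have h1 := hdev n
    beta_reduce at hn
    rw [hn] at h1
    have h2 := (hA ha).1 (t n) (ht0 n) (htδ n)
    have := mul_pos hε (abs_pos.2 (ht0 n))
    linarith
  · refine squeeze_zero (fun n => ccDist_nonneg _ _ _) (fun n => ?_)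
      tendsto_one_div_add_atTop_nhds_zero_nat
    rw [ccDist_comm]
    exact (hdist n).trans (htn n).le
  · rw [eq_empty_iff_forall_notMem]
    rintro y ⟨hy, hyA⟩
    have htp := abs_pos.2 (ht0 n)
    have hlt : ccDist (E := E) X y (a * S.dilation (t n) (u n)) < c * |t n| := by
      refine lt_of_lt_of_le hy ?_
      gcongr
      exact hdist n
    have h1 := hc (t n) (ht0 n) y (a * S.dilation (t n) (u n)) (hlt.trans_le (by
      gcongr; exact min_le_left _ _))
    have h2 := (hf (y * expE G (t n • U)) (a * S.dilation (t n) (u n) * expE G (t n • U))).trans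
      (mul_le_mul_of_nonneg_left h1 hK.le)
    have h3 := (hf y (a * S.dilation (t n) (u n))).trans
      (mul_le_mul_of_nonneg_left (hlt.le.trans (mul_le_mul_of_nonneg_right (min_le_right c₀ (ε / K))
        htp.le)) hK.le)
    have h4 : K * (ε / K * |t n|) = ε * |t n| := by field_simp
    rw [h4] at h2 h3
    have h5 := (hA hyA).1 (t n) (ht0 n) (htδ n)
    have h6 := hdev n
    have := mul_pos hε htp
    have h7 : |f (a * S.dilation (t n) (u n) * expE G (t n • U)) - f (a * S.dilation (t n) (u n)) -
        t n * L| ≤ 5 * (ε * |t n|) := by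
      rw [abs_le] at h2 h3 h5 ⊢
      constructor <;> linarith [h2.1, h2.2, h3.1, h3.2, h5.1, h5.2]
    linarith

/-- Every irregular point belongs to a deviation set with parameters in prescribed dense sets. -/
theorem Stratification.exists_mem_deviationSet (hX : ∀ U ∈ S.lay 1, ∃ v, combo X v = U)
    (hX' : ∀ j, X j ∈ S.lay 1) (hK : 0 < K)
    (hf : ∀ x y, |f x - f y| ≤ K * ccDist (E := E) X x y) {D : Set (S.lay 1)} (hD : Dense D)
    {x : G} {U : E} (hU : U ∈ S.lay 1) {L : ℝ}
    (hd : Tendsto (fun t : ℝ => (f (x * expE G (t • U)) - f x) / t) (𝓝[≠] 0) (𝓝 L))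
    (hx : ¬ TendstoUniformlyOn (fun (t : ℝ) (u : G) =>
        (f (x * S.dilation t u * expE G (t • U)) - f (x * S.dilation t u)) / t)
      (fun _ => L) (𝓝[≠] 0) {u | ccDist (E := E) X u 1 ≤ 1}) :
    ∃ V ∈ D, ∃ (q : ℚ) (n k : ℕ), x ∈ S.deviationSet X f V q (1 / ((n : ℝ) + 1))
      (1 / ((k : ℝ) + 1)) := by
  rw [Metric.tendstoUniformlyOn_iff] at hx
  push Not at hx
  obtain ⟨ε₀, hε₀, hx⟩ := hx
  -- Replacing U by V and L by q costs ε|t| each. At x these errors and that of the limit add up to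
  -- 3ε|t|; at the bad points at least 9ε|t| - 2ε|t| > 6ε|t| remains.
  obtain ⟨n, hn⟩ := exists_nat_one_div_lt (show 0 < ε₀ / 9 by positivity)
  set ε : ℝ := 1 / ((n : ℝ) + 1) with hε
  have hεpos : 0 < ε := by positivity
  obtain ⟨q, hq1, hq2⟩ := exists_rat_btwn (show L < L + ε by linarith)
  have hV : ∃ V ∈ D, ccDist (E := E) X (expE G U) (expE G (V : E)) < ε / K := by
    have h1 : Tendsto (fun V : S.lay 1 => (V : E)) (𝓝 ⟨U, hU⟩) (𝓝 U) :=
      continuous_subtype_val.tendsto _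
    have h2 := h1.eventually (S.eventually_ccDist_exp_lt hX hX' U (div_pos hεpos hK))
    obtain ⟨V, hV, hVD⟩ := mem_closure_iff_nhds.1 (hD ⟨U, hU⟩) _ h2
    exact ⟨V, hVD, hV⟩
  obtain ⟨V, hVD, hV⟩ := hV
  have hcmp : ∀ (t : ℝ) (y : G), |f (y * expE G (t • (V : E))) - f (y * expE G (t • U))| ≤
      ε * |t| := by
    intro t y
    have h1 := S.ccDist_mul_exp_smul_le hX hX' hU V.2 t y
    rw [ccDist_comm] at h1
    calc _ ≤ _ := hf _ _
      _ ≤ K * (|t| * (ε / K)) := by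
        gcongr
        exact h1.trans (by gcongr)
      _ = ε * |t| := by field_simp
  have hqt : ∀ t : ℝ, |t * q - t * L| ≤ ε * |t| := by
    intro t
    rw [← mul_sub, abs_mul, mul_comm]
    gcongr
    rw [abs_le]; constructor <;> linarith
  have hdiv : ∀ (t A : ℝ), t ≠ 0 → |A - t * L| = |A / t - L| * |t| := by
    intro t A ht
    rw [← abs_mul, sub_mul, div_mul_cancel₀ _ ht, mul_comm t]
  have hclose := hd.eventually (Metric.ball_mem_nhds L hεpos)
  rw [eventually_nhdsWithin_iff] at hclose
  obtain ⟨δ, hδ, hball⟩ := Metric.eventually_nhds_iff_ball.1 hclose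
  obtain ⟨k, hk⟩ := exists_nat_one_div_lt hδ
  refine ⟨V, hVD, q, n, k, fun t ht htk => ?_, ?_⟩
  · have h1 := hball t (by rw [mem_ball_zero_iff]; exact htk.trans hk) ht
    have h1 : |(f (x * expE G (t • U)) - f x) / t - L| < ε := h1
    have h2 : |f (x * expE G (t • U)) - f x - t * L| ≤ ε * |t| := by
      rw [hdiv _ _ ht]; gcongr
    have h3 := hcmp t x
    have h4 := hqt t
    rw [abs_le] at h2 h3 h4 ⊢
    constructor <;> linarith [h2.1, h2.2, h3.1, h3.2, h4.1, h4.2]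
  · refine (hx.and_eventually eventually_mem_nhdsWithin).mono ?_
    rintro t ⟨⟨u, hu, hle⟩, ht⟩
    refine ⟨u, hu, ?_⟩
    have ht : t ≠ 0 := ht
    have htp := abs_pos.2 ht
    rw [dist_comm, Real.dist_eq] at hle
    have h2 : ε₀ * |t| ≤ |f (x * S.dilation t u * expE G (t • U)) - f (x * S.dilation t u) -
        t * L| := by
      rw [hdiv _ _ ht]; gcongr
    have h3 := hcmp t (x * S.dilation t u)
    have h4 := hqt t
    have h5 : 9 * ε * |t| ≤ ε₀ * |t| := by gcongr; linarith
    have h6 := mul_pos hεpos htp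
    set A := f (x * S.dilation t u * expE G (t • (V : E)))
    set B := f (x * S.dilation t u * expE G (t • U))
    set C := f (x * S.dilation t u)
    have h7 : |B - C - t * L| ≤ |A - C - t * q| + |A - B| + |t * q - t * L| := by
      have e : B - C - t * L = (A - C - t * q) - (A - B) + (t * q - t * L) := by ring
      rw [e]
      exact (abs_add_le _ _).trans (add_le_add_left (abs_sub _ _) _)
    linarith

end Porosity

end Carnot

/-! ### The proposition -/

theorem proposition4p3 {E : Type*} [NormedAddCommGroup E] [NormedSpace ℝ E]
    [FiniteDimensional ℝ E]
    {G : Type*} [TopologicalSpace G] [ChartedSpace E G] [Group G] [LieGroup 𝓘(ℝ, E) ∞ G]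
    [SimplyConnectedSpace G] {s : ℕ} (S : Carnot.Stratification E G s)
    {m : ℕ} (X : Module.Basis (Fin m) ℝ (S.V 1)) (f : G → ℝ)
    (hf : Carnot.IsLipschitz
      (Carnot.ccDist (fun j => (X j : GroupLieAlgebra 𝓘(ℝ, E) G))) f) :
    Carnot.IsSigmaPorous (Carnot.ccDist (fun j => (X j : GroupLieAlgebra 𝓘(ℝ, E) G)))
      {x | ¬ S.IsRegularPoint X f x} := by
  have : IsTopologicalGroup G := topologicalGroup_of_lieGroup 𝓘(ℝ, E) ∞
  let X' : Fin m → E := fun j => (X j : GroupLieAlgebra 𝓘(ℝ, E) G)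
  have hX' : ∀ j, X' j ∈ S.lay 1 := fun j => (X j).2
  have hX : ∀ U ∈ S.lay 1, ∃ v, Carnot.combo X' v = U := by
    intro U hU
    refine ⟨WithLp.toLp 2 (X.repr ⟨U, hU⟩), ?_⟩
    rw [Carnot.combo_apply]
    have h1 := X.sum_repr ⟨U, hU⟩
    have h2 := congrArg (S.V 1).subtype h1
    rw [map_sum] at h2
    exact h2
  obtain ⟨K₀, hK₀⟩ := hf
  -- The given constant may be zero or negative, while the porosity argument divides by it.
  set K := max K₀ 1
  have hK : 0 < K := lt_of_lt_of_le one_pos (le_max_right _ _)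
  have hf' : ∀ x y, |f x - f y| ≤ K * Carnot.ccDist (E := E) X' x y := fun x y =>
    (hK₀ x y).trans (mul_le_mul_of_nonneg_right (le_max_left _ _) (Carnot.ccDist_nonneg X' x y))
  let D : ℕ → S.lay 1 := TopologicalSpace.denseSeq (S.lay 1)
  have hD : Dense (range D) := TopologicalSpace.denseRange_denseSeq (S.lay 1)
  -- A deviation set may contain regular points; the intersection makes the union equal to the
  -- irregular set and remains porous as a subset of a deviation set.
  let A : ℕ × ℚ × ℕ × ℕ → Set G := fun i =>
    S.deviationSet X' f (D i.1) i.2.1 (1 / ((i.2.2.1 : ℝ) + 1)) (1 / ((i.2.2.2 : ℝ) + 1)) ∩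
      {x | ¬ S.IsRegularPoint X f x}
  obtain ⟨e, he⟩ := exists_surjective_nat (ℕ × ℚ × ℕ × ℕ)
  refine ⟨fun n => A (e n), fun n => ?_, ?_⟩
  · exact S.isPorous_deviationSet hX hX' hK hf' (D (e n).1).2 _ (by positivity) (by positivity)
      inter_subset_left
  · refine Subset.antisymm (fun x hx => ?_) (iUnion_subset fun n => inter_subset_right)
    have hx' : ¬ S.IsRegularPoint X f x := hx
    unfold Carnot.Stratification.IsRegularPoint at hx'
    push Not at hx'
    obtain ⟨U, hU, L, hd, hn⟩ := hx'
    obtain ⟨_, ⟨l, rfl⟩, q, n, k, hmem⟩ :=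
      S.exists_mem_deviationSet hX hX' hK hf' hD hU hd hn
    obtain ⟨i, hi⟩ := he (l, q, n, k)
    refine mem_iUnion.2 ⟨i, ?_⟩
    rw [hi]
    exact ⟨hmem, hx⟩
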